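/- Let $k$ be a field of characteristic zero; all vector spaces are over $k$, and in exponents a homogeneous element stands for its degree. A symmetric graded Lie algebra is a $\mathbb Z$-graded vector space $\mathfrak g$ with a bilinear bracket $[\cdot,\cdot]_{\mathfrak g}$ of degree $1$ such that, for homogeneous $x,y,z$, $[x,y]=(-1)^{xy}[y,x]$ and $[x,[y,z]]=(-1)^{x+1}[[x,y],z]+(-1)^{(x+1)(y+1)}[y,[x,z]]$. A derivation of degree $n$ of a symmetric graded Lie algebra $\mathfrak h$ is a linear map $D$ of degree $n$ with $D[x,y]=(-1)^n[Dx,y]+(-1)^{n(x+1)}[x,Dy]$. An action of $\mathfrak g$ on $\mathfrak h$ is a degree $1$ linear map $\rho:\mathfrak g\to\mathrm{Der}(\mathfrak h)$ such that $\rho([x,y]_{\mathfrak g})=(-1)^{x+1}\bigl(\rho(x)\rho(y)-(-1)^{(x+1)(y+1)}\rho(y)\rho(x)\bigr)$, i.e. $s^{-1}\circ\rho:\mathfrak g\to s^{-1}\mathrm{Der}(\mathfrak h)$ is a homomorphism for the bracket $[s^{-1}D,s^{-1}E]=(-1)^{D}s^{-1}[D,E]$. For graded vector spaces $V,W$ let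 $S(V)=\bigoplus_i S^i(V)$ be the graded symmetric algebra, with product $\odot$, let $\mathrm{Hom}^n(S(V),W)$ be the space of linear maps of degree $n$, and $C^*(V,W)=\bigoplus_{n\in\mathbb Z}\mathrm{Hom}^n(S(V),W)$. For $f\in\mathrm{Hom}^n(S(V),W)$ write $f_i(v_1,\dots,v_i)=f(v_1\odot\cdots\odot v_i)$. Let $\varepsilon(\sigma)$ be the Koszul sign, $v_1\odot\cdots\odot v_p=\varepsilon(\sigma)\,v_{\sigma(1)}\odot\cdots\odot v_{\sigma(p)}$, and $\mathbb S_{(i_1,\dots,i_r)}$ the set of $(i_1,\dots,i_r)$-shuffles. The Nijenhuis–Richardson bracket on $C^*(V,V)$ is $[f,g]_{NR}=f\circ g-(-1)^{mn}g\circ f$ for $f,g$ of degrees $m,n$, where $$(f\circ g)_p(v_1,\dots,v_p)=\sum_{j=0}^{p}\ \sum_{\sigma\in\mathbb S_{(j,p-j)}}\varepsilon(\sigma)\,f_{p-j+1}\bigl(g_j(v_{\sigma(1)},\dots,v_{\sigma(j)}),v_{\sigma(j+1)},\dots,v_{\sigma(p)}\bigr).$$ **Theorem.** Let $\rho$ be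 an action of a symmetric graded Lie algebra $(\mathfrak g,[\cdot,\cdot]_{\mathfrak g})$ on a symmetric graded Lie algebra $(\mathfrak h,[\cdot,\cdot]_{\mathfrak h})$ and let $\lambda\in k$. The following formulas, for homogeneous $v_1,\dots,v_p\in\mathfrak h$, $p\ge0$, give well-defined (and uniquely determined) bilinear, respectively linear, operations on $C^*(\mathfrak h,\mathfrak g)$: for $f\in\mathrm{Hom}^m(S(\mathfrak h),\mathfrak g)$ and $g\in\mathrm{Hom}^n(S(\mathfrak h),\mathfrak g)$, the bracket $[\![f,g]\!]\in\mathrm{Hom}^{m+n+1}(S(\mathfrak h),\mathfrak g)$ with $$\begin{aligned}[\![f,g]\!]_p(v_1,\dots,v_p)=&-\sum_{l=0}^{p-1}\sum_{\sigma\in\mathbb S_{(l,1,p-l-1)}}\varepsilon(\sigma)\,f_{p-l}\bigl(\rho(g_l(v_{\sigma(1)},\dots,v_{\sigma(l)}))v_{\sigma(l+1)},v_{\sigma(l+2)},\dots,v_{\sigma(p)}\bigr)\\&+(-1)^{(m+1)(n+1)}\sum_{l=0}^{p-1}\sum_{\sigma\in\mathbb S_{(l,1,p-l-1)}}\varepsilon(\sigma)\,g_{p-l}\bigl(\rho(f_l(v_{\sigma(1)},\dots,v_{\sigma(l)}))v_{\sigma(l+1)},v_{\sigma(l+2)},\dots,v_{\sigma(p)}\bigr)\\&-\sum_{l=0}^{p}\sum_{\sigma\in\mathbb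 S_{(l,p-l)}}(-1)^{n(v_{\sigma(1)}+\cdots+v_{\sigma(l)})+m+1}\varepsilon(\sigma)\,[f_l(v_{\sigma(1)},\dots,v_{\sigma(l)}),g_{p-l}(v_{\sigma(l+1)},\dots,v_{\sigma(p)})]_{\mathfrak g},\end{aligned}$$ and $d_\lambda g\in\mathrm{Hom}^{n+1}(S(\mathfrak h),\mathfrak g)$ with $$(d_\lambda g)_p(v_1,\dots,v_p)=\sum_{1\le i<j\le p}(-1)^{n+1+v_i(v_1+\cdots+v_{i-1})+v_j(v_1+\cdots+v_{j-1})+v_iv_j}\,g_{p-1}(\lambda[v_i,v_j]_{\mathfrak h},v_1,\dots,\hat v_i,\dots,\hat v_j,\dots,v_p).$$ Then $(sC^*(\mathfrak h,\mathfrak g),[\![\cdot,\cdot]\!],d_\lambda)$, with the suspended grading $(sC^*)^i=\mathrm{Hom}^{i-1}(S(\mathfrak h),\mathfrak g)$, is a differential graded Lie algebra. Moreover, the Nijenhuis–Richardson bracket is well defined on $C^*(\mathfrak g\oplus\mathfrak h,\mathfrak g\oplus\mathfrak h)$ and makes it a graded Lie algebra. Regard $C^*(\mathfrak h,\mathfrak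 g)$ as a subspace of it via $f\mapsto\bigl(((x_1,v_1),\dots,(x_p,v_p))\mapsto(f_p(v_1,\dots,v_p),0)\bigr)$. Let $\mu_{\mathfrak g}+\rho$ and $\lambda\mu_{\mathfrak h}$ be its degree $1$ elements concentrated on $S^2$ and given there by $((x_1,v_1),(x_2,v_2))\mapsto([x_1,x_2]_{\mathfrak g},\rho(x_1)v_2+(-1)^{x_1x_2}\rho(x_2)v_1)$ and $((x_1,v_1),(x_2,v_2))\mapsto(0,\lambda[v_1,v_2]_{\mathfrak h})$. Then for $f$ of degree $m$ and all $g$ in $C^*(\mathfrak h,\mathfrak g)$, $$[\![f,g]\!]=(-1)^m\bigl[[\mu_{\mathfrak g}+\rho,f]_{NR},g\bigr]_{NR},\qquad d_\lambda g=[\lambda\mu_{\mathfrak h},g]_{NR}.$$ -/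

import Mathlib

open scoped DirectSum

namespace HomotopyO

/-!  Conventions.  A `ℤ`-graded vector space is a vector space `V` with a family
`𝒱 : ℤ → Submodule k V` that decomposes it as an internal direct sum.  The sign `(-1)^n`
is `n.negOnePow : ℤˣ`, acting on any additive group. -/

section Graded

/-- `Hom^n(A, B)`: the space of linear maps of degree `n` between two graded vector spaces. -/
def homDeg {k A B : Type*} [Field k] [AddCommGroup A] [Module k A] [AddCommGroup B] [Module k B]
    (𝒜 : ℤ → Submodule k A) (ℬ : ℤ → Submodule k B) (n : ℤ) : Submodule k (A →ₗ[k] B) where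
  carrier := {f | ∀ i, ∀ x ∈ 𝒜 i, f x ∈ ℬ (n + i)}
  add_mem' := fun hf hg i x hx => (ℬ (n + i)).add_mem (hf i x hx) (hg i x hx)
  zero_mem' := fun i _ _ => (ℬ (n + i)).zero_mem
  smul_mem' := fun c _ hf i x hx => (ℬ (n + i)).smul_mem c (hf i x hx)

/-- The grading of the direct sum of two graded vector spaces. -/
def prodDeg {k A B : Type*} [Field k] [AddCommGroup A] [Module k A] [AddCommGroup B] [Module k B]
    (𝒜 : ℤ → Submodule k A) (ℬ : ℤ → Submodule k B) (n : ℤ) : Submodule k (A × B) :=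
  (𝒜 n).prod (ℬ n)

/-- The suspension `sL`, with `(sL)^i = L^(i-1)`; the map `s` is the identity of the underlying
vector space. -/
def suspDeg {k L : Type*} [Field k] [AddCommGroup L] [Module k L]
    (𝓛 : ℤ → Submodule k L) (i : ℤ) : Submodule k L :=
  𝓛 (i - 1)

/-- A graded Lie algebra: a graded vector space with a bracket of degree `0` that is graded
skew-symmetric and satisfies the graded Jacobi identity. -/
structure IsGradedLieAlgebra {k L : Type*} [Field k] [AddCommGroup L] [Module k L]
    (𝓛 : ℤ → Submodule k L) (br : L →ₗ[k] L →ₗ[k] L) : Prop where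
  isInternal : DirectSum.IsInternal 𝓛
  bracket_mem : ∀ i j, ∀ x ∈ 𝓛 i, ∀ y ∈ 𝓛 j, br x y ∈ 𝓛 (i + j)
  skew : ∀ i j, ∀ x ∈ 𝓛 i, ∀ y ∈ 𝓛 j, br x y = -((i * j).negOnePow • br y x)
  jacobi : ∀ i j l, ∀ x ∈ 𝓛 i, ∀ y ∈ 𝓛 j, ∀ z ∈ 𝓛 l,
    br x (br y z) = br (br x y) z + (i * j).negOnePow • br y (br x z)

/-- A differential graded Lie algebra: a graded Lie algebra with a square-zero derivation of
degree `1`. -/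
structure IsDGLieAlgebra {k L : Type*} [Field k] [AddCommGroup L] [Module k L]
    (𝓛 : ℤ → Submodule k L) (br : L →ₗ[k] L →ₗ[k] L) (d : L →ₗ[k] L) : Prop extends
    IsGradedLieAlgebra 𝓛 br where
  d_mem : ∀ i, ∀ x ∈ 𝓛 i, d x ∈ 𝓛 (i + 1)
  d_d : ∀ x, d (d x) = 0
  d_bracket : ∀ i j, ∀ x ∈ 𝓛 i, ∀ y ∈ 𝓛 j,
    d (br x y) = br (d x) y + i.negOnePow • br x (d y)

/-- A symmetric graded Lie algebra: a bracket of degree `1` on a graded vector space, graded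
symmetric and satisfying the graded Leibniz rule. -/
structure IsSymGradedLieAlgebra {k L : Type*} [Field k] [AddCommGroup L] [Module k L]
    (𝓛 : ℤ → Submodule k L) (br : L →ₗ[k] L →ₗ[k] L) : Prop where
  isInternal : DirectSum.IsInternal 𝓛
  bracket_mem : ∀ i j, ∀ x ∈ 𝓛 i, ∀ y ∈ 𝓛 j, br x y ∈ 𝓛 (i + j + 1)
  symm : ∀ i j, ∀ x ∈ 𝓛 i, ∀ y ∈ 𝓛 j, br x y = (i * j).negOnePow • br y x
  leibniz : ∀ i j l, ∀ x ∈ 𝓛 i, ∀ y ∈ 𝓛 j, ∀ z ∈ 𝓛 l,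
    br x (br y z) = (i + 1).negOnePow • br (br x y) z
      + ((i + 1) * (j + 1)).negOnePow • br y (br x z)

/-- `Der^n`: derivations of degree `n` of a symmetric graded Lie algebra. -/
structure IsDerivationOfDegree {k L : Type*} [Field k] [AddCommGroup L] [Module k L]
    (𝓛 : ℤ → Submodule k L) (br : L →ₗ[k] L →ₗ[k] L) (n : ℤ) (D : L →ₗ[k] L) : Prop where
  mem_homDeg : D ∈ homDeg 𝓛 𝓛 n
  map_bracket : ∀ i j, ∀ x ∈ 𝓛 i, ∀ y ∈ 𝓛 j,
    D (br x y) = n.negOnePow • br (D x) y + (n * (i + 1)).negOnePow • br x (D y)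

/-- The graded commutator `[D, E] = D E - (-1)^(mn) E D` of endomorphisms of degrees `m`, `n`. -/
def gradedCommutator {k L : Type*} [Field k] [AddCommGroup L] [Module k L] (m n : ℤ)
    (D E : L →ₗ[k] L) : L →ₗ[k] L :=
  D ∘ₗ E - (m * n).negOnePow • (E ∘ₗ D)

/-- An action of the symmetric graded Lie algebra `(G, brG)` on `(H, brH)`: a degree `1` linear map
`ρ : G → Der(H)` such that `s⁻¹ ∘ ρ` is a homomorphism of symmetric graded Lie algebras into
`s⁻¹ Der(H)`, whose bracket is `[s⁻¹ D, s⁻¹ E] = (-1)^m s⁻¹ [D, E]` for `D` of degree `m`. -/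
structure IsAction {k G H : Type*} [Field k] [AddCommGroup G] [Module k G] [AddCommGroup H]
    [Module k H] (𝒢 : ℤ → Submodule k G) (ℋ : ℤ → Submodule k H) (brG : G →ₗ[k] G →ₗ[k] G)
    (brH : H →ₗ[k] H →ₗ[k] H) (ρ : G →ₗ[k] H →ₗ[k] H) : Prop where
  isDerivation : ∀ i, ∀ x ∈ 𝒢 i, IsDerivationOfDegree ℋ brH (i + 1) (ρ x)
  map_bracket : ∀ i j, ∀ x ∈ 𝒢 i, ∀ y ∈ 𝒢 j,
    ρ (brG x y) = (i + 1).negOnePow • gradedCommutator (i + 1) (j + 1) (ρ x) (ρ y)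

end Graded

section SymmetricAlgebra

/-- The relations `x ⊗ y = (-1)^(ij) y ⊗ x` (`x` of degree `i`, `y` of degree `j`) that cut the
symmetric algebra of a graded vector space out of its tensor algebra. -/
inductive SymRel {k V : Type*} [Field k] [AddCommGroup V] [Module k V]
    (𝒱 : ℤ → Submodule k V) : TensorAlgebra k V → TensorAlgebra k V → Prop
  | swap (i j : ℤ) (x y : V) (hx : x ∈ 𝒱 i) (hy : y ∈ 𝒱 j) :
      SymRel 𝒱 (TensorAlgebra.ι k x * TensorAlgebra.ι k y)
        ((i * j).negOnePow • (TensorAlgebra.ι k y * TensorAlgebra.ι k x))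

/-- The (graded) symmetric algebra `S(V)` of a graded vector space. -/
abbrev SymAlg {k V : Type*} [Field k] [AddCommGroup V] [Module k V]
    (𝒱 : ℤ → Submodule k V) : Type _ :=
  RingQuot (SymRel 𝒱)

/-- The inclusion `V → S(V)`. -/
def symι {k V : Type*} [Field k] [AddCommGroup V] [Module k V]
    (𝒱 : ℤ → Submodule k V) : V →ₗ[k] SymAlg 𝒱 :=
  (RingQuot.mkAlgHom k (SymRel 𝒱)).toLinearMap ∘ₗ TensorAlgebra.ι k

/-- The product `v₁ ⊙ ⋯ ⊙ vₚ` in `S(V)` of a list of vectors. -/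
def sprod {k V : Type*} [Field k] [AddCommGroup V] [Module k V]
    (𝒱 : ℤ → Submodule k V) (l : List V) : SymAlg 𝒱 :=
  (l.map (symι 𝒱)).prod

/-- The grading of `S(V)`: in degree `n`, the span of the products `v₁ ⊙ ⋯ ⊙ vₚ` of homogeneous
elements (with any number of factors) whose degrees add up to `n`. -/
def symDeg {k V : Type*} [Field k] [AddCommGroup V] [Module k V]
    (𝒱 : ℤ → Submodule k V) (n : ℤ) : Submodule k (SymAlg 𝒱) :=
  Submodule.span k {s | ∃ (p : ℕ) (d : Fin p → ℤ) (v : Fin p → V),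
    (∀ a, v a ∈ 𝒱 (d a)) ∧ ∑ a, d a = n ∧ s = sprod 𝒱 (List.ofFn v)}

/-- `S(φ) : S(V) → S(W)` for a degree `0` linear map `φ : V → W`. -/
def symMap {k V W : Type*} [Field k] [AddCommGroup V] [Module k V] [AddCommGroup W] [Module k W]
    {𝒱 : ℤ → Submodule k V} {𝒲 : ℤ → Submodule k W} (φ : V →ₗ[k] W)
    (hφ : ∀ i, ∀ x ∈ 𝒱 i, φ x ∈ 𝒲 i) : SymAlg 𝒱 →ₐ[k] SymAlg 𝒲 :=
  RingQuot.liftAlgHom k ⟨TensorAlgebra.lift k (symι 𝒲 ∘ₗ φ), by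
    rintro _ _ ⟨i, j, x, y, hx, hy⟩
    have h := RingQuot.mkAlgHom_rel k (SymRel.swap (𝒱 := 𝒲) i j (φ x) (φ y) (hφ i x hx) (hφ j y hy))
    rw [Units.smul_def, map_mul, map_zsmul, map_mul] at h
    rw [Units.smul_def, map_mul, map_zsmul, map_mul]
    simpa [symι] using h⟩

theorem symMap_sprod {k V W : Type*} [Field k] [AddCommGroup V] [Module k V] [AddCommGroup W]
    [Module k W] {𝒱 : ℤ → Submodule k V} {𝒲 : ℤ → Submodule k W} (φ : V →ₗ[k] W)
    (hφ : ∀ i, ∀ x ∈ 𝒱 i, φ x ∈ 𝒲 i) (l : List V) :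
    symMap φ hφ (sprod 𝒱 l) = sprod 𝒲 (l.map φ) := by
  have h : ∀ x, symMap φ hφ (symι 𝒱 x) = symι 𝒲 (φ x) := fun x => by
    simp [symMap, symι]
  simp [sprod, map_list_prod, Function.comp_def, h]

theorem symMap_mem_symDeg {k V W : Type*} [Field k] [AddCommGroup V] [Module k V] [AddCommGroup W]
    [Module k W] {𝒱 : ℤ → Submodule k V} {𝒲 : ℤ → Submodule k W} (φ : V →ₗ[k] W)
    (hφ : ∀ i, ∀ x ∈ 𝒱 i, φ x ∈ 𝒲 i) (n : ℤ) (s : SymAlg 𝒱) (hs : s ∈ symDeg 𝒱 n) :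
    symMap φ hφ s ∈ symDeg 𝒲 n := by
  have : symDeg 𝒱 n ≤ (symDeg 𝒲 n).comap (symMap φ hφ).toLinearMap := by
    refine Submodule.span_le.2 ?_
    rintro _ ⟨p, d, v, hv, hd, rfl⟩
    refine Submodule.subset_span ⟨p, d, φ ∘ v, fun a => hφ _ _ (hv a), hd, ?_⟩
    simp [symMap_sprod, List.map_ofFn]
  exact this hs

end SymmetricAlgebra

section Cochains

/-- `C^n(V, W) = Hom^n(S(V), W)`. -/
abbrev Cochain {k V W : Type*} [Field k] [AddCommGroup V] [Module k V] [AddCommGroup W]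
    [Module k W] (𝒱 : ℤ → Submodule k V) (𝒲 : ℤ → Submodule k W) (n : ℤ) :
    Submodule k (SymAlg 𝒱 →ₗ[k] W) :=
  homDeg (symDeg 𝒱) 𝒲 n

/-- `C*(V, W) = ⨁ₙ Hom^n(S(V), W)`. -/
abbrev CStar {k V W : Type*} [Field k] [AddCommGroup V] [Module k V] [AddCommGroup W]
    [Module k W] (𝒱 : ℤ → Submodule k V) (𝒲 : ℤ → Submodule k W) : Type _ :=
  ⨁ n : ℤ, Cochain 𝒱 𝒲 n

/-- The inclusion of the degree `n` summand in `C*(V, W)`. -/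
def CStar.of {k V W : Type*} [Field k] [AddCommGroup V] [Module k V] [AddCommGroup W]
    [Module k W] (𝒱 : ℤ → Submodule k V) (𝒲 : ℤ → Submodule k W) (n : ℤ) :
    Cochain 𝒱 𝒲 n →ₗ[k] CStar 𝒱 𝒲 :=
  DirectSum.lof k ℤ (fun n => Cochain 𝒱 𝒲 n) n

/-- The grading of `C*(V, W)`. -/
def CStar.deg {k V W : Type*} [Field k] [AddCommGroup V] [Module k V] [AddCommGroup W]
    [Module k W] (𝒱 : ℤ → Submodule k V) (𝒲 : ℤ → Submodule k W) (n : ℤ) :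
    Submodule k (CStar 𝒱 𝒲) :=
  LinearMap.range (CStar.of 𝒱 𝒲 n)

end Cochains

section Shuffles

/-- The `(i, p-i)`-shuffles. -/
def shuffles (p i : ℕ) : Finset (Equiv.Perm (Fin p)) :=
  {σ | (∀ a b : Fin p, a < b → b.val < i → σ a < σ b) ∧
    (∀ a b : Fin p, a < b → i ≤ a.val → σ a < σ b)}

/-- The `(i, 1, p-i-1)`-shuffles. -/
def shufflesMid (p i : ℕ) : Finset (Equiv.Perm (Fin p)) :=
  {σ | (∀ a b : Fin p, a < b → b.val < i → σ a < σ b) ∧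
    (∀ a b : Fin p, a < b → i + 1 ≤ a.val → σ a < σ b)}

/-- The Koszul sign `ε(σ; v₁, …, vₚ)`, where `vₐ` has degree `d a`: the sign with
`v₁ ⊙ ⋯ ⊙ vₚ = ε • v_{σ(1)} ⊙ ⋯ ⊙ v_{σ(p)}`, i.e. a factor `(-1)^(deg · deg)` for each pair
that `σ` puts in the opposite order. -/
def koszul {p : ℕ} (d : Fin p → ℤ) (σ : Equiv.Perm (Fin p)) : ℤˣ :=
  ∏ a : Fin p, ∏ b : Fin p, if a < b ∧ σ b < σ a then (d (σ a) * d (σ b)).negOnePow else 1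

end Shuffles

section NijenhuisRichardson

/-- `(f ∘ g)ₚ(v₁, …, vₚ) = ∑_{i+j=p+1, i ≥ 1} (fᵢ ∘ gⱼ)(v₁, …, vₚ)` on homogeneous elements
`v` of degrees `d`, where
`(fᵢ ∘ gⱼ)(v) = ∑ ε(σ) fᵢ(gⱼ(v_{σ(1)}, …, v_{σ(j)}), v_{σ(j+1)}, …, v_{σ(p)})` over the
`(j, i-1)`-shuffles.  Here `fᵢ(v₁, …, vᵢ) = f(v₁ ⊙ ⋯ ⊙ vᵢ)`. -/
def circ {k V : Type*} [Field k] [AddCommGroup V] [Module k V] (𝒱 : ℤ → Submodule k V)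
    (f g : SymAlg 𝒱 →ₗ[k] V) {p : ℕ} (d : Fin p → ℤ) (v : Fin p → V) : V :=
  ∑ j ∈ Finset.range (p + 1), ∑ σ ∈ shuffles p j,
    koszul d σ • f (sprod 𝒱 (g (sprod 𝒱 ((List.ofFn (v ∘ σ)).take j)) ::
      (List.ofFn (v ∘ σ)).drop j))

/-- `NR` is the Nijenhuis–Richardson bracket on `C*(V, V)`: on `C^m × C^n` it takes values in
`C^(m+n)` and is `[f, g] = f ∘ g - (-1)^(mn) g ∘ f`. -/
def IsNRBracket {k V : Type*} [Field k] [AddCommGroup V] [Module k V] (𝒱 : ℤ → Submodule k V)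
    (NR : CStar 𝒱 𝒱 →ₗ[k] CStar 𝒱 𝒱 →ₗ[k] CStar 𝒱 𝒱) : Prop :=
  ∀ (m n : ℤ) (f : Cochain 𝒱 𝒱 m) (g : Cochain 𝒱 𝒱 n), ∃ h : Cochain 𝒱 𝒱 (m + n),
    NR (CStar.of 𝒱 𝒱 m f) (CStar.of 𝒱 𝒱 n g) = CStar.of 𝒱 𝒱 (m + n) h ∧
    ∀ (p : ℕ) (d : Fin p → ℤ) (v : Fin p → V), (∀ a, v a ∈ 𝒱 (d a)) →
      h.1 (sprod 𝒱 (List.ofFn v)) =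
        circ 𝒱 f.1 g.1 d v - (m * n).negOnePow • circ 𝒱 g.1 f.1 d v

end NijenhuisRichardson

section Deformation

/-- The value `⟦f, g⟧ₚ(v₁, …, vₚ)` of the bracket on `C*(H, G)`, for `f` of degree `m`, `g` of
degree `n` and homogeneous elements `v` of degrees `d`. -/
def bracketValue {k G H : Type*} [Field k] [AddCommGroup G] [Module k G] [AddCommGroup H]
    [Module k H] (ℋ : ℤ → Submodule k H) (brG : G →ₗ[k] G →ₗ[k] G) (ρ : G →ₗ[k] H →ₗ[k] H)
    (m n : ℤ) (f g : SymAlg ℋ →ₗ[k] G) {p : ℕ} (d : Fin p → ℤ) (v : Fin p → H) : G :=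
  - (∑ l : Fin p, ∑ σ ∈ shufflesMid p l,
      koszul d σ • f (sprod ℋ (ρ (g (sprod ℋ ((List.ofFn (v ∘ σ)).take l))) (v (σ l)) ::
        (List.ofFn (v ∘ σ)).drop (l + 1))))
  + ((m + 1) * (n + 1)).negOnePow • (∑ l : Fin p, ∑ σ ∈ shufflesMid p l,
      koszul d σ • g (sprod ℋ (ρ (f (sprod ℋ ((List.ofFn (v ∘ σ)).take l))) (v (σ l)) ::
        (List.ofFn (v ∘ σ)).drop (l + 1))))
  - (∑ l ∈ Finset.range (p + 1), ∑ σ ∈ shuffles p l,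
      (n * (∑ a : Fin p, if a.val < l then d (σ a) else 0) + m + 1).negOnePow • koszul d σ •
        brG (f (sprod ℋ ((List.ofFn (v ∘ σ)).take l)))
          (g (sprod ℋ ((List.ofFn (v ∘ σ)).drop l))))

/-- The value `(d_λ g)ₚ(v₁, …, vₚ)` of the differential on `C*(H, G)`, for `g` of degree `n` and
homogeneous elements `v` of degrees `d`. -/
def diffValue {k G H : Type*} [Field k] [AddCommGroup G] [Module k G] [AddCommGroup H]
    [Module k H] (ℋ : ℤ → Submodule k H) (brH : H →ₗ[k] H →ₗ[k] H) (lam : k)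
    (n : ℤ) (g : SymAlg ℋ →ₗ[k] G) {p : ℕ} (d : Fin p → ℤ) (v : Fin p → H) : G :=
  ∑ i : Fin p, ∑ j ∈ Finset.Ioi i,
    (n + 1 + d i * (∑ a ∈ Finset.Iio i, d a) + d j * (∑ a ∈ Finset.Iio j, d a)
      + d i * d j).negOnePow •
    g (sprod ℋ (lam • brH (v i) (v j) ::
      ((List.finRange p).filter (fun a => a ≠ i ∧ a ≠ j)).map v))

/-- `br` is the bracket `⟦·,·⟧` on `C*(H, G)`, which maps `C^m × C^n` to `C^(m+n+1)`. -/
def IsDeformationBracket {k G H : Type*} [Field k] [AddCommGroup G] [Module k G]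
    [AddCommGroup H] [Module k H] (𝒢 : ℤ → Submodule k G) (ℋ : ℤ → Submodule k H)
    (brG : G →ₗ[k] G →ₗ[k] G) (ρ : G →ₗ[k] H →ₗ[k] H)
    (br : CStar ℋ 𝒢 →ₗ[k] CStar ℋ 𝒢 →ₗ[k] CStar ℋ 𝒢) : Prop :=
  ∀ (m n : ℤ) (f : Cochain ℋ 𝒢 m) (g : Cochain ℋ 𝒢 n), ∃ h : Cochain ℋ 𝒢 (m + n + 1),
    br (CStar.of ℋ 𝒢 m f) (CStar.of ℋ 𝒢 n g) = CStar.of ℋ 𝒢 (m + n + 1) h ∧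
    ∀ (p : ℕ) (d : Fin p → ℤ) (v : Fin p → H), (∀ a, v a ∈ ℋ (d a)) →
      h.1 (sprod ℋ (List.ofFn v)) = bracketValue ℋ brG ρ m n f.1 g.1 d v

/-- `D` is the differential `d_λ` on `C*(H, G)`, which maps `C^n` to `C^(n+1)`. -/
def IsDeformationDifferential {k G H : Type*} [Field k] [AddCommGroup G] [Module k G]
    [AddCommGroup H] [Module k H] (𝒢 : ℤ → Submodule k G) (ℋ : ℤ → Submodule k H)
    (brH : H →ₗ[k] H →ₗ[k] H) (lam : k) (D : CStar ℋ 𝒢 →ₗ[k] CStar ℋ 𝒢) : Prop :=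
  ∀ (n : ℤ) (g : Cochain ℋ 𝒢 n), ∃ h : Cochain ℋ 𝒢 (n + 1),
    D (CStar.of ℋ 𝒢 n g) = CStar.of ℋ 𝒢 (n + 1) h ∧
    ∀ (p : ℕ) (d : Fin p → ℤ) (v : Fin p → H), (∀ a, v a ∈ ℋ (d a)) →
      h.1 (sprod ℋ (List.ofFn v)) = diffValue ℋ brH lam n g.1 d v

/-- `C^n(H, G) ⊆ C^n(G ⊕ H, G ⊕ H)`: the cochain
`((x₁, v₁), …, (xₚ, vₚ)) ↦ (fₚ(v₁, …, vₚ), 0)`. -/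
def embedCochain {k G H : Type*} [Field k] [AddCommGroup G] [Module k G] [AddCommGroup H]
    [Module k H] (𝒢 : ℤ → Submodule k G) (ℋ : ℤ → Submodule k H) (n : ℤ) :
    Cochain ℋ 𝒢 n →ₗ[k] Cochain (prodDeg 𝒢 ℋ) (prodDeg 𝒢 ℋ) n where
  toFun f := ⟨LinearMap.inl k G H ∘ₗ f.1 ∘ₗ
      (symMap (𝒱 := prodDeg 𝒢 ℋ) (𝒲 := ℋ) (LinearMap.snd k G H)
        (fun _ _ hx => hx.2)).toLinearMap,
    fun i s hs => ⟨f.2 i _ (symMap_mem_symDeg _ _ i s hs), (ℋ (n + i)).zero_mem⟩⟩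
  map_add' f g := by ext <;> simp
  map_smul' c f := by ext <;> simp

/-- The inclusion `C*(H, G) ⊆ C*(G ⊕ H, G ⊕ H)`. -/
def embed {k G H : Type*} [Field k] [AddCommGroup G] [Module k G] [AddCommGroup H]
    [Module k H] (𝒢 : ℤ → Submodule k G) (ℋ : ℤ → Submodule k H) :
    CStar ℋ 𝒢 →ₗ[k] CStar (prodDeg 𝒢 ℋ) (prodDeg 𝒢 ℋ) :=
  DirectSum.toModule k ℤ _ (fun n => CStar.of _ _ n ∘ₗ embedCochain 𝒢 ℋ n)

/-- `Q` is `μ_G + ρ`: the map `S(G ⊕ H) → G ⊕ H` that is the semidirect product bracket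
`[x₁+v₁, x₂+v₂] = [x₁, x₂] + ρ(x₁)v₂ + (-1)^(x₁x₂) ρ(x₂)v₁` on `S²` and zero on `Sᵖ`, `p ≠ 2`. -/
def IsSemidirectElement {k G H : Type*} [Field k] [AddCommGroup G] [Module k G]
    [AddCommGroup H] [Module k H] (𝒢 : ℤ → Submodule k G) (ℋ : ℤ → Submodule k H)
    (brG : G →ₗ[k] G →ₗ[k] G) (ρ : G →ₗ[k] H →ₗ[k] H)
    (Q : SymAlg (prodDeg 𝒢 ℋ) →ₗ[k] G × H) : Prop :=
  (∀ l : List (G × H), l.length ≠ 2 → Q (sprod _ l) = 0) ∧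
  ∀ i j, ∀ x ∈ prodDeg 𝒢 ℋ i, ∀ y ∈ prodDeg 𝒢 ℋ j,
    Q (sprod _ [x, y]) =
      (brG x.1 y.1, ρ x.1 y.2 + (i * j).negOnePow • ρ y.1 x.2)

/-- `P` is `λ μ_H`: the map `S(G ⊕ H) → G ⊕ H` that is `(x₁+v₁, x₂+v₂) ↦ λ[v₁, v₂]` on `S²` and
zero on `Sᵖ`, `p ≠ 2`. -/
def IsWeightElement {k G H : Type*} [Field k] [AddCommGroup G] [Module k G]
    [AddCommGroup H] [Module k H] (𝒢 : ℤ → Submodule k G) (ℋ : ℤ → Submodule k H)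
    (brH : H →ₗ[k] H →ₗ[k] H) (lam : k) (P : SymAlg (prodDeg 𝒢 ℋ) →ₗ[k] G × H) : Prop :=
  (∀ l : List (G × H), l.length ≠ 2 → P (sprod _ l) = 0) ∧
  ∀ x y : G × H, P (sprod _ [x, y]) = (0, lam • brH x.2 y.2)

end Deformation

end HomotopyO

open HomotopyO

/-! The sum over shuffles defining `f ∘ g` is the composite of `f` with an operator `I_g` on `S(V)`,
the coderivation `s ↦ ∑ g(s₁) ⊙ s₂` (`insertion`). The defect `I_f I_g - I_{f ∘ I_g}` is graded
symmetric in `f` and `g` (`insertionDefect_symm`). Hence `I` turns the Nijenhuis–Richardson bracket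
into the graded commutator (`insertion_nrBracket`), and its Jacobi identity reduces to associativity
of composition.

On `V = G ⊕ H`, the embedded cochains read only `H`-components and have values in `G`, so they form
an abelian subalgebra. Put `Q = μ_G + ρ` and `P = λ μ_H`. The Jacobi identity of `G` and the
homomorphism property of `ρ` give `[Q, Q] = 0`; the Jacobi identity of `H` gives `[P, P] = 0`; `[P,
Q] = 0` says that `ρ` acts by derivations. The derived bracket `± [[Q, f], g]` and the differential
`[P, ·]` preserve the abelian subalgebra, and `isDGLieAlgebra_of_derivedBracket` gives the
differential graded Lie structure on its suspension.

It remains to match these abstract operations with the explicit formulas. Shuffles are encoded as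
colorings of the positions, which can be summed by recursion on the first position, just as `I_g` is
computed by recursion on the first factor (`comp_insertion_sprod`,
`comp_insertion_insertion_sprod`). The outcome is `derivedBracket_sprod` and
`nrBracket_weight_sprod`. Existence of the operations on `C*(H, G)` follows by restricting the
abstract ones to `H`, and uniqueness by injectivity of `embed`. -/

namespace HomotopyO

/-! ### Signs, and linear maps prescribed on homogeneous elements. -/

section GradedLinearAlgebra

variable {k V W M : Type*} [Field k] [AddCommGroup V] [Module k V] [AddCommGroup W] [Module k W]
  [AddCommGroup M] [Module k M] {𝒱 : ℤ → Submodule k V} {𝒲 : ℤ → Submodule k W}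

theorem negOnePow_eq_ite (n : ℤ) : n.negOnePow = if Even n then 1 else -1 := by
  split_ifs with h
  · exact Int.negOnePow_even n h
  · exact Int.negOnePow_odd n (Int.not_even_iff_odd.1 h)

/-- The sign `(-1)^n` as a scalar. -/
def sg (k : Type*) [Field k] (n : ℤ) : k := ((n.negOnePow : ℤ) : k)

theorem negOnePow_smul (n : ℤ) (x : V) : n.negOnePow • x = sg k n • x := by
  rw [sg, Units.smul_def, Int.cast_smul_eq_zsmul]

theorem sg_eq_ite (n : ℤ) : sg k n = if Even n then 1 else -1 := by
  rw [sg, negOnePow_eq_ite]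
  split_ifs <;> simp

theorem sg_eq_or (n : ℤ) : sg k n = 1 ∨ sg k n = -1 := by
  rw [sg_eq_ite]
  split_ifs <;> simp

theorem sg_zero : sg k 0 = 1 := by simp [sg]

theorem sg_add (m n : ℤ) : sg k (m + n) = sg k m * sg k n := by simp [sg, Int.negOnePow_add]

/-- Turns an identity between signs into a propositional statement about parities, which case
analysis settles. -/
theorem sg_eq_sg {m n : ℤ} (h : Even m ↔ Even n) : sg k m = sg k n := by
  simp only [sg_eq_ite, h]

theorem sg_mul_self (n : ℤ) : sg k n * sg k n = 1 := by
  rw [sg_eq_ite]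
  split_ifs <;> simp

variable {N : Type*} [AddCommMonoid N] [Module k N]

/-- The linear map out of a graded vector space with given homogeneous components. -/
noncomputable def homogLift (hV : DirectSum.IsInternal 𝒱) (F : ∀ i, 𝒱 i →ₗ[k] N) : V →ₗ[k] N :=
  DirectSum.toModule k ℤ N F ∘ₗ
    (LinearEquiv.ofBijective (DirectSum.coeLinearMap 𝒱) hV).symm.toLinearMap

theorem homogLift_apply (hV : DirectSum.IsInternal 𝒱) (F : ∀ i, 𝒱 i →ₗ[k] N) {i : ℤ} {x : V}
    (hx : x ∈ 𝒱 i) : homogLift hV F x = F i ⟨x, hx⟩ := by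
  have h : (LinearEquiv.ofBijective (DirectSum.coeLinearMap 𝒱) hV).symm x =
      DirectSum.lof k ℤ (fun i => 𝒱 i) i ⟨x, hx⟩ :=
    (LinearEquiv.symm_apply_eq _).2 (DirectSum.coeLinearMap_lof 𝒱 i ⟨x, hx⟩).symm
  rw [homogLift, LinearMap.comp_apply, LinearEquiv.coe_coe, h, DirectSum.toModule_lof]

theorem homog_induction (hV : DirectSum.IsInternal 𝒱) {p : V → Prop}
    (add : ∀ x y, p x → p y → p (x + y)) (homog : ∀ i, ∀ x ∈ 𝒱 i, p x) (x : V) : p x := by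
  have hx : x ∈ iSup 𝒱 := hV.submodule_iSup_eq_top ▸ Submodule.mem_top
  exact Submodule.iSup_induction 𝒱 (motive := p) hx homog (homog 0 0 (zero_mem _)) add

/-- The map multiplying the elements of degree `j` by `(-1)^(ij)`. -/
noncomputable def twist (hV : DirectSum.IsInternal 𝒱) (i : ℤ) : V →ₗ[k] V :=
  homogLift hV fun j => sg k (i * j) • (𝒱 j).subtype

theorem twist_apply (hV : DirectSum.IsInternal 𝒱) (i : ℤ) {j : ℤ} {x : V} (hx : x ∈ 𝒱 j) :
    twist hV i x = sg k (i * j) • x := by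
  rw [twist, homogLift_apply hV _ hx]
  rfl

theorem twist_mem (hV : DirectSum.IsInternal 𝒱) (i j : ℤ) (x : V) (hx : x ∈ 𝒱 j) :
    twist hV i x ∈ 𝒱 j := by
  rw [twist_apply hV i hx]
  exact Submodule.smul_mem _ _ hx

theorem twist_comm (hV : DirectSum.IsInternal 𝒱) (i j : ℤ) :
    twist hV i ∘ₗ twist hV j = twist hV j ∘ₗ twist hV i := by
  ext x
  induction x using homog_induction hV with
  | add x y hx hy => rw [map_add, hx, hy, map_add]
  | homog l x hx =>
    simp only [LinearMap.comp_apply, twist_apply hV _ hx, map_smul, smul_smul, mul_comm]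

end GradedLinearAlgebra

/-! ### The graded symmetric algebra: universal property, induction, grading. -/

section SymmetricAlgebra

variable {k V W M A : Type*} [Field k] [AddCommGroup V] [Module k V] [AddCommGroup W] [Module k W]
  [AddCommGroup M] [Module k M] [Semiring A] [Algebra k A]
  {𝒱 : ℤ → Submodule k V} {𝒲 : ℤ → Submodule k W}

theorem symι_comm {i j : ℤ} {x y : V} (hx : x ∈ 𝒱 i) (hy : y ∈ 𝒱 j) :
    symι 𝒱 x * symι 𝒱 y = sg k (i * j) • (symι 𝒱 y * symι 𝒱 x) := by
  have h := RingQuot.mkAlgHom_rel k (SymRel.swap (𝒱 := 𝒱) i j x y hx hy)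
  rw [negOnePow_smul (k := k), map_mul, map_smul, map_mul] at h
  simpa [symι] using h

theorem symι_comm_mul {i j : ℤ} {x y : V} (hx : x ∈ 𝒱 i) (hy : y ∈ 𝒱 j) (s : SymAlg 𝒱) :
    symι 𝒱 x * (symι 𝒱 y * s) = sg k (i * j) • (symι 𝒱 y * (symι 𝒱 x * s)) := by
  rw [← mul_assoc, symι_comm hx hy, smul_mul_assoc, mul_assoc]

/-- The algebra map out of `S(V)` induced by a linear map with graded commuting values. -/
noncomputable def symLift (F : V →ₗ[k] A) (hF : ∀ i j, ∀ x ∈ 𝒱 i, ∀ y ∈ 𝒱 j,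
    F x * F y = sg k (i * j) • (F y * F x)) : SymAlg 𝒱 →ₐ[k] A :=
  RingQuot.liftAlgHom k ⟨TensorAlgebra.lift k F, by
    rintro _ _ ⟨i, j, x, y, hx, hy⟩
    have h := hF i j x hx y hy
    rw [negOnePow_smul (k := k), map_mul, map_smul, map_mul]
    simpa using h⟩

theorem symLift_symι (F : V →ₗ[k] A) (hF : ∀ i j, ∀ x ∈ 𝒱 i, ∀ y ∈ 𝒱 j,
    F x * F y = sg k (i * j) • (F y * F x)) (v : V) : symLift F hF (symι 𝒱 v) = F v := by
  simp [symLift, symι]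

theorem sprod_nil : sprod 𝒱 [] = 1 := rfl

theorem sprod_cons (v : V) (l : List V) : sprod 𝒱 (v :: l) = symι 𝒱 v * sprod 𝒱 l := rfl

theorem symMap_symι (φ : V →ₗ[k] W) (hφ : ∀ i, ∀ x ∈ 𝒱 i, φ x ∈ 𝒲 i) (v : V) :
    symMap φ hφ (symι 𝒱 v) = symι 𝒲 (φ v) := by
  simp [symMap, symι]

theorem symAlg_induction (hV : DirectSum.IsInternal 𝒱) {p : SymAlg 𝒱 → Prop} (s : SymAlg 𝒱)
    (one : p 1) (smul : ∀ (c : k) s, p s → p (c • s)) (add : ∀ s t, p s → p t → p (s + t))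
    (mul : ∀ i, ∀ v ∈ 𝒱 i, ∀ s, p s → p (symι 𝒱 v * s)) : p s := by
  -- Induction in the tensor algebra also produces products of two arbitrary elements. Strengthening
  -- the claim to left multiplication by `s` makes that case a composition of two implications.
  have key : ∀ t, p t → p (s * t) := by
    obtain ⟨s, rfl⟩ := RingQuot.mkAlgHom_surjective k (SymRel 𝒱) s
    induction s using TensorAlgebra.induction with
    | algebraMap c =>
      intro t ht
      rw [AlgHom.commutes, ← Algebra.smul_def]
      exact smul c t ht
    | ι v =>
      intro t ht
      have : (RingQuot.mkAlgHom k (SymRel 𝒱)) (TensorAlgebra.ι k v) = symι 𝒱 v := rfl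
      rw [this]
      refine homog_induction hV (fun x y hx hy => ?_) (fun i x hx => mul i x hx t ht) v
      rw [map_add, add_mul]
      exact add _ _ hx hy
    | mul a b ha hb =>
      intro t ht
      rw [map_mul, mul_assoc]
      exact ha _ (hb _ ht)
    | add a b ha hb =>
      intro t ht
      rw [map_add, add_mul]
      exact add _ _ (ha _ ht) (hb _ ht)
  simpa using key 1 one

theorem span_sprod (hV : DirectSum.IsInternal 𝒱) :
    Submodule.span k {s | ∃ (p : ℕ) (d : Fin p → ℤ) (v : Fin p → V),
      (∀ a, v a ∈ 𝒱 (d a)) ∧ s = sprod 𝒱 (List.ofFn v)} = ⊤ := by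
  refine Submodule.eq_top_iff'.2 fun s => symAlg_induction hV s ?_
    (fun c s hs => Submodule.smul_mem _ c hs) (fun s t hs ht => Submodule.add_mem _ hs ht)
    fun i v hv s hs => ?_
  · exact Submodule.subset_span ⟨0, Fin.elim0, Fin.elim0, fun a => a.elim0, by simp [sprod_nil]⟩
  · refine Submodule.span_induction (fun x hx => ?_) (by simp) (fun x y _ _ hx hy => ?_)
      (fun c x _ hx => ?_) hs
    · obtain ⟨p, d, w, hw, rfl⟩ := hx
      refine Submodule.subset_span ⟨p + 1, Fin.cons i d, Fin.cons v w, fun a => ?_, ?_⟩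
      · refine Fin.cases ?_ (fun a => ?_) a
        · simpa using hv
        · simpa using hw a
      · simp [List.ofFn_succ, sprod_cons]
    · rw [mul_add]
      exact Submodule.add_mem _ hx hy
    · rw [mul_smul_comm]
      exact Submodule.smul_mem _ c hx

theorem symAlg_hom_ext (hV : DirectSum.IsInternal 𝒱) {f g : SymAlg 𝒱 →ₗ[k] M}
    (h : ∀ (p : ℕ) (d : Fin p → ℤ) (v : Fin p → V), (∀ a, v a ∈ 𝒱 (d a)) →
      f (sprod 𝒱 (List.ofFn v)) = g (sprod 𝒱 (List.ofFn v))) : f = g :=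
  LinearMap.ext_on (span_sprod hV) (by rintro _ ⟨p, d, v, hv, rfl⟩; exact h p d v hv)

theorem sprod_mem_symDeg {p : ℕ} {d : Fin p → ℤ} {v : Fin p → V} (hv : ∀ a, v a ∈ 𝒱 (d a)) :
    sprod 𝒱 (List.ofFn v) ∈ symDeg 𝒱 (∑ a, d a) :=
  Submodule.subset_span ⟨p, d, v, hv, rfl, rfl⟩

theorem one_mem_symDeg : (1 : SymAlg 𝒱) ∈ symDeg 𝒱 0 :=
  Submodule.subset_span ⟨0, Fin.elim0, Fin.elim0, fun a => a.elim0, by simp, by simp [sprod_nil]⟩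

theorem symι_mul_mem_symDeg {i n : ℤ} {v : V} (hv : v ∈ 𝒱 i) {s : SymAlg 𝒱}
    (hs : s ∈ symDeg 𝒱 n) : symι 𝒱 v * s ∈ symDeg 𝒱 (i + n) := by
  refine Submodule.span_induction (fun x hx => ?_) (by simp) (fun x y _ _ hx hy => ?_)
      (fun c x _ hx => ?_) hs
  · obtain ⟨p, d, w, hw, rfl, rfl⟩ := hx
    refine Submodule.subset_span ⟨p + 1, Fin.cons i d, Fin.cons v w, fun a => ?_, ?_, ?_⟩
    · refine Fin.cases ?_ (fun a => ?_) a
      · simpa using hv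
      · simpa using hw a
    · simp [Fin.sum_univ_succ]
    · simp [List.ofFn_succ, sprod_cons]
  · rw [mul_add]
    exact Submodule.add_mem _ hx hy
  · rw [mul_smul_comm]
    exact Submodule.smul_mem _ c hx

theorem symι_mem_symDeg {i : ℤ} {v : V} (hv : v ∈ 𝒱 i) : symι 𝒱 v ∈ symDeg 𝒱 i := by
  simpa using symι_mul_mem_symDeg hv one_mem_symDeg

theorem mem_homDeg_of_sprod {ℳ : ℤ → Submodule k M} {f : SymAlg 𝒱 →ₗ[k] M} {n : ℤ}
    (h : ∀ (p : ℕ) (d : Fin p → ℤ) (v : Fin p → V), (∀ a, v a ∈ 𝒱 (d a)) →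
      f (sprod 𝒱 (List.ofFn v)) ∈ ℳ (n + ∑ a, d a)) : f ∈ homDeg (symDeg 𝒱) ℳ n := by
  intro i x hx
  refine Submodule.span_induction (fun x hx => ?_) (by simp) (fun x y _ _ hx hy => ?_)
      (fun c x _ hx => ?_) hx
  · obtain ⟨p, d, w, hw, rfl, rfl⟩ := hx
    exact h p d w hw
  · rw [map_add]
    exact Submodule.add_mem _ hx hy
  · rw [map_smul]
    exact Submodule.smul_mem _ c hx

/-- The left multiplication by `v` on `S(V)`. -/
noncomputable def lmul (𝒱 : ℤ → Submodule k V) (v : V) : SymAlg 𝒱 →ₗ[k] SymAlg 𝒱 :=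
  LinearMap.mulLeft k (symι 𝒱 v)

@[simp] theorem lmul_apply (v : V) (s : SymAlg 𝒱) : lmul 𝒱 v s = symι 𝒱 v * s := rfl

theorem comp_lmul_mem {ℳ : ℤ → Submodule k M} {f : SymAlg 𝒱 →ₗ[k] M} {n i : ℤ}
    (hf : f ∈ homDeg (symDeg 𝒱) ℳ n) {v : V} (hv : v ∈ 𝒱 i) :
    f ∘ₗ lmul 𝒱 v ∈ homDeg (symDeg 𝒱) ℳ (n + i) := by
  intro j s hs
  rw [add_assoc]
  exact hf _ _ (symι_mul_mem_symDeg hv hs)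

/-- The algebra automorphism of `S(V)` multiplying the elements of degree `j` by `(-1)^(ij)`. -/
noncomputable def symTwist (hV : DirectSum.IsInternal 𝒱) (i : ℤ) : SymAlg 𝒱 →ₐ[k] SymAlg 𝒱 :=
  symMap (twist hV i) (twist_mem hV i)

theorem symTwist_symι_mul (hV : DirectSum.IsInternal 𝒱) (i : ℤ) {j : ℤ} {v : V} (hv : v ∈ 𝒱 j)
    (s : SymAlg 𝒱) :
    symTwist hV i (symι 𝒱 v * s) = sg k (i * j) • (symι 𝒱 v * symTwist hV i s) := by
  rw [map_mul, symTwist, symMap_symι, twist_apply hV i hv, map_smul,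
    smul_mul_assoc]

theorem symTwist_apply (hV : DirectSum.IsInternal 𝒱) (i : ℤ) {n : ℤ} {s : SymAlg 𝒱}
    (hs : s ∈ symDeg 𝒱 n) : symTwist hV i s = sg k (i * n) • s := by
  have h : ∀ (p : ℕ) (d : Fin p → ℤ) (v : Fin p → V), (∀ a, v a ∈ 𝒱 (d a)) →
      symTwist hV i (sprod 𝒱 (List.ofFn v)) =
        sg k (i * ∑ a, d a) • sprod 𝒱 (List.ofFn v) := by
    intro p d v hv
    induction p with
    | zero => simp [sprod_nil, sg_zero]
    | succ p ih =>
      rw [List.ofFn_succ, sprod_cons, symTwist_symι_mul hV i (hv 0), ih _ _ fun a => hv a.succ,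
        mul_smul_comm, smul_smul, Fin.sum_univ_succ, mul_add, sg_add]
  refine Submodule.span_induction (fun x hx => ?_) (by simp) (fun x y _ _ hx hy => ?_)
      (fun c x _ hx => ?_) hs
  · obtain ⟨p, d, v, hv, rfl, rfl⟩ := hx
    exact h p d v hv
  · rw [map_add, hx, hy, smul_add]
  · rw [map_smul, hx, smul_comm]

theorem symTwist_comm (hV : DirectSum.IsInternal 𝒱) (i j : ℤ) (s : SymAlg 𝒱) :
    symTwist hV i (symTwist hV j s) = symTwist hV j (symTwist hV i s) := by
  have h : (symTwist hV i).toLinearMap ∘ₗ (symTwist hV j).toLinearMap =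
      (symTwist hV j).toLinearMap ∘ₗ (symTwist hV i).toLinearMap := by
    refine symAlg_hom_ext hV fun p d v hv => ?_
    simp only [LinearMap.comp_apply, AlgHom.toLinearMap_apply,
      symTwist_apply hV _ (sprod_mem_symDeg hv), map_smul]
    rw [smul_comm]
  exact LinearMap.congr_fun h s

end SymmetricAlgebra

/-! ### Insertion coderivations of `S(V)` and the Nijenhuis–Richardson bracket on cochains. -/

section Insertion

variable {k V W M : Type*} [Field k] [AddCommGroup V] [Module k V] [AddCommGroup W] [Module k W]
  [AddCommGroup M] [Module k M] {𝒱 : ℤ → Submodule k V} {𝒲 : ℤ → Submodule k W}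

/-- The map multiplying the cochains of degree `n` by `(-1)^(in)`. -/
noncomputable def conj (hV : DirectSum.IsInternal 𝒱) (i : ℤ) :
    (SymAlg 𝒱 →ₗ[k] V) →ₗ[k] SymAlg 𝒱 →ₗ[k] V :=
  LinearMap.lcomp k V (symTwist hV i).toLinearMap ∘ₗ LinearMap.llcomp k (SymAlg 𝒱) V V (twist hV i)

theorem conj_apply_apply (hV : DirectSum.IsInternal 𝒱) (i : ℤ) (g : SymAlg 𝒱 →ₗ[k] V)
    (s : SymAlg 𝒱) : conj hV i g s = twist hV i (g (symTwist hV i s)) := rfl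

/-- On inputs of degree `j` the twist of the output contributes `i(n + j)` and the twist of the
input `ij`; only `in` survives modulo 2. -/
theorem conj_apply (hV : DirectSum.IsInternal 𝒱) (i : ℤ) {n : ℤ} {g : SymAlg 𝒱 →ₗ[k] V}
    (hg : g ∈ homDeg (symDeg 𝒱) 𝒱 n) : conj hV i g = sg k (i * n) • g := by
  refine symAlg_hom_ext hV fun p d v hv => ?_
  have hs := sprod_mem_symDeg hv
  rw [conj_apply_apply, symTwist_apply hV i hs, map_smul, map_smul, twist_apply hV i (hg _ _ hs),
    smul_smul, mul_add, sg_add, mul_left_comm, sg_mul_self, mul_one, LinearMap.smul_apply]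

theorem conj_comm (hV : DirectSum.IsInternal 𝒱) (i j : ℤ) (g : SymAlg 𝒱 →ₗ[k] V) :
    conj hV i (conj hV j g) = conj hV j (conj hV i g) := by
  ext1 s
  simp only [conj_apply_apply]
  rw [symTwist_comm]
  exact LinearMap.congr_fun (twist_comm hV i j) _

theorem conj_comp_lmul (hV : DirectSum.IsInternal 𝒱) (i : ℤ) {j : ℤ} {v : V} (hv : v ∈ 𝒱 j)
    (g : SymAlg 𝒱 →ₗ[k] V) :
    conj hV i (g ∘ₗ lmul 𝒱 v) = sg k (i * j) • conj hV i g ∘ₗ lmul 𝒱 v := by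
  ext1 s
  simp only [conj_apply_apply, LinearMap.comp_apply, lmul_apply, LinearMap.smul_apply,
    symTwist_symι_mul hV i hv, map_smul, smul_smul, sg_mul_self, one_smul]

/-- The functionals on cochains with values in `S(V)`. -/
abbrev InsertionSpace (𝒱 : ℤ → Submodule k V) : Type _ := (SymAlg 𝒱 →ₗ[k] V) →ₗ[k] SymAlg 𝒱

/-- The action of `𝒱 i` on functionals that encodes the recursion of the insertion operators. -/
noncomputable def insertionStepHomog (hV : DirectSum.IsInternal 𝒱) (i : ℤ) :
    𝒱 i →ₗ[k] Module.End k (InsertionSpace 𝒱) :=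
  -- If `φ` is the functional `g ↦ I_g(s)`, the new functional is to be `g ↦ I_g(v ⊙ s)`: either `v`
  -- becomes an argument of `g`, or it is pulled out to the left past `g`. The second case costs a
  -- sign depending on the degree of `g`, which `conj` supplies linearly in `g`.
  LinearMap.mk₂ k (fun (v : 𝒱 i) (φ : InsertionSpace 𝒱) =>
      (φ ∘ₗ LinearMap.lcomp k V (lmul 𝒱 (v : V)) + lmul 𝒱 (v : V) ∘ₗ φ ∘ₗ conj hV i :
        InsertionSpace 𝒱))
    (fun v w φ => by
      refine LinearMap.ext fun g => ?_
      have h : g ∘ₗ lmul 𝒱 ((v : V) + w) = g ∘ₗ lmul 𝒱 (v : V) + g ∘ₗ lmul 𝒱 (w : V) := by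
        ext s
        simp [add_mul]
      simp only [LinearMap.add_apply, LinearMap.comp_apply, LinearMap.lcomp_apply', Submodule.coe_add, h, map_add,
        lmul_apply, add_mul]
      abel)
    (fun c v φ => by
      refine LinearMap.ext fun g => ?_
      have h : g ∘ₗ lmul 𝒱 (c • (v : V)) = c • g ∘ₗ lmul 𝒱 (v : V) := by
        ext s
        simp
      simp only [LinearMap.add_apply, LinearMap.comp_apply, LinearMap.lcomp_apply', Submodule.coe_smul, h, map_smul,
        lmul_apply, smul_mul_assoc, LinearMap.smul_apply, smul_add])
    (fun v φ ψ => by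
      refine LinearMap.ext fun g => ?_
      simp only [LinearMap.add_apply, LinearMap.comp_apply, map_add]
      abel)
    (fun c v φ => by
      refine LinearMap.ext fun g => ?_
      simp only [LinearMap.add_apply, LinearMap.comp_apply, map_smul, LinearMap.smul_apply,
        smul_add])

/-- The action of `V` on functionals that encodes the recursion of the insertion operators. -/
noncomputable def insertionStep (hV : DirectSum.IsInternal 𝒱) :
    V →ₗ[k] Module.End k (InsertionSpace 𝒱) :=
  homogLift hV (insertionStepHomog hV)

theorem insertionStep_apply (hV : DirectSum.IsInternal 𝒱) {i : ℤ} {v : V} (hv : v ∈ 𝒱 i)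
    (φ : InsertionSpace 𝒱) (g : SymAlg 𝒱 →ₗ[k] V) :
    insertionStep hV v φ g = φ (g ∘ₗ lmul 𝒱 v) + symι 𝒱 v * φ (conj hV i g) := by
  rw [insertionStep, homogLift_apply hV _ hv]
  rfl

/-- This lets the recursion descend from the tensor algebra to `S(V)`. Expanding both sides gives
four terms each: those where both vectors enter `g`, or both stay outside, agree by graded
commutativity in `S(V)`, and the two mixed terms are interchanged, with the sign coming from
`conj_comp_lmul`. -/
theorem insertionStep_comm (hV : DirectSum.IsInternal 𝒱) (i j : ℤ) (x : V) (hx : x ∈ 𝒱 i) (y : V)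
    (hy : y ∈ 𝒱 j) : insertionStep hV x * insertionStep hV y =
      sg k (i * j) • (insertionStep hV y * insertionStep hV x) := by
  refine LinearMap.ext fun φ => LinearMap.ext fun g => ?_
  have h : (g ∘ₗ lmul 𝒱 x) ∘ₗ lmul 𝒱 y = sg k (i * j) • (g ∘ₗ lmul 𝒱 y) ∘ₗ lmul 𝒱 x := by
    ext s
    simp only [LinearMap.comp_apply, lmul_apply, LinearMap.smul_apply]
    rw [symι_comm_mul hx hy, map_smul]
  simp only [Module.End.mul_apply, LinearMap.smul_apply, insertionStep_apply hV hx,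
    insertionStep_apply hV hy, h, conj_comp_lmul hV _ hx, conj_comp_lmul hV _ hy, map_smul,
    symι_comm_mul hx hy, mul_add, smul_add, mul_smul_comm, smul_smul, mul_comm j i, sg_mul_self,
    one_smul, conj_comm hV i j]
  abel

/-- The coderivation `s ↦ ∑ g(s₁) ⊙ s₂` of `S(V)` extending `g : S(V) → V`. -/
noncomputable def insertion (hV : DirectSum.IsInternal 𝒱) :
    (SymAlg 𝒱 →ₗ[k] V) →ₗ[k] SymAlg 𝒱 →ₗ[k] SymAlg 𝒱 :=
  -- The recursion starts at `s = 1` with the functional `g ↦ g(1)`, viewed in `S(V)`.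
  LinearMap.flip (LinearMap.applyₗ (symι 𝒱 ∘ₗ LinearMap.applyₗ 1 : InsertionSpace 𝒱) ∘ₗ
    (symLift (insertionStep hV) (insertionStep_comm hV)).toLinearMap)

variable (hV : DirectSum.IsInternal 𝒱)

theorem insertion_one (g : SymAlg 𝒱 →ₗ[k] V) : insertion hV g 1 = symι 𝒱 (g 1) := by
  simp [insertion]

theorem insertion_symι_mul_conj {i : ℤ} {v : V} (hv : v ∈ 𝒱 i) (g : SymAlg 𝒱 →ₗ[k] V)
    (s : SymAlg 𝒱) : insertion hV g (symι 𝒱 v * s) =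
      insertion hV (g ∘ₗ lmul 𝒱 v) s + symι 𝒱 v * insertion hV (conj hV i g) s := by
  simp only [insertion, LinearMap.flip_apply, LinearMap.comp_apply, AlgHom.toLinearMap_apply,
    map_mul, symLift_symι, LinearMap.applyₗ_apply_apply, Module.End.mul_apply,
    insertionStep_apply hV hv]

theorem insertion_symι_mul {i n : ℤ} {v : V} (hv : v ∈ 𝒱 i) {g : SymAlg 𝒱 →ₗ[k] V}
    (hg : g ∈ homDeg (symDeg 𝒱) 𝒱 n) (s : SymAlg 𝒱) : insertion hV g (symι 𝒱 v * s) =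
      insertion hV (g ∘ₗ lmul 𝒱 v) s + sg k (i * n) • (symι 𝒱 v * insertion hV g s) := by
  rw [insertion_symι_mul_conj hV hv, conj_apply hV i hg, map_smul, LinearMap.smul_apply,
    mul_smul_comm]

theorem insertion_symι {i n : ℤ} {v : V} (hv : v ∈ 𝒱 i) {g : SymAlg 𝒱 →ₗ[k] V}
    (hg : g ∈ homDeg (symDeg 𝒱) 𝒱 n) : insertion hV g (symι 𝒱 v) =
      symι 𝒱 (g (symι 𝒱 v)) + sg k (i * n) • (symι 𝒱 v * symι 𝒱 (g 1)) := by
  have := insertion_symι_mul hV hv hg 1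
  simpa only [mul_one, insertion_one, LinearMap.comp_apply, lmul_apply] using this

theorem insertion_mem {n : ℤ} {g : SymAlg 𝒱 →ₗ[k] V} (hg : g ∈ homDeg (symDeg 𝒱) 𝒱 n) :
    insertion hV g ∈ homDeg (symDeg 𝒱) (symDeg 𝒱) n := by
  refine mem_homDeg_of_sprod fun p d v hv => ?_
  induction p generalizing n g with
  | zero =>
    rw [List.ofFn_zero, sprod_nil, insertion_one]
    exact symι_mem_symDeg (by simpa using hg _ _ one_mem_symDeg)
  | succ p ih =>
    rw [List.ofFn_succ, sprod_cons, insertion_symι_mul hV (hv 0) hg, Fin.sum_univ_succ]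
    refine add_mem ?_ (Submodule.smul_mem _ _ ?_)
    · rw [← add_assoc]
      exact ih (comp_lmul_mem hg (hv 0)) _ _ fun a => hv a.succ
    · rw [add_left_comm]
      exact symι_mul_mem_symDeg (hv 0) (ih hg _ _ fun a => hv a.succ)

theorem comp_insertion_mem {ℳ : ℤ → Submodule k M} {m n : ℤ} {f : SymAlg 𝒱 →ₗ[k] M}
    {g : SymAlg 𝒱 →ₗ[k] V} (hf : f ∈ homDeg (symDeg 𝒱) ℳ m)
    (hg : g ∈ homDeg (symDeg 𝒱) 𝒱 n) :
    f ∘ₗ insertion hV g ∈ homDeg (symDeg 𝒱) ℳ (m + n) := by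
  intro i s hs
  rw [add_assoc]
  exact hf _ _ (insertion_mem hV hg _ _ hs)

theorem comp_insertion_comp_lmul {i n : ℤ} {v : V} (hv : v ∈ 𝒱 i) (f : SymAlg 𝒱 →ₗ[k] M)
    {g : SymAlg 𝒱 →ₗ[k] V} (hg : g ∈ homDeg (symDeg 𝒱) 𝒱 n) :
    (f ∘ₗ insertion hV g) ∘ₗ lmul 𝒱 v =
      f ∘ₗ insertion hV (g ∘ₗ lmul 𝒱 v) + sg k (i * n) • (f ∘ₗ lmul 𝒱 v) ∘ₗ insertion hV g := by
  ext1 s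
  simp only [LinearMap.comp_apply, lmul_apply, LinearMap.add_apply, LinearMap.smul_apply,
    insertion_symι_mul hV hv hg, map_add, map_smul]

/-- The failure of the insertion operators to be closed under composition. -/
noncomputable def insertionDefect (f g : SymAlg 𝒱 →ₗ[k] V) : SymAlg 𝒱 →ₗ[k] SymAlg 𝒱 :=
  insertion hV f ∘ₗ insertion hV g - insertion hV (f ∘ₗ insertion hV g)

/-- A first factor `v` enters `g`, enters `f`, or stays outside. The terms where it sits in only one
of the two nested operators cancel in the difference, so the recursion has the same shape after
exchanging `f` and `g`. -/
theorem insertionDefect_symι_mul {i m n : ℤ} {v : V} (hv : v ∈ 𝒱 i) {f g : SymAlg 𝒱 →ₗ[k] V}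
    (hf : f ∈ homDeg (symDeg 𝒱) 𝒱 m) (hg : g ∈ homDeg (symDeg 𝒱) 𝒱 n) (s : SymAlg 𝒱) :
    insertionDefect hV f g (symι 𝒱 v * s) = insertionDefect hV f (g ∘ₗ lmul 𝒱 v) s +
      sg k (i * n) • insertionDefect hV (f ∘ₗ lmul 𝒱 v) g s +
      sg k (i * (m + n)) • (symι 𝒱 v * insertionDefect hV f g s) := by
  simp only [insertionDefect, LinearMap.sub_apply, LinearMap.comp_apply,
    insertion_symι_mul hV hv hg, insertion_symι_mul hV hv hf,
    insertion_symι_mul hV hv (comp_insertion_mem hV hf hg), comp_insertion_comp_lmul hV hv f hg,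
    map_add, map_smul, LinearMap.add_apply, LinearMap.smul_apply, mul_add i, sg_add, mul_sub]
  module

/-- The defect collects the terms of `I_f I_g` in which `g`'s output is not fed into `f`; there the
two insertions are disjoint and may be done in either order. This is the pre-Lie identity behind
every Jacobi identity below. -/
theorem insertionDefect_symm {m n : ℤ} {f g : SymAlg 𝒱 →ₗ[k] V}
    (hf : f ∈ homDeg (symDeg 𝒱) 𝒱 m) (hg : g ∈ homDeg (symDeg 𝒱) 𝒱 n) :
    insertionDefect hV f g = sg k (m * n) • insertionDefect hV g f := by
  ext1 s
  -- The recursion replaces `f` and `g` by cochains of other degrees, so all of these data must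
  -- vary.
  induction s using symAlg_induction hV generalizing m n f g with
  | one =>
    have hf1 : f 1 ∈ 𝒱 m := by simpa using hf _ _ one_mem_symDeg
    have hg1 : g 1 ∈ 𝒱 n := by simpa using hg _ _ one_mem_symDeg
    simp only [insertionDefect, LinearMap.sub_apply, LinearMap.comp_apply, insertion_one,
      insertion_symι hV hf1 hg, insertion_symι hV hg1 hf, LinearMap.smul_apply, add_sub_cancel_left,
      smul_smul, sg_mul_self, one_smul]
    rw [symι_comm hg1 hf1, smul_smul, mul_comm n m, sg_mul_self, one_smul]
  | smul c s h => rw [map_smul, map_smul, h hf hg]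
  | add s t hs ht => rw [map_add, map_add, hs hf hg, ht hf hg]
  | mul i v hv s h =>
    rw [LinearMap.smul_apply, insertionDefect_symι_mul hV hv hf hg,
      insertionDefect_symι_mul hV hv hg hf,
      h hf hg, h hf (comp_lmul_mem hg hv), h (comp_lmul_mem hf hv) hg]
    simp only [LinearMap.smul_apply, mul_smul_comm, smul_smul, smul_add, mul_add, add_mul, sg_add,
      mul_comm m i]
    rcases sg_eq_or (k := k) (i * n) with hs | hs <;> simp only [hs] <;> module

/-- The Nijenhuis–Richardson bracket of cochains of degrees `m` and `n`. -/
noncomputable def nrBracket (m n : ℤ) (f g : SymAlg 𝒱 →ₗ[k] V) : SymAlg 𝒱 →ₗ[k] V :=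
  f ∘ₗ insertion hV g - sg k (m * n) • g ∘ₗ insertion hV f

theorem nrBracket_mem {m n : ℤ} {f g : SymAlg 𝒱 →ₗ[k] V}
    (hf : f ∈ homDeg (symDeg 𝒱) 𝒱 m) (hg : g ∈ homDeg (symDeg 𝒱) 𝒱 n) :
    nrBracket hV m n f g ∈ homDeg (symDeg 𝒱) 𝒱 (m + n) :=
  sub_mem (comp_insertion_mem hV hf hg)
    (Submodule.smul_mem _ _ (add_comm n m ▸ comp_insertion_mem hV hg hf))

/-- The difference of the two sides is the graded antisymmetrization of the defect, which vanishes
by symmetry. -/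
theorem insertion_nrBracket {m n : ℤ} {f g : SymAlg 𝒱 →ₗ[k] V}
    (hf : f ∈ homDeg (symDeg 𝒱) 𝒱 m) (hg : g ∈ homDeg (symDeg 𝒱) 𝒱 n) :
    insertion hV (nrBracket hV m n f g) = insertion hV f ∘ₗ insertion hV g -
      sg k (m * n) • insertion hV g ∘ₗ insertion hV f := by
  ext1 s
  have h := LinearMap.congr_fun (insertionDefect_symm hV hf hg) s
  simp only [insertionDefect, LinearMap.sub_apply, LinearMap.smul_apply] at h
  simp only [nrBracket, map_sub, map_smul, LinearMap.sub_apply, LinearMap.smul_apply]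
  linear_combination (norm := module) (-1 : k) • h

theorem nrBracket_skew (m n : ℤ) (f g : SymAlg 𝒱 →ₗ[k] V) :
    nrBracket hV m n f g = -(sg k (m * n) • nrBracket hV n m g f) := by
  rw [nrBracket, nrBracket, smul_sub, smul_smul, mul_comm n m, sg_mul_self]
  module

/-- Once each `I` of a bracket is replaced by a commutator, both sides are combinations of threefold
composites such as `f ∘ I_g ∘ I_h`, and only signs are left to compare. -/
theorem nrBracket_jacobi {l m n : ℤ} {f g h : SymAlg 𝒱 →ₗ[k] V}
    (hf : f ∈ homDeg (symDeg 𝒱) 𝒱 l) (hg : g ∈ homDeg (symDeg 𝒱) 𝒱 m)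
    (hh : h ∈ homDeg (symDeg 𝒱) 𝒱 n) :
    nrBracket hV l (m + n) f (nrBracket hV m n g h) =
      nrBracket hV (l + m) n (nrBracket hV l m f g) h +
        sg k (l * m) • nrBracket hV m (l + n) g (nrBracket hV l n f h) := by
  ext s
  have h1 := insertion_nrBracket hV hg hh
  have h2 := insertion_nrBracket hV hf hg
  have h3 := insertion_nrBracket hV hf hh
  unfold nrBracket at *
  rw [h1, h2, h3]
  simp only [LinearMap.sub_apply, LinearMap.add_apply, LinearMap.comp_apply, LinearMap.smul_apply,
    map_sub, map_smul, smul_sub, smul_smul]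
  simp only [sg_eq_ite, Int.even_add, Int.even_mul]
  by_cases h1 : Even l <;> by_cases h2 : Even m <;> by_cases h3 : Even n <;>
    simp only [h1, h2, h3, if_true, if_false, or_true, or_false, or_self, iff_true,
      iff_false, not_true] <;> module

end Insertion

/-! ### Sums over shuffles as sums over colorings. -/

section Colorings

variable {α M : Type*} [AddCommMonoid M] {p r : ℕ}

/-- The positions of color `a`, in increasing order. -/
def block [DecidableEq α] (c : Fin p → α) (a : α) : List (Fin p) :=
  (List.finRange p).filter fun i => c i = a

/-- The sign of moving the factors of a product of elements of degrees `d` into the order of their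
colors. -/
def colorSign (d : Fin p → ℤ) (c : Fin p → Fin r) : ℤˣ :=
  ∏ a, ∏ b, if a < b ∧ c b < c a then (d a * d b).negOnePow else 1

theorem block_cons [DecidableEq α] (x a : α) (c : Fin p → α) :
    block (Fin.cons x c : Fin (p + 1) → α) a =
      if x = a then 0 :: (block c a).map Fin.succ else (block c a).map Fin.succ := by
  simp only [block, List.finRange_succ, List.filter_cons, List.filter_map, Fin.cons_zero,
    decide_eq_true_eq]
  rfl

theorem mem_block [DecidableEq α] {c : Fin p → α} {a : α} {i : Fin p} :
    i ∈ block c a ↔ c i = a := by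
  simp [block]

theorem map_block_cons {N : Type*} [DecidableEq α] (x a : α) (c : Fin p → α) (v : Fin (p + 1) → N) :
    (block (Fin.cons x c : Fin (p + 1) → α) a).map v =
      if x = a then v 0 :: (block c a).map (fun i => v i.succ)
      else (block c a).map fun i => v i.succ := by
  rw [block_cons]
  split_ifs <;> simp [Function.comp_def]

/-- Coloring sums split according to the color of the first position; shuffle sums have no equally
direct recursion. -/
theorem sum_coloring_succ [Fintype α] (F : (Fin (p + 1) → α) → M) :
    ∑ c, F c = ∑ x, ∑ c : Fin p → α, F (Fin.cons x c) := by
  rw [← (Fin.consEquiv fun _ => α).sum_comp, Fintype.sum_prod_type]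
  rfl

theorem prod_negOnePow {ι : Type*} (s : Finset ι) (e : ι → ℤ) :
    ∏ i ∈ s, (e i).negOnePow = (∑ i ∈ s, e i).negOnePow := by
  classical
  induction s using Finset.induction_on with
  | empty => simp
  | insert i s hi ih => rw [Finset.prod_insert hi, Finset.sum_insert hi, ih, Int.negOnePow_add]

/-- The first position is inverted exactly with the later positions of smaller color. -/
theorem colorSign_cons (d : Fin (p + 1) → ℤ) (x : Fin r) (c : Fin p → Fin r) :
    colorSign d (Fin.cons x c) =
      (d 0 * ∑ b : Fin p, if c b < x then d b.succ else 0).negOnePow *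
        colorSign (fun i => d i.succ) c := by
  rw [colorSign, Fin.prod_univ_succ, Fin.prod_univ_succ, Finset.mul_sum, ← prod_negOnePow]
  simp only [Fin.prod_univ_succ, Fin.cons_zero, Fin.cons_succ, lt_self_iff_false, false_and,
    if_false, one_mul, Fin.succ_pos, true_and, Fin.succ_lt_succ_iff, Fin.not_lt_zero]
  congr 1
  refine Finset.prod_congr rfl fun b _ => ?_
  split_ifs <;> simp

theorem sum_map_block [DecidableEq α] (d : Fin p → ℤ) (c : Fin p → α) (a : α) :
    ((block c a).map d).sum = ∑ b, if c b = a then d b else 0 := by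
  induction p with
  | zero => simp [block]
  | succ p ih =>
    rw [← Fin.cons_self_tail c, map_block_cons, Fin.sum_univ_succ]
    simp only [Fin.cons_zero, Fin.cons_succ, ← ih]
    split_ifs <;> simp

/-- A stable sort reverses a pair of positions precisely when their colors are in the wrong order.
-/
theorem koszul_eq_colorSign (d : Fin p → ℤ) (c : Fin p → Fin r) :
    koszul d (Tuple.sort c) = colorSign d c := by
  obtain ⟨h1, h2⟩ := Tuple.eq_sort_iff.1 (Eq.refl (Tuple.sort c))
  set σ := Tuple.sort c
  rw [koszul, colorSign, Finset.prod_comm, ← Equiv.prod_comp σ fun a =>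
    ∏ b, if a < b ∧ c b < c a then (d a * d b).negOnePow else 1]
  refine Finset.prod_congr rfl fun a _ => ?_
  rw [← Equiv.prod_comp σ fun b => if σ a < b ∧ c b < c (σ a) then (d (σ a) * d b).negOnePow else 1]
  refine Finset.prod_congr rfl fun b _ => ?_
  rw [mul_comm]
  refine if_congr ?_ rfl rfl
  rw [and_comm]
  refine and_congr_right fun h => ⟨fun hba => ?_, fun hc => ?_⟩
  · exact lt_of_le_of_ne (h1 hba.le) fun he => absurd (h2 b a hba he) h.le.not_gt
  · by_contra hba
    exact absurd (h1 (not_lt.1 hba)) (not_le.2 hc)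

/-- A stable sort is increasing on each color class, so both lists are strictly increasing with the
same elements. -/
theorem map_sort_block (c : Fin p → Fin r) (a : Fin r) :
    (block (c ∘ Tuple.sort c) a).map (Tuple.sort c) = block c a := by
  obtain ⟨h1, h2⟩ := Tuple.eq_sort_iff.1 (Eq.refl (Tuple.sort c))
  set σ := Tuple.sort c
  have hs : ∀ c : Fin p → Fin r, (block c a).Pairwise (· < ·) := fun c =>
    (List.pairwise_lt_finRange p).filter _
  have hm : ((block (c ∘ σ) a).map σ).Pairwise (· < ·) := by
    rw [List.pairwise_map]
    refine (hs (c ∘ σ)).imp_of_mem fun hi hj hij => h2 _ _ hij ?_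
    exact (mem_block.1 hi).trans (mem_block.1 hj).symm
  refine List.Perm.eq_of_pairwise (fun a b _ _ h h' => absurd h h'.not_gt) hm (hs c) ?_
  rw [List.perm_ext_iff_of_nodup (hm.imp fun h => h.ne) ((hs c).imp fun h => h.ne)]
  intro i
  simp only [List.mem_map, mem_block, Function.comp_apply]
  exact ⟨fun ⟨j, hj, hji⟩ => hji ▸ hj, fun hi => ⟨σ.symm i, by simpa using hi, by simp⟩⟩

theorem filter_finRange_lt (j : ℕ) :
    ((List.finRange p).filter fun i => i.val < j) = (List.finRange p).take j := by
  have h1 : ((List.finRange p).take j).filter (fun i => decide (i.val < j)) =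
      (List.finRange p).take j := by
    refine List.filter_eq_self.2 fun i hi => ?_
    obtain ⟨m, hm, rfl⟩ := List.mem_take_iff_getElem.1 hi
    simp; omega
  have h2 : ((List.finRange p).drop j).filter (fun i => decide (i.val < j)) = [] := by
    refine List.filter_eq_nil_iff.2 fun i hi => ?_
    obtain ⟨m, hm, rfl⟩ := List.mem_drop_iff_getElem.1 hi
    simp
  conv_lhs => rw [← List.take_append_drop j (List.finRange p)]
  rw [List.filter_append, h1, h2, List.append_nil]

theorem filter_finRange_ge (j : ℕ) :
    ((List.finRange p).filter fun i => j ≤ i.val) = (List.finRange p).drop j := by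
  have h1 : ((List.finRange p).take j).filter (fun i => decide (j ≤ i.val)) = [] := by
    refine List.filter_eq_nil_iff.2 fun i hi => ?_
    obtain ⟨m, hm, rfl⟩ := List.mem_take_iff_getElem.1 hi
    simp; omega
  have h2 : ((List.finRange p).drop j).filter (fun i => decide (j ≤ i.val)) =
      (List.finRange p).drop j := by
    refine List.filter_eq_self.2 fun i hi => ?_
    obtain ⟨m, hm, rfl⟩ := List.mem_drop_iff_getElem.1 hi
    simp
  conv_lhs => rw [← List.take_append_drop j (List.finRange p)]
  rw [List.filter_append, h1, h2, List.nil_append]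

/-- A sum over shuffles is a sum over colorings with two colors. -/
theorem sum_shuffles (Φ : Equiv.Perm (Fin p) → List (Fin p) → List (Fin p) → M) :
    ∑ j ∈ Finset.range (p + 1), ∑ σ ∈ shuffles p j,
        Φ σ ((List.ofFn σ).take j) ((List.ofFn σ).drop j) =
      ∑ c : Fin p → Fin 2, Φ (Tuple.sort c) (block c 0) (block c 1) := by
  -- The shuffle conditions are what characterizes the stable sort of the coloring that marks the
  -- images of the first `j` positions. Hence `σ` can be recovered from this coloring.
  have key : ∀ (j : ℕ), ∀ σ ∈ shuffles p j,
      Tuple.sort (fun a => if (σ.symm a).val < j then (0 : Fin 2) else 1) = σ := by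
    intro j σ hσ
    simp only [shuffles, Finset.mem_filter, Finset.mem_univ, true_and] at hσ
    symm
    refine Tuple.eq_sort_iff.2 ⟨fun a b hab => ?_, fun a b hab h => ?_⟩
    · simp only [Function.comp_apply, Equiv.symm_apply_apply]
      have : a.val ≤ b.val := hab
      split_ifs <;> simp; omega
    · simp only [Equiv.symm_apply_apply] at h
      by_cases hb : b.val < j
      · exact hσ.1 a b hab hb
      · rw [if_neg hb] at h
        refine hσ.2 a b hab ?_
        by_contra ha
        rw [if_pos (not_le.1 ha)] at h
        exact absurd h (by decide)
  rw [Finset.sum_sigma']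
  refine Finset.sum_bij (fun x _ => fun a => if (x.2.symm a).val < x.1 then (0 : Fin 2) else 1)
    (fun _ _ => Finset.mem_univ _) ?_ ?_ ?_
  · rintro ⟨j, σ⟩ h ⟨j', σ'⟩ h' he
    simp only [Finset.mem_sigma, Finset.mem_range] at h h'
    have hσ : σ = σ' := by
      rw [← key j σ h.2, ← key j' σ' h'.2]
      exact congrArg Tuple.sort he
    subst hσ
    have : j = j' := by
      have hval : ∀ a : Fin p, a.val < j ↔ a.val < j' := by
        intro a
        have := congrFun he (σ a)
        simp only [Equiv.symm_apply_apply] at this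
        split_ifs at this with ha hb hb
        · exact iff_of_true ha hb
        · exact absurd this (by decide)
        · exact absurd this (by decide)
        · exact iff_of_false ha hb
      by_contra hne
      rcases lt_or_gt_of_ne hne with hlt | hlt
      · exact absurd ((hval ⟨j, by omega⟩).2 hlt) (lt_irrefl _)
      · exact absurd ((hval ⟨j', by omega⟩).1 hlt) (lt_irrefl _)
    subst this
    rfl
  · intro c _
    obtain ⟨h1, h2⟩ := Tuple.eq_sort_iff.1 (Eq.refl (Tuple.sort c))
    set σ := Tuple.sort c with hσ
    have hj : ∀ a : Fin p, a.val < Finset.card {i | (c ∘ σ) i ≤ 0} ↔ c (σ a) = 0 := fun a => by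
      rw [Tuple.lt_card_le_iff_apply_le_of_monotone h1, Function.comp_apply, Fin.le_zero_iff]
    have hc1 : ∀ a, c a ≠ 0 → c a = 1 := fun a h => by omega
    -- The cut `j` of the shuffle attached to `c` is the number of positions of color `0`.
    refine ⟨⟨Finset.card {i | (c ∘ σ) i ≤ 0}, σ⟩, ?_, ?_⟩
    · simp only [Finset.mem_sigma, Finset.mem_range, shuffles, Finset.mem_filter, Finset.mem_univ,
        true_and]
      refine ⟨?_, fun a b hab hb => ?_, fun a b hab ha => ?_⟩
      · exact Nat.lt_succ_of_le ((Finset.card_le_univ _).trans_eq (Fintype.card_fin p))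
      · rw [hj] at hb
        refine h2 a b hab (le_antisymm (h1 hab.le) ?_)
        rw [hb]
        exact Fin.zero_le _
      · have hca := hc1 _ (mt (hj a).2 ha.not_gt)
        refine h2 a b hab ?_
        rw [hca, hc1 _ (mt (hj b).2 (ha.trans (Fin.le_def.1 hab.le)).not_gt)]
    · funext a
      have := hj (σ.symm a)
      rw [Equiv.apply_symm_apply] at this
      simp only [this]
      split_ifs with h
      · exact h.symm
      · exact (hc1 a h).symm
  · rintro ⟨j, σ⟩ h
    simp only [Finset.mem_sigma] at h
    have hs := key j σ h.2
    simp only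
    set c : Fin p → Fin 2 := fun a => if (σ.symm a).val < j then (0 : Fin 2) else 1 with hc
    have hcσ : ∀ a, (c ∘ σ) a = if a.val < j then 0 else 1 := fun a => by simp [hc]
    rw [← map_sort_block c 0, ← map_sort_block c 1, hs]
    congr 1
    · rw [List.ofFn_eq_map, ← List.map_take, ← filter_finRange_lt]
      congr 1
      refine List.filter_congr fun a _ => ?_
      rw [hcσ]
      by_cases h : a.val < j <;> simp [h]
    · rw [List.ofFn_eq_map, ← List.map_drop, ← filter_finRange_ge]
      congr 1
      refine List.filter_congr fun a _ => ?_
      rw [hcσ]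
      by_cases h : a.val < j <;> simp [h]; omega

theorem filter_finRange_eq (l : Fin p) : ((List.finRange p).filter fun i => i = l) = [l] := by
  refine List.Perm.eq_of_pairwise (le := (· < ·)) (fun a b _ _ h h' => absurd h h'.not_gt)
    ((List.pairwise_lt_finRange p).filter _) (List.pairwise_singleton _ _) ?_
  rw [List.perm_ext_iff_of_nodup ((List.nodup_finRange p).filter _) (List.nodup_singleton _)]
  simp

/-- A sum over `(l, 1, p - l - 1)`-shuffles is a sum over colorings with three colors, the second
of which is used once. -/
theorem sum_shufflesMid (Φ : Equiv.Perm (Fin p) → List (Fin p) → List (Fin p) → List (Fin p) → M)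
    (hΦ : ∀ σ A B C, B.length ≠ 1 → Φ σ A B C = 0) :
    ∑ l : Fin p, ∑ σ ∈ shufflesMid p l,
        Φ σ ((List.ofFn σ).take l) [σ l] ((List.ofFn σ).drop (l + 1)) =
      ∑ c : Fin p → Fin 3, Φ (Tuple.sort c) (block c 0) (block c 1) (block c 2) := by
  have key : ∀ (l : Fin p), ∀ σ ∈ shufflesMid p l,
      Tuple.sort (fun a => if σ.symm a < l then (0 : Fin 3) else if σ.symm a = l then 1 else 2) =
        σ := by
    intro l σ hσ
    simp only [shufflesMid, Finset.mem_filter, Finset.mem_univ, true_and] at hσ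
    symm
    refine Tuple.eq_sort_iff.2 ⟨fun a b hab => ?_, fun a b hab h => ?_⟩
    · simp only [Function.comp_apply, Equiv.symm_apply_apply]
      split_ifs <;> first | decide | (exfalso; omega)
    · simp only [Equiv.symm_apply_apply] at h
      by_cases hb : b < l
      · exact hσ.1 a b hab hb
      · refine hσ.2 a b hab ?_
        rw [if_neg hb] at h
        split_ifs at h <;> first | exact absurd h (by decide) | omega
  have hblock : ∀ (l : Fin p), ∀ σ ∈ shufflesMid p l, ∀ c : Fin p → Fin 3,
      c = (fun a => if σ.symm a < l then (0 : Fin 3) else if σ.symm a = l then 1 else 2) →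
      block c 0 = (List.ofFn σ).take l ∧ block c 1 = [σ l] ∧
        block c 2 = (List.ofFn σ).drop (l + 1) := by
    intro l σ hσ c hc
    have hcσ : ∀ a, (c ∘ σ) a = if a < l then (0 : Fin 3) else if a = l then 1 else 2 :=
      fun a => by simp [hc]
    rw [← map_sort_block c 0, ← map_sort_block c 1, ← map_sort_block c 2,
      show Tuple.sort c = σ from hc ▸ key l σ hσ]
    refine ⟨?_, ?_, ?_⟩
    · rw [List.ofFn_eq_map, ← List.map_take, ← filter_finRange_lt]
      congr 1
      refine List.filter_congr fun a _ => ?_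
      rw [hcσ]
      split_ifs <;> simp <;> omega
    · rw [← List.map_singleton, ← filter_finRange_eq l]
      congr 1
      refine List.filter_congr fun a _ => ?_
      rw [hcσ]
      split_ifs <;> simp <;> omega
    · rw [List.ofFn_eq_map, ← List.map_drop, ← filter_finRange_ge]
      congr 1
      refine List.filter_congr fun a _ => ?_
      rw [hcσ]
      split_ifs <;> simp <;> omega
  -- Colorings that do not use color `1` exactly once contribute zero by `hΦ`; the remaining ones
  -- correspond to pairs `(l, σ)`.
  rw [Finset.sum_sigma', ← Finset.sum_filter_of_ne (p := fun c => (block c 1).length = 1)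
    fun c _ h => not_not.1 (mt (hΦ _ _ _ _) h)]
  refine Finset.sum_bij
    (fun x _ => fun a =>
      if x.2.symm a < x.1 then (0 : Fin 3) else if x.2.symm a = x.1 then 1 else 2) ?_ ?_ ?_ ?_
  · rintro ⟨l, σ⟩ h
    simp only [Finset.mem_sigma] at h
    simp [(hblock l σ h.2 _ rfl).2.1]
  · rintro ⟨l, σ⟩ h ⟨l', σ'⟩ h' he
    simp only [Finset.mem_sigma] at h h'
    have hσ : σ = σ' := by
      rw [← key l σ h.2, ← key l' σ' h'.2]
      exact congrArg Tuple.sort he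
    subst hσ
    have hl := (hblock l σ h.2 _ rfl).2.1
    simp only at he
    rw [he, (hblock l' σ h'.2 _ rfl).2.1] at hl
    simp only [List.cons.injEq, EmbeddingLike.apply_eq_iff_eq, and_true] at hl
    subst hl
    rfl
  · intro c hc
    obtain ⟨b, hb⟩ := List.length_eq_one_iff.1 (Finset.mem_filter.1 hc).2
    have hb1 : ∀ a, c a = 1 ↔ a = b := fun a => by rw [← mem_block, hb, List.mem_singleton]
    obtain ⟨h1, h2⟩ := Tuple.eq_sort_iff.1 (Eq.refl (Tuple.sort c))
    set σ := Tuple.sort c with hσ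
    have hl : c (σ (σ.symm b)) = 1 := by rw [Equiv.apply_symm_apply, hb1]
    have hlt : ∀ a, a < σ.symm b → c (σ a) = 0 := fun a ha => by
      have := h1 ha.le
      simp only [Function.comp_apply, hl] at this
      have hne : c (σ a) ≠ 1 := by
        rw [Ne, hb1, ← Equiv.eq_symm_apply]
        exact ha.ne
      omega
    have hgt : ∀ a, σ.symm b < a → c (σ a) = 2 := fun a ha => by
      have := h1 ha.le
      simp only [Function.comp_apply, hl] at this
      have hne : c (σ a) ≠ 1 := by
        rw [Ne, hb1, ← Equiv.eq_symm_apply]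
        exact ha.ne'
      omega
    refine ⟨⟨σ.symm b, σ⟩, ?_, ?_⟩
    · simp only [Finset.mem_sigma, Finset.mem_univ, shufflesMid, Finset.mem_filter, true_and]
      refine ⟨fun x y hxy hy => h2 x y hxy ?_, fun x y hxy hx => h2 x y hxy ?_⟩
      · rw [hlt x (hxy.trans hy), hlt y hy]
      · have hx' : σ.symm b < x := hx
        rw [hgt x hx', hgt y (hx'.trans hxy)]
    · funext a
      simp only
      split_ifs with h h'
      · simpa using (hlt _ h).symm
      · rw [EmbeddingLike.apply_eq_iff_eq] at h'
        exact ((hb1 a).2 h').symm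
      · simpa using (hgt _ (lt_of_le_of_ne (not_lt.1 h) (Ne.symm h'))).symm
  · rintro ⟨l, σ⟩ h
    simp only [Finset.mem_sigma] at h
    obtain ⟨h0, h1, h2⟩ := hblock l σ h.2 _ rfl
    simp only [h0, h1, h2, key l σ h.2]

/-- A sum over colorings with two colors, the first of which is used twice, is a sum over pairs. -/
theorem sum_pairs {M : Type*} [AddCommGroup M] (d : Fin p → ℤ)
    (Φ : List (Fin p) → List (Fin p) → M)
    (hΦ : ∀ A B, A.length ≠ 2 → Φ A B = 0) :
    ∑ c : Fin p → Fin 2, colorSign d c • Φ (block c 0) (block c 1) =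
      ∑ i : Fin p, ∑ j ∈ Finset.Ioi i,
        (d i * (∑ a ∈ Finset.Iio i, d a) + d j * (∑ a ∈ Finset.Iio j, d a)
          + d i * d j).negOnePow •
          Φ [i, j] ((List.finRange p).filter fun a => a ≠ i ∧ a ≠ j) := by
  have hc01 : ∀ (c : Fin p → Fin 2) (a : Fin p), c a ≠ 0 → c a = 1 := fun c a h => by omega
  have hsort : ∀ c : Fin p → Fin 2, (block c 0).Pairwise (· < ·) := fun c =>
    (List.pairwise_lt_finRange p).filter _
  have hmem : ∀ i j a : Fin p, (if a = i ∨ a = j then (0 : Fin 2) else 1) = 0 ↔ a = i ∨ a = j :=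
    fun i j a => by split_ifs with h <;> simp [h]
  have hb0 : ∀ i j : Fin p, i < j →
      block (fun a => if a = i ∨ a = j then (0 : Fin 2) else 1) 0 = [i, j] := fun i j hij => by
    refine List.Perm.eq_of_pairwise (le := (· < ·)) (fun a b _ _ h h' => absurd h h'.not_gt)
      (hsort _) (by simpa using hij) ?_
    rw [List.perm_ext_iff_of_nodup ((hsort _).imp fun h => h.ne) (by simpa using hij.ne)]
    intro a
    rw [mem_block, hmem]
    simp
  rw [Finset.sum_sigma', ← Finset.sum_filter_of_ne (p := fun c => (block c 0).length = 2)
    fun c _ h => not_not.1 fun h' => h (by rw [hΦ _ _ h', smul_zero])]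
  symm
  refine Finset.sum_bij
    (fun x _ => fun a => if a = x.1 ∨ a = x.2 then (0 : Fin 2) else 1) ?_ ?_ ?_ ?_
  · rintro ⟨i, j⟩ h
    simp only [Finset.mem_sigma, Finset.mem_Ioi] at h
    simp [hb0 i j h.2]
  · rintro ⟨i, j⟩ h ⟨i', j'⟩ h' he
    simp only [Finset.mem_sigma, Finset.mem_Ioi] at h h'
    have := hb0 i j h.2
    simp only at he
    rw [he, hb0 i' j' h'.2] at this
    simp only [List.cons.injEq, and_true] at this
    obtain ⟨rfl, rfl⟩ := this
    rfl
  · intro c hc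
    obtain ⟨i, j, hij⟩ := List.length_eq_two.1 (Finset.mem_filter.1 hc).2
    have hlt : i < j := by simpa [hij] using hsort c
    refine ⟨⟨i, j⟩, by simpa using hlt, ?_⟩
    funext a
    have : c a = 0 ↔ a = i ∨ a = j := by rw [← mem_block, hij]; simp
    simp only [← this]
    split_ifs with h
    · exact h.symm
    · exact (hc01 c a h).symm
  · rintro ⟨i, j⟩ h
    simp only [Finset.mem_sigma, Finset.mem_Ioi] at h
    have hij := h.2
    simp only [hb0 i j hij]
    have hb1 : block (fun a => if a = i ∨ a = j then (0 : Fin 2) else 1) 1 =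
        (List.finRange p).filter fun a => a ≠ i ∧ a ≠ j := by
      refine List.filter_congr fun a _ => ?_
      by_cases h : a = i ∨ a = j
      · simp only [if_pos h]; simp; tauto
      · simp only [if_neg h]; simp; tauto
    rw [hb1]
    congr 1
    -- Inversions end at `i` or `j`: every `a < i` is inverted with `i`, and every `a < j` except `a
    -- = i` with `j`. The subtracted `d i * d j` removes that exception, and modulo 2 it is the `+ d
    -- i * d j` of the statement.
    have hpair : ∀ a b : Fin p, (if a < b ∧ (if b = i ∨ b = j then (0 : Fin 2) else 1) <
          (if a = i ∨ a = j then (0 : Fin 2) else 1) then (d a * d b).negOnePow else 1) =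
        ((if b = i then (if a < i then d a * d i else 0) else 0) +
          (if b = j then (if a < j then d a * d j else 0) - (if a = i then d i * d j else 0)
            else 0)).negOnePow := by
      intro a b
      rcases eq_or_ne b i with rfl | hbi
      · rcases eq_or_ne a b with rfl | hab
        · simp [hij.ne]
        · rcases eq_or_ne a j with rfl | haj
          · simp [hij.ne, hij.not_gt]
          · simp [hij.ne, hab, haj]
            split_ifs <;> simp
      · rcases eq_or_ne b j with rfl | hbj
        · rcases eq_or_ne a i with rfl | hai
          · simp [hij, hbi]
          · rcases eq_or_ne a b with rfl | hab
            · simp [hbi]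
            · simp [hbi, hai, hab]
              split_ifs <;> simp
        · simp [hbi, hbj]
          intro _ h
          split_ifs at h <;> exact absurd h (by decide)
    simp only [colorSign, hpair, prod_negOnePow, Finset.sum_add_distrib, Finset.sum_ite_eq',
      Finset.mem_univ, if_true, Finset.sum_sub_distrib]
    rw [Int.negOnePow_eq_iff]
    have hsum : ∀ i : Fin p, ∑ a, (if a < i then d a * d i else 0) =
        d i * ∑ a ∈ Finset.Iio i, d a := fun i => by
      rw [Finset.mul_sum, ← Finset.sum_filter]
      refine Finset.sum_congr (by ext; simp) fun a _ => mul_comm _ _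
    rw [hsum, hsum]
    exact ⟨d i * d j, by ring⟩

end Colorings

/-! ### Explicit values of insertion operators on products. -/

section Evaluation

variable {k V M : Type*} [Field k] [AddCommGroup V] [Module k V]
  [AddCommGroup M] [Module k M] {𝒱 : ℤ → Submodule k V}

theorem sprod_map_mem {ι : Type*} {d : ι → ℤ} {v : ι → V} (hv : ∀ a, v a ∈ 𝒱 (d a)) (L : List ι) :
    sprod 𝒱 (L.map v) ∈ symDeg 𝒱 (L.map d).sum := by
  induction L with
  | nil => simpa [sprod_nil] using one_mem_symDeg
  | cons a L ih =>
    rw [List.map_cons, List.map_cons, sprod_cons, List.sum_cons]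
    exact symι_mul_mem_symDeg (hv a) ih

theorem sprod_cons_cons_comm {i j : ℤ} {x y : V} (hx : x ∈ 𝒱 i) (hy : y ∈ 𝒱 j) (l : List V)
    (f : SymAlg 𝒱 →ₗ[k] M) :
    f (sprod 𝒱 (x :: y :: l)) = (i * j).negOnePow • f (sprod 𝒱 (y :: x :: l)) := by
  simp only [sprod_cons]
  rw [symι_comm_mul hx hy, map_smul, negOnePow_smul (k := k)]

variable (hV : DirectSum.IsInternal 𝒱)

/-- Color `0` marks the arguments of `g`, color `1` the vectors left outside. Both sides satisfy the
same recursion according to where the first vector goes. -/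
theorem comp_insertion_sprod {n : ℤ} {g : SymAlg 𝒱 →ₗ[k] V} (hg : g ∈ homDeg (symDeg 𝒱) 𝒱 n)
    (f : SymAlg 𝒱 →ₗ[k] M) {p : ℕ} {d : Fin p → ℤ} {v : Fin p → V} (hv : ∀ a, v a ∈ 𝒱 (d a)) :
    f (insertion hV g (sprod 𝒱 (List.ofFn v))) = ∑ c : Fin p → Fin 2, colorSign d c •
      f (sprod 𝒱 (g (sprod 𝒱 ((block c 0).map v)) :: (block c 1).map v)) := by
  induction p generalizing f g n with
  | zero =>
    simp [block, colorSign, sprod_nil, sprod_cons, insertion_one]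
  | succ p ih =>
    have hv' : ∀ a, (fun i : Fin p => v i.succ) a ∈ 𝒱 ((fun i => d i.succ) a) := fun a => hv a.succ
    rw [List.ofFn_succ, sprod_cons, insertion_symι_mul hV (hv 0) hg, map_add, map_smul,
      ← lmul_apply, ← LinearMap.comp_apply f (lmul 𝒱 (v 0)), ih (comp_lmul_mem hg (hv 0)) _ hv', ih hg _ hv',
      sum_coloring_succ, Fin.sum_univ_two, Finset.smul_sum]
    congr 1
    · refine Finset.sum_congr rfl fun c _ => ?_
      simp [colorSign_cons, map_block_cons, sprod_cons]
    · refine Finset.sum_congr rfl fun c _ => ?_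
      have hsum : (∑ b : Fin p, if c b < 1 then d b.succ else 0) =
          ((block c 0).map fun i => d i.succ).sum := by
        rw [sum_map_block]
        exact Finset.sum_congr rfl fun b _ => if_congr (by omega) rfl rfl
      -- Moving `v 0` behind the output of `g` costs `d 0` times `n` plus the degree of the
      -- arguments of `g`. The part with `n` cancels the sign of the recursion, and the rest is the
      -- factor in `colorSign_cons`.
      rw [colorSign_cons, map_block_cons, map_block_cons, hsum, if_neg (by decide), if_pos rfl,
        sprod_cons_cons_comm (hg _ _ (sprod_map_mem hv' (block c 0))) (hv 0),
        ← negOnePow_smul (k := k), smul_smul, smul_smul, LinearMap.comp_apply, lmul_apply,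
        sprod_cons (v 0), mul_right_comm, ← Int.negOnePow_add]
      congr 2
      rw [Int.negOnePow_eq_iff]
      exact ⟨-(d 0 * ((block c 0).map fun i => d i.succ).sum), by ring⟩

/-- The three colors mark the arguments of `g`, the further arguments of `q`, and the further
arguments of `f`. As with two colors, induction compares the possible places of the first vector. -/
theorem comp_insertion_insertion_sprod {m n : ℤ} {q g : SymAlg 𝒱 →ₗ[k] V}
    (hq : q ∈ homDeg (symDeg 𝒱) 𝒱 m) (hg : g ∈ homDeg (symDeg 𝒱) 𝒱 n)
    (f : SymAlg 𝒱 →ₗ[k] M) {p : ℕ} {d : Fin p → ℤ} {v : Fin p → V} (hv : ∀ a, v a ∈ 𝒱 (d a)) :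
    f (insertion hV (q ∘ₗ insertion hV g) (sprod 𝒱 (List.ofFn v))) =
      ∑ c : Fin p → Fin 3, colorSign d c • f (sprod 𝒱 (q (sprod 𝒱 (
        g (sprod 𝒱 ((block c 0).map v)) :: (block c 1).map v)) :: (block c 2).map v)) := by
  induction p generalizing f g q m n with
  | zero =>
    simp [block, colorSign, sprod_nil, sprod_cons, insertion_one]
  | succ p ih =>
    have hv' : ∀ a, (fun i : Fin p => v i.succ) a ∈ 𝒱 ((fun i => d i.succ) a) := fun a => hv a.succ
    rw [List.ofFn_succ, sprod_cons,
      insertion_symι_mul hV (hv 0) (comp_insertion_mem hV hq hg), map_add, map_smul,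
      comp_insertion_comp_lmul hV (hv 0) _ hg, map_add, LinearMap.add_apply, map_add, map_smul,
      LinearMap.smul_apply, map_smul,
      ← lmul_apply (𝒱 := 𝒱), ← LinearMap.comp_apply f (lmul 𝒱 (v 0)),
      ih hq (comp_lmul_mem hg (hv 0)) _ hv', ih (comp_lmul_mem hq (hv 0)) hg _ hv', ih hq hg _ hv',
      sum_coloring_succ, Fin.sum_univ_three, Finset.smul_sum, Finset.smul_sum]
    refine congrArg₂ (· + ·) (congrArg₂ (· + ·) ?_ ?_) ?_
    · refine Finset.sum_congr rfl fun c _ => ?_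
      simp [colorSign_cons, map_block_cons, sprod_cons]
    · refine Finset.sum_congr rfl fun c _ => ?_
      have hsum : (∑ b : Fin p, if c b < 1 then d b.succ else 0) =
          ((block c 0).map fun i => d i.succ).sum := by
        rw [sum_map_block]
        exact Finset.sum_congr rfl fun b _ => if_congr (by omega) rfl rfl
      -- Here the exchange takes place inside the argument of `q`, so it is applied to the
      -- functional consisting of `q` followed by everything outside it.
      have hswap := sprod_cons_cons_comm (hg _ _ (sprod_map_mem hv' (block c 0))) (hv 0)
        ((block c 1).map fun i => v i.succ) (f ∘ₗ LinearMap.mulRight k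
          (sprod 𝒱 ((block c 2).map fun i => v i.succ)) ∘ₗ symι 𝒱 ∘ₗ q)
      simp only [LinearMap.comp_apply, LinearMap.mulRight_apply, ← sprod_cons] at hswap
      rw [colorSign_cons, map_block_cons, map_block_cons, map_block_cons, hsum,
        if_neg (by decide), if_pos rfl, if_neg (by decide), hswap,
        ← negOnePow_smul (k := k), smul_smul, smul_smul, LinearMap.comp_apply, lmul_apply,
        sprod_cons (v 0), mul_right_comm, ← Int.negOnePow_add]
      congr 2
      rw [Int.negOnePow_eq_iff]
      exact ⟨-(d 0 * ((block c 0).map fun i => d i.succ).sum), by ring⟩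
    · refine Finset.sum_congr rfl fun c _ => ?_
      have hsum : (∑ b : Fin p, if c b < 2 then d b.succ else 0) =
          ((block c 0).map fun i => d i.succ).sum + ((block c 1).map fun i => d i.succ).sum := by
        rw [sum_map_block, sum_map_block, ← Finset.sum_add_distrib]
        refine Finset.sum_congr rfl fun b _ => ?_
        generalize c b = x
        fin_cases x <;> simp
      have hmem := hq _ _ (symι_mul_mem_symDeg (hg _ _ (sprod_map_mem hv' (block c 0)))
        (sprod_map_mem hv' (block c 1)))
      rw [← sprod_cons] at hmem
      rw [colorSign_cons, map_block_cons, map_block_cons, map_block_cons, hsum,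
        if_neg (by decide), if_neg (by decide), if_pos rfl, sprod_cons_cons_comm hmem (hv 0),
        ← negOnePow_smul (k := k), smul_smul, smul_smul, LinearMap.comp_apply, lmul_apply,
        sprod_cons (v 0), mul_right_comm, ← Int.negOnePow_add]
      congr 2
      rw [Int.negOnePow_eq_iff]
      exact ⟨-(d 0 * (((block c 0).map fun i => d i.succ).sum +
        ((block c 1).map fun i => d i.succ).sum)), by ring⟩

theorem circ_eq {n : ℤ} (f : SymAlg 𝒱 →ₗ[k] V) {g : SymAlg 𝒱 →ₗ[k] V}
    (hg : g ∈ homDeg (symDeg 𝒱) 𝒱 n) {p : ℕ} {d : Fin p → ℤ} {v : Fin p → V}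
    (hv : ∀ a, v a ∈ 𝒱 (d a)) :
    circ 𝒱 f g d v = f (insertion hV g (sprod 𝒱 (List.ofFn v))) := by
  rw [comp_insertion_sprod hV hg f hv]
  simp only [circ, ← koszul_eq_colorSign]
  rw [← sum_shuffles fun σ A B =>
    koszul d σ • f (sprod 𝒱 (g (sprod 𝒱 (A.map v)) :: B.map v))]
  simp only [List.map_take, List.map_drop, List.map_ofFn]

end Evaluation

/-! ### The direct sum `C*(V, W)` and its grading. -/

section CStar

variable {k V W : Type*} [Field k] [AddCommGroup V] [Module k V] [AddCommGroup W] [Module k W]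
  {𝒱 : ℤ → Submodule k V} {𝒲 : ℤ → Submodule k W}

/-- The linear map underlying an element of `C*(V, W)`. -/
noncomputable def CStar.val : CStar 𝒱 𝒲 →ₗ[k] SymAlg 𝒱 →ₗ[k] W :=
  DirectSum.toModule k ℤ _ fun n => (Cochain 𝒱 𝒲 n).subtype

@[simp] theorem CStar.val_of (n : ℤ) (f : Cochain 𝒱 𝒲 n) :
    CStar.val (CStar.of 𝒱 𝒲 n f) = f.1 := by
  rw [CStar.val, CStar.of, DirectSum.toModule_lof]
  rfl

theorem CStar.of_mem (n : ℤ) (f : Cochain 𝒱 𝒲 n) : CStar.of 𝒱 𝒲 n f ∈ CStar.deg 𝒱 𝒲 n :=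
  ⟨f, rfl⟩

/-- Compares elements through their underlying maps, so that summands indexed by `i + j` and `j + i`
need no transport. -/
theorem CStar.eq_of_val_eq {n : ℤ} {x y : CStar 𝒱 𝒲} (hx : x ∈ CStar.deg 𝒱 𝒲 n)
    (hy : y ∈ CStar.deg 𝒱 𝒲 n) (h : CStar.val x = CStar.val y) : x = y := by
  obtain ⟨f, rfl⟩ := hx
  obtain ⟨g, rfl⟩ := hy
  rw [CStar.val_of, CStar.val_of] at h
  rw [Subtype.ext h]

theorem CStar.isInternal_deg : DirectSum.IsInternal (CStar.deg 𝒱 𝒲) := by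
  have hof : ∀ n, Function.Injective (CStar.of 𝒱 𝒲 n) := fun n =>
    DirectSum.of_injective (β := fun n => Cochain 𝒱 𝒲 n) n
  let e : (⨁ n, Cochain 𝒱 𝒲 n) ≃ₗ[k] ⨁ n, CStar.deg 𝒱 𝒲 n :=
    DFinsupp.mapRange.linearEquiv fun n => LinearEquiv.ofInjective (CStar.of 𝒱 𝒲 n) (hof n)
  have h : DirectSum.coeLinearMap (CStar.deg 𝒱 𝒲) ∘ₗ e.toLinearMap = LinearMap.id := by
    refine DirectSum.linearMap_ext k fun n => LinearMap.ext fun f => ?_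
    have : e (DirectSum.lof k ℤ (fun n => Cochain 𝒱 𝒲 n) n f) =
        DirectSum.lof k ℤ (fun n => CStar.deg 𝒱 𝒲 n) n
          (LinearEquiv.ofInjective (CStar.of 𝒱 𝒲 n) (hof n) f) :=
      DFinsupp.mapRange_single (hf := fun _ => map_zero _)
    rw [LinearMap.comp_apply, LinearMap.comp_apply, LinearEquiv.coe_coe, this]
    exact DirectSum.coeLinearMap_lof (CStar.deg 𝒱 𝒲) n ⟨CStar.of 𝒱 𝒲 n f, CStar.of_mem n f⟩
  have hb : Function.Bijective (DirectSum.coeLinearMap (CStar.deg 𝒱 𝒲) ∘ e) := by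
    rw [← LinearEquiv.coe_coe, ← LinearMap.coe_comp, h]
    exact Function.bijective_id
  exact (Function.Bijective.of_comp_iff _ e.bijective).1 hb

theorem CStar.induction {P : CStar 𝒱 𝒲 → Prop} (x : CStar 𝒱 𝒲)
    (of : ∀ n f, P (CStar.of 𝒱 𝒲 n f)) (add : ∀ x y, P x → P y → P (x + y)) : P x := by
  induction x using DirectSum.induction_on with
  | zero => simpa using of 0 0
  | of n f => exact of n f
  | add x y hx hy => exact add x y hx hy

/-- The bilinear map on `C*(V, W)` with given homogeneous components. -/
noncomputable def CStar.lift₂ {N : Type*} [AddCommMonoid N] [Module k N]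
    (B : ∀ m n, Cochain 𝒱 𝒲 m →ₗ[k] Cochain 𝒱 𝒲 n →ₗ[k] N) :
    CStar 𝒱 𝒲 →ₗ[k] CStar 𝒱 𝒲 →ₗ[k] N :=
  DirectSum.toModule k ℤ _ fun m =>
    (DirectSum.toModule k ℤ _ fun n => (B m n).flip).flip

theorem CStar.lift₂_of {N : Type*} [AddCommMonoid N] [Module k N]
    (B : ∀ m n, Cochain 𝒱 𝒲 m →ₗ[k] Cochain 𝒱 𝒲 n →ₗ[k] N) (m n : ℤ) (f : Cochain 𝒱 𝒲 m)
    (g : Cochain 𝒱 𝒲 n) :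
    CStar.lift₂ B (CStar.of 𝒱 𝒲 m f) (CStar.of 𝒱 𝒲 n g) = B m n f g := by
  rw [CStar.lift₂, CStar.of, CStar.of, DirectSum.toModule_lof, LinearMap.flip_apply,
    DirectSum.toModule_lof, LinearMap.flip_apply]

theorem CStar.hom_ext₂ {N : Type*} [AddCommMonoid N] [Module k N]
    {φ ψ : CStar 𝒱 𝒲 →ₗ[k] CStar 𝒱 𝒲 →ₗ[k] N}
    (h : ∀ m n f g, φ (CStar.of 𝒱 𝒲 m f) (CStar.of 𝒱 𝒲 n g) =
      ψ (CStar.of 𝒱 𝒲 m f) (CStar.of 𝒱 𝒲 n g)) : φ = ψ := by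
  refine LinearMap.ext fun x => LinearMap.ext fun y => ?_
  induction x using CStar.induction with
  | add x x' hx hx' => rw [map_add, map_add, LinearMap.add_apply, LinearMap.add_apply, hx, hx']
  | of m f =>
    induction y using CStar.induction with
    | add y y' hy hy' => rw [map_add, map_add, hy, hy']
    | of n g => exact h m n f g

theorem CStar.hom_ext {N : Type*} [AddCommMonoid N] [Module k N] {φ ψ : CStar 𝒱 𝒲 →ₗ[k] N}
    (h : ∀ n f, φ (CStar.of 𝒱 𝒲 n f) = ψ (CStar.of 𝒱 𝒲 n f)) : φ = ψ := by
  refine LinearMap.ext fun x => ?_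
  induction x using CStar.induction with
  | add x x' hx hx' => rw [map_add, map_add, hx, hx']
  | of n f => exact h n f

end CStar

/-! ### The Nijenhuis–Richardson graded Lie algebra. -/

section NijenhuisRichardson

variable {k V : Type*} [Field k] [AddCommGroup V] [Module k V] {𝒱 : ℤ → Submodule k V}
  (hV : DirectSum.IsInternal 𝒱)

/-- The component of the Nijenhuis–Richardson bracket in degrees `m` and `n`. -/
noncomputable def nrHomog (m n : ℤ) :
    Cochain 𝒱 𝒱 m →ₗ[k] Cochain 𝒱 𝒱 n →ₗ[k] Cochain 𝒱 𝒱 (m + n) :=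
  LinearMap.mk₂ k (fun f g => ⟨nrBracket hV m n f.1 g.1, nrBracket_mem hV f.2 g.2⟩)
    (fun f f' g => Subtype.ext <| LinearMap.ext fun s => by
      simp only [nrBracket, Submodule.coe_add, map_add, LinearMap.add_apply, LinearMap.sub_apply,
        LinearMap.comp_apply, LinearMap.smul_apply]
      module)
    (fun c f g => Subtype.ext <| LinearMap.ext fun s => by
      simp only [nrBracket, Submodule.coe_smul, map_smul, LinearMap.sub_apply,
        LinearMap.comp_apply, LinearMap.smul_apply]
      module)
    (fun f g g' => Subtype.ext <| LinearMap.ext fun s => by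
      simp only [nrBracket, Submodule.coe_add, map_add, LinearMap.add_apply, LinearMap.sub_apply,
        LinearMap.comp_apply, LinearMap.smul_apply]
      module)
    (fun c f g => Subtype.ext <| LinearMap.ext fun s => by
      simp only [nrBracket, Submodule.coe_smul, map_smul, LinearMap.sub_apply,
        LinearMap.comp_apply, LinearMap.smul_apply]
      module)

/-- The Nijenhuis–Richardson bracket on `C*(V, V)`. -/
noncomputable def nr : CStar 𝒱 𝒱 →ₗ[k] CStar 𝒱 𝒱 →ₗ[k] CStar 𝒱 𝒱 :=
  CStar.lift₂ fun m n => (nrHomog hV m n).compr₂ (CStar.of 𝒱 𝒱 (m + n))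

theorem nr_of (m n : ℤ) (f : Cochain 𝒱 𝒱 m) (g : Cochain 𝒱 𝒱 n) :
    nr hV (CStar.of 𝒱 𝒱 m f) (CStar.of 𝒱 𝒱 n g) = CStar.of 𝒱 𝒱 (m + n) (nrHomog hV m n f g) := by
  rw [nr, CStar.lift₂_of]
  rfl

theorem nrHomog_coe (m n : ℤ) (f : Cochain 𝒱 𝒱 m) (g : Cochain 𝒱 𝒱 n) :
    (nrHomog hV m n f g).1 = nrBracket hV m n f.1 g.1 := rfl

theorem isNRBracket_nr : IsNRBracket 𝒱 (nr hV) := fun m n f g =>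
  ⟨nrHomog hV m n f g, nr_of hV m n f g, fun p d v hv => by
    rw [circ_eq hV _ g.2 hv, circ_eq hV _ f.2 hv, negOnePow_smul (k := k)]
    rfl⟩

/-- The defining formula fixes the values on products of homogeneous vectors, and these span `S(V)`.
-/
theorem IsNRBracket.eq_nr {NR : CStar 𝒱 𝒱 →ₗ[k] CStar 𝒱 𝒱 →ₗ[k] CStar 𝒱 𝒱}
    (h : IsNRBracket 𝒱 NR) : NR = nr hV := by
  refine CStar.hom_ext₂ fun m n f g => ?_
  obtain ⟨x, hx, hx'⟩ := h m n f g
  obtain ⟨y, hy, hy'⟩ := isNRBracket_nr hV m n f g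
  rw [hx, hy]
  refine congrArg _ (Subtype.ext (symAlg_hom_ext hV fun p d v hv => ?_))
  rw [hx' p d v hv, hy' p d v hv]

theorem isGradedLieAlgebra_nr : IsGradedLieAlgebra (L := CStar 𝒱 𝒱) (CStar.deg 𝒱 𝒱) (nr hV) := by
  have hmem : ∀ i j, ∀ x ∈ CStar.deg 𝒱 𝒱 i, ∀ y ∈ CStar.deg 𝒱 𝒱 j,
      nr hV x y ∈ CStar.deg 𝒱 𝒱 (i + j) := by
    rintro i j _ ⟨f, rfl⟩ _ ⟨g, rfl⟩
    rw [nr_of]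
    exact CStar.of_mem _ _
  refine ⟨CStar.isInternal_deg, hmem, ?_, ?_⟩
  · intro i j x hx y hy
    rw [negOnePow_smul (k := k), ← neg_smul]
    refine CStar.eq_of_val_eq (hmem i j x hx y hy)
      (Submodule.smul_mem _ _ (add_comm j i ▸ hmem j i y hy x hx)) ?_
    obtain ⟨f, rfl⟩ := hx
    obtain ⟨g, rfl⟩ := hy
    rw [map_smul, neg_smul, nr_of, nr_of, CStar.val_of, CStar.val_of, nrHomog_coe, nrHomog_coe,
      ← nrBracket_skew]
  · intro i j l x hx y hy z hz
    rw [negOnePow_smul (k := k)]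
    refine CStar.eq_of_val_eq (hmem i (j + l) x hx _ (hmem j l y hy z hz))
      (Submodule.add_mem _ (add_assoc i j l ▸ hmem (i + j) l _ (hmem i j x hx y hy) z hz)
        (Submodule.smul_mem _ _
          (add_left_comm j i l ▸ hmem j (i + l) y hy _ (hmem i l x hx z hz)))) ?_
    obtain ⟨f, rfl⟩ := hx
    obtain ⟨g, rfl⟩ := hy
    obtain ⟨h, rfl⟩ := hz
    rw [map_add, map_smul]
    simp only [nr_of, CStar.val_of, nrHomog_coe]
    exact nrBracket_jacobi hV f.2 g.2 h.2

end NijenhuisRichardson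

/-! ### Derived brackets on abelian subalgebras. -/

section DerivedBracket

variable {k L A : Type*} [Field k] [AddCommGroup L] [Module k L] [AddCommGroup A] [Module k A]

theorem isInternal_suspDeg {𝒜 : ℤ → Submodule k A} (h : DirectSum.IsInternal 𝒜) :
    DirectSum.IsInternal (suspDeg 𝒜) := by
  rw [DirectSum.isInternal_submodule_iff_iSupIndep_and_iSup_eq_top] at h ⊢
  refine ⟨h.1.comp (sub_left_injective (b := (1 : ℤ))), ?_⟩
  rw [← h.2]
  exact (Equiv.subRight (1 : ℤ)).iSup_comp (g := 𝒜)

/-- A derived bracket on an abelian subalgebra of a graded Lie algebra makes the suspension a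
differential graded Lie algebra. -/
theorem isDGLieAlgebra_of_derivedBracket [CharZero k] {𝓛 : ℤ → Submodule k L}
    {NR : L →ₗ[k] L →ₗ[k] L} (hL : IsGradedLieAlgebra 𝓛 NR) {𝒜 : ℤ → Submodule k A}
    (h𝒜 : DirectSum.IsInternal 𝒜) {e : A →ₗ[k] L} (he : Function.Injective e)
    (he_mem : ∀ i, ∀ a ∈ 𝒜 i, e a ∈ 𝓛 i) (abel : ∀ a b, NR (e a) (e b) = 0)
    {Q P : L} (hQ : Q ∈ 𝓛 1) (hP : P ∈ 𝓛 1) (hQQ : NR Q Q = 0) (hPP : NR P P = 0)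
    (hPQ : NR P Q = 0) {br : A →ₗ[k] A →ₗ[k] A} {D : A →ₗ[k] A}
    (br_mem : ∀ i j, ∀ a ∈ 𝒜 i, ∀ b ∈ 𝒜 j, br a b ∈ 𝒜 (i + j + 1))
    (D_mem : ∀ i, ∀ a ∈ 𝒜 i, D a ∈ 𝒜 (i + 1))
    (hbr : ∀ i, ∀ a ∈ 𝒜 i, ∀ b, e (br a b) = i.negOnePow • NR (NR Q (e a)) (e b))
    (hD : ∀ a, e (D a) = NR P (e a)) :
    IsDGLieAlgebra (suspDeg 𝒜) br D := by
  have jac : ∀ {i j l : ℤ} {x y z : L}, x ∈ 𝓛 i → y ∈ 𝓛 j → z ∈ 𝓛 l →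
      NR x (NR y z) = NR (NR x y) z + sg k (i * j) • NR y (NR x z) := fun hx hy hz => by
    rw [hL.jacobi _ _ _ _ hx _ hy _ hz, negOnePow_smul (k := k)]
  have skew : ∀ {i j : ℤ} {x y : L}, x ∈ 𝓛 i → y ∈ 𝓛 j →
      NR x y = -(sg k (i * j) • NR y x) := fun hx hy => by
    rw [hL.skew _ _ _ hx _ hy, negOnePow_smul (k := k)]
  have hbr' : ∀ {i : ℤ} {a : A}, a ∈ 𝒜 i → ∀ b, e (br a b) = sg k i • NR (NR Q (e a)) (e b) :=
    fun ha b => by rw [hbr _ _ ha, negOnePow_smul (k := k)]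
  have sg_one : sg k 1 = -1 := by simp [sg]
  -- For odd `R` the Jacobi identity gives `[R, [R, x]] = -[R, [R, x]]`; the characteristic is used
  -- to divide by 2.
  have square : ∀ R ∈ 𝓛 1, NR R R = 0 → ∀ i, ∀ x ∈ 𝓛 i, NR R (NR R x) = 0 := by
    intro R hR hRR i x hx
    have h := jac hR hR hx
    rw [hRR, map_zero, LinearMap.zero_apply, zero_add, mul_one, sg_one, neg_smul, one_smul] at h
    have h2 : (2 : k) • NR R (NR R x) = 0 := by
      rw [two_smul]
      nth_rewrite 1 [h]
      exact neg_add_cancel _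
    exact (smul_eq_zero.1 h2).resolve_left two_ne_zero
  have skew_br : ∀ {i j : ℤ} {a b : A}, a ∈ 𝒜 i → b ∈ 𝒜 j →
      br a b = -(sg k ((i + 1) * (j + 1)) • br b a) := by
    intro i j a b ha hb
    apply he
    have hx := he_mem _ _ ha
    have hy := he_mem _ _ hb
    have hQy := hL.bracket_mem _ _ _ hQ _ hy
    -- Applying `[Q, ·]` to `[a, b] = 0` expresses `[[Q, a], b]` through `[a, [Q, b]]`, which gives
    -- the symmetry of the derived bracket.
    have h := jac hQ hx hy
    rw [abel, map_zero, skew hx hQy] at h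
    rw [map_neg, map_smul, hbr' ha, hbr' hb]
    have h' : NR (NR Q (e a)) (e b) = (sg k (1 * i) * sg k (i * (1 + j))) • NR (NR Q (e b)) (e a) := by
      linear_combination (norm := module) -h
    rw [h', smul_smul, smul_smul, ← neg_smul, ← neg_one_mul, ← sg_one]
    simp only [← sg_add]
    congr 1
    apply sg_eq_sg
    simp only [Int.even_add, Int.even_mul, Int.not_even_one]
    tauto
  refine ⟨⟨isInternal_suspDeg h𝒜, ?_, ?_, ?_⟩, ?_, ?_, ?_⟩
  · intro i j a ha b hb
    have := br_mem _ _ a ha b hb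
    rwa [show i - 1 + (j - 1) + 1 = i + j - 1 by ring] at this
  · intro i j a ha b hb
    rw [skew_br ha hb, negOnePow_smul (k := k), sub_add_cancel, sub_add_cancel]
  · intro i j l a ha b hb c hc
    apply he
    have hx := he_mem _ _ ha
    have hy := he_mem _ _ hb
    have hz := he_mem _ _ hc
    have hQx := hL.bracket_mem _ _ _ hQ _ hx
    have hQy := hL.bracket_mem _ _ _ hQ _ hy
    -- The Jacobi identity for `[Q, a]`, `[Q, b]`, `c` has the right shape once `[[Q, a], [Q, b]]`
    -- is rewritten as `± [Q, [[Q, a], b]]`, which uses `[Q, [Q, a]] = 0`.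
    have h1 := jac hQx hQy hz
    have h2 := jac hQ hQx hy
    rw [square Q hQ hQQ _ _ hx, map_zero, LinearMap.zero_apply, zero_add] at h2
    have h3 : NR (NR Q (e a)) (NR Q (e b)) =
        sg k (1 * (1 + (i - 1))) • NR Q (NR (NR Q (e a)) (e b)) := by
      rw [h2, smul_smul, sg_mul_self, one_smul]
    rw [h3] at h1
    rw [map_add, negOnePow_smul (k := k), map_smul, hbr' ha, hbr' hb c,
      hbr' (br_mem _ _ _ ha _ hb), hbr' ha b, hbr' hb, hbr' ha c]
    simp only [map_smul, LinearMap.smul_apply, h1, smul_add, smul_smul, ← sg_add]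
    refine congrArg₂ (· + ·) (congrArg (· • _) (sg_eq_sg ?_)) (congrArg (· • _) (sg_eq_sg ?_)) <;>
    simp only [Int.even_add, Int.even_sub, Int.even_mul, Int.not_even_one] <;>
    by_cases hi : Even i <;> by_cases hj : Even j <;> simp [hi, hj]
  · intro i a ha
    have := D_mem _ a ha
    rwa [show i - 1 + 1 = i + 1 - 1 by ring] at this
  · intro a
    apply he
    rw [map_zero, hD, hD]
    refine homog_induction h𝒜 (p := fun a => NR P (NR P (e a)) = 0) (fun a b ha hb => ?_)
      (fun i a ha => square P hP hPP _ _ (he_mem _ _ ha)) a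
    rw [map_add, map_add, map_add, ha, hb, add_zero]
  · intro i j a ha b hb
    apply he
    have hx := he_mem _ _ ha
    have hy := he_mem _ _ hb
    -- The operator `[P, ·]` is a derivation of the ambient bracket and, since `[P, Q] = 0`, passes
    -- through `[Q, ·]` up to sign.
    have h1 := jac hP (hL.bracket_mem _ _ _ hQ _ hx) hy
    have h2 := jac hP hQ hx
    rw [hPQ, map_zero, LinearMap.zero_apply, zero_add] at h2
    rw [h2] at h1
    simp only [map_add, negOnePow_smul (k := k), map_smul, hbr' ha, hbr' (D_mem _ _ ha), hD,
      LinearMap.smul_apply, h1, smul_add, smul_smul, ← sg_add]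
    refine congrArg₂ (· + ·) (congrArg (· • _) (sg_eq_sg ?_)) (congrArg (· • _) (sg_eq_sg ?_)) <;>
    simp only [Int.even_add, Int.even_sub, Int.even_mul, Int.not_even_one] <;>
    by_cases hi : Even i <;> simp [hi]

end DerivedBracket

/-! ### Cochains concentrated on `S²`. -/

section Quadratic

variable {k V W M : Type*} [Field k] [AddCommGroup V] [Module k V] [AddCommGroup W] [Module k W]
  [AddCommGroup M] [Module k M] {𝒱 : ℤ → Submodule k V}

/-- The action of `V` on `k × V × W` that encodes a bilinear map `q : V × V → W`. -/
noncomputable def quadraticStep (q : V →ₗ[k] V →ₗ[k] W) : V →ₗ[k] Module.End k (k × V × W) :=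
  -- Starting from `(1, 0, 0)`, one factor gives `(0, v, 0)`, two give `(0, 0, q v w)`, and a third
  -- gives zero. The last component therefore detects products of length two only.
  LinearMap.mk₂ k (fun v x => ((0 : k), x.1 • v, q v x.2.1))
    (fun v w x => by simp) (fun c v x => by simp [smul_comm x.1 c v])
    (fun v x y => by simp [add_smul]) (fun c v x => by simp [mul_smul])

theorem quadraticStep_apply (q : V →ₗ[k] V →ₗ[k] W) (v : V) (x : k × V × W) :
    quadraticStep q v x = (0, x.1 • v, q v x.2.1) := rfl

/-- The map `S(V) → W` that is a graded symmetric bilinear map on `S²(V)` and zero elsewhere. -/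
noncomputable def quadraticMap (q : V →ₗ[k] V →ₗ[k] W)
    (hq : ∀ i j, ∀ x ∈ 𝒱 i, ∀ y ∈ 𝒱 j, q x y = sg k (i * j) • q y x) : SymAlg 𝒱 →ₗ[k] W :=
  LinearMap.snd k V W ∘ₗ LinearMap.snd k k (V × W) ∘ₗ LinearMap.applyₗ ((1 : k), (0 : V), (0 : W)) ∘ₗ
    (symLift (𝒱 := 𝒱) (quadraticStep q) (by
      intro i j x hx y hy
      refine LinearMap.ext fun z => ?_
      simp only [Module.End.mul_apply, LinearMap.smul_apply, quadraticStep_apply, zero_smul,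
        map_smul, Prod.smul_mk, smul_zero]
      rw [hq i j x hx y hy, smul_comm])).toLinearMap

theorem quadraticMap_sprod (q : V →ₗ[k] V →ₗ[k] W)
    (hq : ∀ i j, ∀ x ∈ 𝒱 i, ∀ y ∈ 𝒱 j, q x y = sg k (i * j) • q y x) (l : List V) :
    quadraticMap q hq (sprod 𝒱 l) =
      (l.foldr (fun v z => quadraticStep q v z) ((1 : k), (0 : V), (0 : W))).2.2 := by
  rw [quadraticMap]
  simp only [LinearMap.comp_apply, AlgHom.toLinearMap_apply, LinearMap.applyₗ_apply_apply,
    LinearMap.snd_apply]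
  congr 2
  induction l with
  | nil => simp [sprod_nil]
  | cons v l ih => rw [sprod_cons, map_mul, Module.End.mul_apply, ih, symLift_symι, List.foldr_cons]

theorem quadraticMap_pair (q : V →ₗ[k] V →ₗ[k] W)
    (hq : ∀ i j, ∀ x ∈ 𝒱 i, ∀ y ∈ 𝒱 j, q x y = sg k (i * j) • q y x) (x y : V) :
    quadraticMap q hq (sprod 𝒱 [x, y]) = q x y := by
  simp [quadraticMap_sprod, quadraticStep_apply]

theorem quadraticMap_of_length_ne (q : V →ₗ[k] V →ₗ[k] W)
    (hq : ∀ i j, ∀ x ∈ 𝒱 i, ∀ y ∈ 𝒱 j, q x y = sg k (i * j) • q y x) (l : List V)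
    (hl : l.length ≠ 2) : quadraticMap q hq (sprod 𝒱 l) = 0 := by
  rw [quadraticMap_sprod]
  match l, hl with
  | [], _ => rfl
  | [x], _ => simp [quadraticStep_apply]
  | x :: y :: z :: l, _ => simp [quadraticStep_apply]

/-- A quadratic map is determined by its values on pairs of homogeneous elements. -/
theorem quadratic_ext (hV : DirectSum.IsInternal 𝒱) {Q P : SymAlg 𝒱 →ₗ[k] W}
    (hQ : ∀ l : List V, l.length ≠ 2 → Q (sprod 𝒱 l) = 0)
    (hP : ∀ l : List V, l.length ≠ 2 → P (sprod 𝒱 l) = 0)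
    (h : ∀ i j, ∀ x ∈ 𝒱 i, ∀ y ∈ 𝒱 j, Q (sprod 𝒱 [x, y]) = P (sprod 𝒱 [x, y])) : Q = P := by
  refine symAlg_hom_ext hV fun p d v hv => ?_
  by_cases hp : p = 2
  · subst hp
    simpa using h _ _ _ (hv 0) _ (hv 1)
  · rw [hQ _ (by simpa using hp), hP _ (by simpa using hp)]

theorem quadratic_mem_homDeg {𝒲 : ℤ → Submodule k W} {n : ℤ} {Q : SymAlg 𝒱 →ₗ[k] W}
    (hQ : ∀ l : List V, l.length ≠ 2 → Q (sprod 𝒱 l) = 0)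
    (h : ∀ i j, ∀ x ∈ 𝒱 i, ∀ y ∈ 𝒱 j, Q (sprod 𝒱 [x, y]) ∈ 𝒲 (n + (i + j))) :
    Q ∈ homDeg (symDeg 𝒱) 𝒲 n := by
  refine mem_homDeg_of_sprod fun p d v hv => ?_
  by_cases hp : p = 2
  · subst hp
    simpa [Fin.sum_univ_two] using h _ _ _ (hv 0) _ (hv 1)
  · rw [hQ _ (by simpa using hp)]
    exact zero_mem _

theorem length_block_add {p : ℕ} (c : Fin p → Fin 2) :
    (block c 0).length + (block c 1).length = p := by
  have h := List.length_eq_length_filter_add (l := List.finRange p) (fun i => decide (c i = 0))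
  rw [List.length_finRange] at h
  refine Eq.trans ?_ h.symm
  rw [block, block]
  congr 2
  refine List.filter_congr fun i _ => ?_
  generalize c i = x
  fin_cases x <;> rfl

variable (hV : DirectSum.IsInternal 𝒱)

/-- The inner map consumes two vectors and returns one, so the outer map receives two arguments only
when `p = 3`. -/
theorem quadratic_insertion_sprod_of_ne {Q : SymAlg 𝒱 →ₗ[k] V} {P : SymAlg 𝒱 →ₗ[k] M} {n : ℤ}
    (hQn : Q ∈ homDeg (symDeg 𝒱) 𝒱 n)
    (hQ : ∀ l : List V, l.length ≠ 2 → Q (sprod 𝒱 l) = 0)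
    (hP : ∀ l : List V, l.length ≠ 2 → P (sprod 𝒱 l) = 0)
    {p : ℕ} (hp : p ≠ 3) {d : Fin p → ℤ} {v : Fin p → V} (hv : ∀ a, v a ∈ 𝒱 (d a)) :
    P (insertion hV Q (sprod 𝒱 (List.ofFn v))) = 0 := by
  rw [comp_insertion_sprod hV hQn P hv]
  refine Finset.sum_eq_zero fun c _ => ?_
  have := length_block_add c
  by_cases h : (block c 0).length = 2
  · rw [hP _ (by simp only [List.length_cons, List.length_map]; omega), smul_zero]
  · rw [hQ _ (by simpa using h), sprod_cons, map_zero, zero_mul, map_zero, smul_zero]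

theorem quadratic_insertion_sprod_three {Q : SymAlg 𝒱 →ₗ[k] V} (P : SymAlg 𝒱 →ₗ[k] M) {n : ℤ}
    (hQn : Q ∈ homDeg (symDeg 𝒱) 𝒱 n)
    (hQ : ∀ l : List V, l.length ≠ 2 → Q (sprod 𝒱 l) = 0)
    {d : Fin 3 → ℤ} {v : Fin 3 → V} (hv : ∀ a, v a ∈ 𝒱 (d a)) :
    P (insertion hV Q (sprod 𝒱 (List.ofFn v))) =
      P (sprod 𝒱 [Q (sprod 𝒱 [v 0, v 1]), v 2]) +
        sg k (d 1 * d 2) • P (sprod 𝒱 [Q (sprod 𝒱 [v 0, v 2]), v 1]) +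
        sg k (d 0 * (d 1 + d 2)) • P (sprod 𝒱 [Q (sprod 𝒱 [v 1, v 2]), v 0]) := by
  rw [comp_insertion_sprod hV hQn P hv, sum_pairs d fun A B =>
    P (sprod 𝒱 (Q (sprod 𝒱 (A.map v)) :: B.map v))]
  · have h0 : Finset.Ioi (0 : Fin 3) = {1, 2} := by decide
    have h1 : Finset.Ioi (1 : Fin 3) = {2} := by decide
    have h2 : Finset.Ioi (2 : Fin 3) = ∅ := by decide
    have h0' : Finset.Iio (0 : Fin 3) = ∅ := by decide
    have h1' : Finset.Iio (1 : Fin 3) = {0} := by decide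
    have h2' : Finset.Iio (2 : Fin 3) = {0, 1} := by decide
    have f01 : (List.finRange 3).filter (fun a => a ≠ 0 ∧ a ≠ 1) = [2] := by decide
    have f02 : (List.finRange 3).filter (fun a => a ≠ 0 ∧ a ≠ 2) = [1] := by decide
    have f12 : (List.finRange 3).filter (fun a => a ≠ 1 ∧ a ≠ 2) = [0] := by decide
    rw [Fin.sum_univ_three, h0, h1, h2, Finset.sum_pair (by decide), Finset.sum_singleton,
      Finset.sum_empty, add_zero, f01, f02, f12, h0', h1', h2', Finset.sum_pair (by decide)]
    simp only [Finset.sum_empty, Finset.sum_singleton, mul_zero, zero_add, negOnePow_smul (k := k),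
      List.map_cons, List.map_nil]
    congr 2
    · rw [sg_eq_ite, if_pos, one_smul]
      exact ⟨d 0 * d 1, by ring⟩
    · congr 1
      apply sg_eq_sg
      simp only [Int.even_add, Int.even_mul]
      tauto
    · apply sg_eq_sg
      simp only [Int.even_add, Int.even_mul]
      tauto
  · intro A B hA
    rw [hQ _ (by simpa using hA), sprod_cons, map_zero, zero_mul, map_zero]

/-- Since `q` sees only products of length one, the sole surviving term is the one in which `K`
takes every factor. -/
theorem linear_insertion {K : SymAlg 𝒱 →ₗ[k] V} {n : ℤ} (hK : K ∈ homDeg (symDeg 𝒱) 𝒱 n)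
    {q : SymAlg 𝒱 →ₗ[k] M} (hq : ∀ l : List V, l.length ≠ 1 → q (sprod 𝒱 l) = 0) (s : SymAlg 𝒱) :
    q (insertion hV K s) = q (symι 𝒱 (K s)) := by
  have h : q ∘ₗ insertion hV K = q ∘ₗ symι 𝒱 ∘ₗ K := by
    refine symAlg_hom_ext hV fun p d v hv => ?_
    rw [LinearMap.comp_apply, comp_insertion_sprod hV hK q hv,
      Finset.sum_eq_single (fun _ => (0 : Fin 2))]
    · have h0 : block (fun _ : Fin p => (0 : Fin 2)) 0 = List.finRange p := by simp [block]
      have h1 : block (fun _ : Fin p => (0 : Fin 2)) 1 = [] := by simp [block]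
      simp [h0, h1, colorSign, sprod_cons, sprod_nil, ← List.ofFn_eq_map]
    · intro c _ hc
      rw [hq, smul_zero]
      intro hlen
      refine hc (funext fun i => ?_)
      by_contra hi
      have hmem : i ∈ block c 1 := mem_block.2 (by omega)
      have : block c 1 = [] := by simpa using hlen
      simp [this] at hmem
    · simp
  exact LinearMap.congr_fun h s

end Quadratic

/-! ### The elements `μ_G + ρ` and `λ μ_H` and their commutation relations. -/

section Semidirect

variable {k G H : Type*} [Field k] [AddCommGroup G] [Module k G] [AddCommGroup H] [Module k H]
  {𝒢 : ℤ → Submodule k G} {ℋ : ℤ → Submodule k H}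
  {brG : G →ₗ[k] G →ₗ[k] G} {brH : H →ₗ[k] H →ₗ[k] H} {ρ : G →ₗ[k] H →ₗ[k] H} {lam : k}

theorem isInternal_prodDeg (hG : DirectSum.IsInternal 𝒢) (hH : DirectSum.IsInternal ℋ) :
    DirectSum.IsInternal (prodDeg 𝒢 ℋ) := by
  have hG' := (DirectSum.isInternal_submodule_iff_iSupIndep_and_iSup_eq_top 𝒢).1 hG
  have hH' := (DirectSum.isInternal_submodule_iff_iSupIndep_and_iSup_eq_top ℋ).1 hH
  rw [DirectSum.isInternal_submodule_iff_iSupIndep_and_iSup_eq_top]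
  constructor
  · intro i
    have hle : (⨆ j, ⨆ (_ : j ≠ i), prodDeg 𝒢 ℋ j) ≤
        (⨆ j, ⨆ (_ : j ≠ i), 𝒢 j).prod (⨆ j, ⨆ (_ : j ≠ i), ℋ j) :=
      iSup₂_le fun j hj => Submodule.prod_mono (le_iSup₂_of_le j hj le_rfl)
        (le_iSup₂_of_le j hj le_rfl)
    rw [Submodule.disjoint_def]
    intro x hx hx'
    exact Prod.ext (Submodule.disjoint_def.1 (hG'.1 i) _ hx.1 (hle hx').1)
      (Submodule.disjoint_def.1 (hH'.1 i) _ hx.2 (hle hx').2)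
  · rw [Submodule.eq_top_iff']
    rintro ⟨x, y⟩
    have h1 : ∀ x : G, (x, (0 : H)) ∈ ⨆ i, prodDeg 𝒢 ℋ i := fun x => by
      induction x using homog_induction hG with
      | add x x' hx hx' => simpa using add_mem hx hx'
      | homog i x hx => exact Submodule.mem_iSup_of_mem i ⟨hx, zero_mem _⟩
    have h2 : ∀ y : H, ((0 : G), y) ∈ ⨆ i, prodDeg 𝒢 ℋ i := fun y => by
      induction y using homog_induction hH with
      | add y y' hy hy' => simpa using add_mem hy hy'
      | homog i y hy => exact Submodule.mem_iSup_of_mem i ⟨zero_mem _, hy⟩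
    simpa using add_mem (h1 x) (h2 y)

theorem IsSymGradedLieAlgebra.symm_sg {𝓛 : ℤ → Submodule k G} {br : G →ₗ[k] G →ₗ[k] G}
    (h : IsSymGradedLieAlgebra 𝓛 br) {i j : ℤ} {x y : G} (hx : x ∈ 𝓛 i) (hy : y ∈ 𝓛 j) :
    br x y = sg k (i * j) • br y x := by
  rw [h.symm _ _ _ hx _ hy, negOnePow_smul (k := k)]

/-- The Jacobi identity of a symmetric graded Lie algebra, as a sum over shuffles. -/
theorem IsSymGradedLieAlgebra.jacobi {𝓛 : ℤ → Submodule k G} {br : G →ₗ[k] G →ₗ[k] G}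
    (h : IsSymGradedLieAlgebra 𝓛 br) {i j l : ℤ} {x y z : G} (hx : x ∈ 𝓛 i) (hy : y ∈ 𝓛 j)
    (hz : z ∈ 𝓛 l) :
    br (br x y) z + sg k (j * l) • br (br x z) y + sg k (i * (j + l)) • br (br y z) x = 0 := by
  have h1 := h.leibniz _ _ _ _ hx _ hy _ hz
  rw [h.symm_sg hx (h.bracket_mem _ _ _ hy _ hz), h.symm_sg hy (h.bracket_mem _ _ _ hx _ hz),
    negOnePow_smul (k := k), negOnePow_smul (k := k)] at h1
  simp only [sg_eq_ite, Int.even_add, Int.even_mul, Int.not_even_one] at h1 ⊢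
  by_cases hi : Even i <;> by_cases hj : Even j <;> by_cases hl : Even l <;>
    simp only [hi, hj, hl, or_true, or_false, or_self, iff_true, iff_false, iff_self,
      not_true, if_true, if_false] at h1 ⊢ <;>
    first
    | linear_combination (norm := module) h1
    | linear_combination (norm := module) -h1

theorem IsAction.map_bracket_apply (hρ : IsAction 𝒢 ℋ brG brH ρ) {i j : ℤ} {x y : G}
    (hx : x ∈ 𝒢 i) (hy : y ∈ 𝒢 j) (h : H) :
    ρ (brG x y) h = -(sg k i • ρ x (ρ y h) + sg k ((i + 1) * j) • ρ y (ρ x h)) := by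
  rw [hρ.map_bracket _ _ _ hx _ hy, negOnePow_smul (k := k), gradedCommutator,
    negOnePow_smul (k := k)]
  simp only [LinearMap.smul_apply, LinearMap.sub_apply, LinearMap.comp_apply]
  simp only [sg_eq_ite, Int.even_add, Int.even_mul, Int.not_even_one]
  by_cases hi : Even i <;> by_cases hj : Even j <;> simp [hi, hj] <;> abel

theorem IsAction.apply_mem (hρ : IsAction 𝒢 ℋ brG brH ρ) {i j : ℤ} {x : G} {h : H}
    (hx : x ∈ 𝒢 i) (hh : h ∈ ℋ j) : ρ x h ∈ ℋ (i + j + 1) := by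
  have := (hρ.isDerivation _ _ hx).mem_homDeg _ _ hh
  rwa [add_right_comm] at this

/-- The second term of the derivation rule is turned around so that values of `ρ` stand in the first
slot, as they do in `quadratic_insertion_sprod_three`. -/
theorem IsAction.apply_bracket (hρ : IsAction 𝒢 ℋ brG brH ρ) (hH : IsSymGradedLieAlgebra ℋ brH)
    {i j l : ℤ} {x : G} {a b : H} (hx : x ∈ 𝒢 i) (ha : a ∈ ℋ j) (hb : b ∈ ℋ l) :
    ρ x (brH a b) = sg k (i + 1) • brH (ρ x a) b +
      sg k ((i + 1) * (j + 1) + j * (i + l + 1)) • brH (ρ x b) a := by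
  rw [(hρ.isDerivation _ _ hx).map_bracket _ _ _ ha _ hb, hH.symm_sg ha (hρ.apply_mem hx hb),
    negOnePow_smul (k := k), negOnePow_smul (k := k), smul_smul, ← sg_add]

/-- The semidirect product bracket on `G × H`. -/
noncomputable def semidirectForm (hG : DirectSum.IsInternal 𝒢) (hH : DirectSum.IsInternal ℋ)
    (brG : G →ₗ[k] G →ₗ[k] G) (ρ : G →ₗ[k] H →ₗ[k] H) : G × H →ₗ[k] G × H →ₗ[k] G × H :=
  -- The sign `(-1)^(ij)` is not bilinear as written: the degree of `x` is fixed by `homogLift`, and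
  -- the dependence on that of `y` is carried by `twist`.
  homogLift (isInternal_prodDeg hG hH) fun i => LinearMap.mk₂ k
    (fun (x : prodDeg 𝒢 ℋ i) (y : G × H) =>
      (brG x.1.1 y.1, ρ x.1.1 y.2 + ρ (twist hG i y.1) x.1.2))
    (fun x x' y => by simp [add_add_add_comm]) (fun c x y => by simp)
    (fun x y y' => by simp [add_add_add_comm]) (fun c x y => by simp)

theorem semidirectForm_apply (hG : DirectSum.IsInternal 𝒢) (hH : DirectSum.IsInternal ℋ)
    {i j : ℤ} {x y : G × H} (hx : x ∈ prodDeg 𝒢 ℋ i) (hy : y ∈ prodDeg 𝒢 ℋ j) :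
    semidirectForm hG hH brG ρ x y =
      (brG x.1 y.1, ρ x.1 y.2 + sg k (i * j) • ρ y.1 x.2) := by
  rw [semidirectForm, homogLift_apply _ _ hx, LinearMap.mk₂_apply, twist_apply hG i hy.1, map_smul,
    LinearMap.smul_apply]

theorem exists_semidirectElement (hG : IsSymGradedLieAlgebra 𝒢 brG)
    (hH : DirectSum.IsInternal ℋ) :
    ∃ Q : SymAlg (prodDeg 𝒢 ℋ) →ₗ[k] G × H, IsSemidirectElement 𝒢 ℋ brG ρ Q := by
  have happ : ∀ i j, ∀ x ∈ prodDeg 𝒢 ℋ i, ∀ y ∈ prodDeg 𝒢 ℋ j,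
      semidirectForm hG.isInternal hH brG ρ x y =
        (brG x.1 y.1, ρ x.1 y.2 + sg k (i * j) • ρ y.1 x.2) :=
    fun i j x hx y hy => semidirectForm_apply _ _ hx hy
  have hq : ∀ i j, ∀ x ∈ prodDeg 𝒢 ℋ i, ∀ y ∈ prodDeg 𝒢 ℋ j,
      semidirectForm hG.isInternal hH brG ρ x y =
        sg k (i * j) • semidirectForm hG.isInternal hH brG ρ y x := by
    intro i j x hx y hy
    rw [happ i j x hx y hy, happ j i y hy x hx, Prod.smul_mk, ← hG.symm_sg hx.1 hy.1, smul_add,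
      smul_smul, mul_comm j i, sg_mul_self, one_smul, add_comm (ρ x.1 y.2)]
  exact ⟨quadraticMap _ hq, quadraticMap_of_length_ne _ hq, fun i j x hx y hy => by
    rw [quadraticMap_pair, happ i j x hx y hy, negOnePow_smul (k := k)]⟩

theorem IsSemidirectElement.mem_homDeg {Q : SymAlg (prodDeg 𝒢 ℋ) →ₗ[k] G × H}
    (hQ : IsSemidirectElement 𝒢 ℋ brG ρ Q) (hG : IsSymGradedLieAlgebra 𝒢 brG)
    (hρ : IsAction 𝒢 ℋ brG brH ρ) : Q ∈ homDeg (symDeg (prodDeg 𝒢 ℋ)) (prodDeg 𝒢 ℋ) 1 := by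
  refine quadratic_mem_homDeg hQ.1 fun i j x hx y hy => ?_
  rw [hQ.2 i j x hx y hy, negOnePow_smul (k := k), add_comm 1]
  have h : ρ y.1 x.2 ∈ ℋ (i + j + 1) := add_comm j i ▸ hρ.apply_mem hy.1 hx.2
  exact ⟨hG.bracket_mem _ _ _ hx.1 _ hy.1,
    add_mem (hρ.apply_mem hx.1 hy.2) (Submodule.smul_mem _ _ h)⟩

theorem IsSemidirectElement.unique {Q Q' : SymAlg (prodDeg 𝒢 ℋ) →ₗ[k] G × H}
    (hQ : IsSemidirectElement 𝒢 ℋ brG ρ Q) (hQ' : IsSemidirectElement 𝒢 ℋ brG ρ Q')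
    (hV : DirectSum.IsInternal (prodDeg 𝒢 ℋ)) : Q = Q' :=
  quadratic_ext hV hQ.1 hQ'.1 fun i j x hx y hy => by
    rw [hQ'.2 i j x hx y hy, hQ.2 i j x hx y hy]

theorem existsUnique_semidirectElement (hG : IsSymGradedLieAlgebra 𝒢 brG)
    (hH : DirectSum.IsInternal ℋ) (hρ : IsAction 𝒢 ℋ brG brH ρ) :
    ∃! Q : Cochain (prodDeg 𝒢 ℋ) (prodDeg 𝒢 ℋ) 1, IsSemidirectElement 𝒢 ℋ brG ρ Q.1 := by
  obtain ⟨Q, hQ⟩ := exists_semidirectElement (ρ := ρ) hG hH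
  exact ⟨⟨Q, hQ.mem_homDeg hG hρ⟩, hQ, fun Q' hQ' =>
    Subtype.ext (hQ'.unique hQ (isInternal_prodDeg hG.isInternal hH))⟩

/-- The bracket of `H` with weight `lam`, as a bilinear map on `G × H`. -/
noncomputable def weightForm (brH : H →ₗ[k] H →ₗ[k] H) (lam : k) :
    G × H →ₗ[k] G × H →ₗ[k] G × H :=
  LinearMap.mk₂ k (fun x y => ((0 : G), lam • brH x.2 y.2))
    (fun x x' y => by simp) (fun c x y => by simp [smul_comm lam c])
    (fun x y y' => by simp) (fun c x y => by simp [smul_comm lam c])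

theorem exists_weightElement (hH : IsSymGradedLieAlgebra ℋ brH) (lam : k) :
    ∃ P : SymAlg (prodDeg 𝒢 ℋ) →ₗ[k] G × H, IsWeightElement 𝒢 ℋ brH lam P := by
  have happ : ∀ x y : G × H, weightForm brH lam x y = (0, lam • brH x.2 y.2) := fun _ _ => rfl
  have hq : ∀ i j, ∀ x ∈ prodDeg 𝒢 ℋ i, ∀ y ∈ prodDeg 𝒢 ℋ j,
      (weightForm brH lam : G × H →ₗ[k] G × H →ₗ[k] G × H) x y =
        sg k (i * j) • weightForm brH lam y x := by
    intro i j x hx y hy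
    rw [happ, happ, Prod.smul_mk, smul_zero, smul_comm, ← hH.symm_sg hx.2 hy.2]
  exact ⟨quadraticMap _ hq, quadraticMap_of_length_ne _ hq, fun x y => by
    rw [quadraticMap_pair, happ]⟩

theorem IsWeightElement.mem_homDeg {P : SymAlg (prodDeg 𝒢 ℋ) →ₗ[k] G × H}
    (hP : IsWeightElement 𝒢 ℋ brH lam P) (hH : IsSymGradedLieAlgebra ℋ brH) :
    P ∈ homDeg (symDeg (prodDeg 𝒢 ℋ)) (prodDeg 𝒢 ℋ) 1 := by
  refine quadratic_mem_homDeg hP.1 fun i j x hx y hy => ?_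
  rw [hP.2, add_comm 1]
  exact ⟨zero_mem _, Submodule.smul_mem _ _ (hH.bracket_mem _ _ _ hx.2 _ hy.2)⟩

theorem IsWeightElement.unique {P P' : SymAlg (prodDeg 𝒢 ℋ) →ₗ[k] G × H}
    (hP : IsWeightElement 𝒢 ℋ brH lam P) (hP' : IsWeightElement 𝒢 ℋ brH lam P')
    (hV : DirectSum.IsInternal (prodDeg 𝒢 ℋ)) : P = P' :=
  quadratic_ext hV hP.1 hP'.1 fun i j x hx y hy => by rw [hP'.2, hP.2]

theorem existsUnique_weightElement (hG : DirectSum.IsInternal 𝒢)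
    (hH : IsSymGradedLieAlgebra ℋ brH) (lam : k) :
    ∃! P : Cochain (prodDeg 𝒢 ℋ) (prodDeg 𝒢 ℋ) 1, IsWeightElement 𝒢 ℋ brH lam P.1 := by
  obtain ⟨P, hP⟩ := exists_weightElement (𝒢 := 𝒢) hH lam
  exact ⟨⟨P, hP.mem_homDeg hH⟩, hP, fun P' hP' =>
    Subtype.ext (hP'.unique hP (isInternal_prodDeg hG hH.isInternal))⟩

theorem IsSemidirectElement.pair {Q : SymAlg (prodDeg 𝒢 ℋ) →ₗ[k] G × H}
    (hQ : IsSemidirectElement 𝒢 ℋ brG ρ Q) {i j : ℤ} {x y : G × H} (hx : x ∈ prodDeg 𝒢 ℋ i)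
    (hy : y ∈ prodDeg 𝒢 ℋ j) :
    Q (sprod _ [x, y]) = (brG x.1 y.1, ρ x.1 y.2 + sg k (i * j) • ρ y.1 x.2) := by
  rw [hQ.2 i j x hx y hy, negOnePow_smul (k := k)]

theorem pair_mem {V : Type*} [AddCommGroup V] [Module k V] {𝒱 : ℤ → Submodule k V} {n : ℤ}
    {Q : SymAlg 𝒱 →ₗ[k] V} (hQ : Q ∈ homDeg (symDeg 𝒱) 𝒱 n) {i j : ℤ} {x y : V} (hx : x ∈ 𝒱 i)
    (hy : y ∈ 𝒱 j) : Q (sprod 𝒱 [x, y]) ∈ 𝒱 (n + (i + j)) :=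
  hQ _ _ (symι_mul_mem_symDeg hx (by simpa [sprod_nil, sprod_cons] using symι_mem_symDeg hy))

/-- On three vectors the `G`-component is the Jacobi identity of `G`; in the `H`-component `ρ` of a
bracket cancels against composites of two `ρ`'s. -/
theorem semidirect_insertion_semidirect (hG : IsSymGradedLieAlgebra 𝒢 brG)
    (hρ : IsAction 𝒢 ℋ brG brH ρ) (hV : DirectSum.IsInternal (prodDeg 𝒢 ℋ))
    {Q : SymAlg (prodDeg 𝒢 ℋ) →ₗ[k] G × H}
    (hQ1 : Q ∈ homDeg (symDeg (prodDeg 𝒢 ℋ)) (prodDeg 𝒢 ℋ) 1)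
    (hQ : IsSemidirectElement 𝒢 ℋ brG ρ Q) : Q ∘ₗ insertion hV Q = 0 := by
  refine symAlg_hom_ext hV fun p d v hv => ?_
  rw [LinearMap.comp_apply, LinearMap.zero_apply]
  by_cases hp : p = 3
  · subst hp
    have h0 := hv 0
    have h1 := hv 1
    have h2 := hv 2
    rw [quadratic_insertion_sprod_three hV Q hQ1 hQ.1 hv, hQ.pair (pair_mem hQ1 h0 h1) h2,
      hQ.pair (pair_mem hQ1 h0 h2) h1, hQ.pair (pair_mem hQ1 h1 h2) h0, hQ.pair h0 h1,
      hQ.pair h0 h2, hQ.pair h1 h2]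
    refine Prod.ext (hG.jacobi h0.1 h1.1 h2.1) ?_
    simp only [Prod.snd_add, Prod.smul_snd, Prod.snd_zero, hρ.map_bracket_apply h0.1 h1.1,
      hρ.map_bracket_apply h0.1 h2.1, hρ.map_bracket_apply h1.1 h2.1, map_add, map_smul]
    generalize d 0 = a, d 1 = b, d 2 = c
    simp only [sg_eq_ite, Int.even_add, Int.even_mul, Int.not_even_one]
    by_cases ha : Even a <;> by_cases hb : Even b <;> by_cases hc : Even c <;>
      simp only [ha, hb, hc, or_true, or_false, or_self, iff_true, iff_false, iff_self,
        not_true, if_true, if_false] <;> module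
  · exact quadratic_insertion_sprod_of_ne hV hQ1 hQ.1 hQ.1 hp hv

theorem weight_insertion_weight (hH : IsSymGradedLieAlgebra ℋ brH)
    (hV : DirectSum.IsInternal (prodDeg 𝒢 ℋ)) {P : SymAlg (prodDeg 𝒢 ℋ) →ₗ[k] G × H}
    (hP1 : P ∈ homDeg (symDeg (prodDeg 𝒢 ℋ)) (prodDeg 𝒢 ℋ) 1)
    (hP : IsWeightElement 𝒢 ℋ brH lam P) : P ∘ₗ insertion hV P = 0 := by
  refine symAlg_hom_ext hV fun p d v hv => ?_
  rw [LinearMap.comp_apply, LinearMap.zero_apply]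
  by_cases hp : p = 3
  · subst hp
    have h := hH.jacobi (hv 0).2 (hv 1).2 (hv 2).2
    rw [quadratic_insertion_sprod_three hV P hP1 hP.1 hv]
    simp only [hP.2]
    refine Prod.ext (by simp) ?_
    simp only [Prod.snd_add, Prod.smul_snd, Prod.snd_zero, map_smul, LinearMap.smul_apply]
    linear_combination (norm := module) (lam * lam) • h
  · exact quadratic_insertion_sprod_of_ne hV hP1 hP.1 hP.1 hp hv

/-- On three vectors the first composite yields terms `λ[ρ(x)v, w]` and the second terms `ρ(x)(λ[v,
w])`; they cancel because each `ρ(x)` is a derivation. -/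
theorem weight_insertion_semidirect_add (hH : IsSymGradedLieAlgebra ℋ brH)
    (hρ : IsAction 𝒢 ℋ brG brH ρ) (hV : DirectSum.IsInternal (prodDeg 𝒢 ℋ))
    {Q P : SymAlg (prodDeg 𝒢 ℋ) →ₗ[k] G × H}
    (hQ1 : Q ∈ homDeg (symDeg (prodDeg 𝒢 ℋ)) (prodDeg 𝒢 ℋ) 1)
    (hQ : IsSemidirectElement 𝒢 ℋ brG ρ Q)
    (hP1 : P ∈ homDeg (symDeg (prodDeg 𝒢 ℋ)) (prodDeg 𝒢 ℋ) 1)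
    (hP : IsWeightElement 𝒢 ℋ brH lam P) :
    P ∘ₗ insertion hV Q + Q ∘ₗ insertion hV P = 0 := by
  refine symAlg_hom_ext hV fun p d v hv => ?_
  rw [LinearMap.add_apply, LinearMap.comp_apply, LinearMap.comp_apply, LinearMap.zero_apply]
  by_cases hp : p = 3
  · subst hp
    have h0 := hv 0
    have h1 := hv 1
    have h2 := hv 2
    rw [quadratic_insertion_sprod_three hV P hQ1 hQ.1 hv,
      quadratic_insertion_sprod_three hV Q hP1 hP.1 hv, hQ.pair (pair_mem hP1 h0 h1) h2,
      hQ.pair (pair_mem hP1 h0 h2) h1, hQ.pair (pair_mem hP1 h1 h2) h0, hQ.pair h0 h1,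
      hQ.pair h0 h2, hQ.pair h1 h2]
    simp only [hP.2]
    refine Prod.ext (by simp) ?_
    simp only [Prod.snd_add, Prod.smul_snd, Prod.snd_zero, map_add, map_smul, map_zero,
      LinearMap.zero_apply, LinearMap.add_apply, LinearMap.smul_apply, zero_add,
      hρ.apply_bracket hH h2.1 h0.2 h1.2, hρ.apply_bracket hH h1.1 h0.2 h2.2,
      hρ.apply_bracket hH h0.1 h1.2 h2.2]
    generalize d 0 = a, d 1 = b, d 2 = c
    simp only [sg_eq_ite, Int.even_add, Int.even_mul, Int.not_even_one]
    by_cases ha : Even a <;> by_cases hb : Even b <;> by_cases hc : Even c <;>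
      simp only [ha, hb, hc, or_true, or_false, or_self, iff_true, iff_false, iff_self,
        not_true, if_true, if_false] <;> module
  · rw [quadratic_insertion_sprod_of_ne hV hQ1 hQ.1 hP.1 hp hv,
      quadratic_insertion_sprod_of_ne hV hP1 hP.1 hQ.1 hp hv, add_zero]

end Semidirect

/-! ### The derived bracket and the differential evaluated on products. -/

section Evaluation

variable {k G H : Type*} [Field k] [AddCommGroup G] [Module k G] [AddCommGroup H] [Module k H]
  {𝒢 : ℤ → Submodule k G} {ℋ : ℤ → Submodule k H}
  {brG : G →ₗ[k] G →ₗ[k] G} {brH : H →ₗ[k] H →ₗ[k] H} {ρ : G →ₗ[k] H →ₗ[k] H} {lam : k}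

theorem embedCochain_sprod {n : ℤ} (f : Cochain ℋ 𝒢 n) (l : List (G × H)) :
    (embedCochain 𝒢 ℋ n f).1 (sprod _ l) = LinearMap.inl k G H (f.1 (sprod ℋ (l.map Prod.snd))) :=
  congrArg (fun s => LinearMap.inl k G H (f.1 s)) (symMap_sprod _ _ l)

theorem embedCochain_apply_snd {n : ℤ} (f : Cochain ℋ 𝒢 n) (s : SymAlg (prodDeg 𝒢 ℋ)) :
    ((embedCochain 𝒢 ℋ n f).1 s).2 = 0 := rfl

theorem snd_mem_of_mem_prodDeg (i : ℤ) (x : G × H) (hx : x ∈ prodDeg 𝒢 ℋ i) :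
    LinearMap.snd k G H x ∈ ℋ i := hx.2

/-- Embedded cochains factor through the projection to `H`, which kills any product having a factor
from `G`. -/
theorem embedCochain_sprod_cons {n : ℤ} (f : Cochain ℋ 𝒢 n) {u : G × H} (hu : u.2 = 0)
    (s : SymAlg (prodDeg 𝒢 ℋ)) : (embedCochain 𝒢 ℋ n f).1 (symι _ u * s) = 0 := by
  have h : symMap (𝒱 := prodDeg 𝒢 ℋ) (𝒲 := ℋ) (LinearMap.snd k G H) snd_mem_of_mem_prodDeg
      (symι _ u * s) = 0 := by
    rw [map_mul, symMap_symι, LinearMap.snd_apply, hu, map_zero, zero_mul]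
  change LinearMap.inl k G H (f.1 (symMap _ _ _)) = 0
  rw [h, map_zero, map_zero]

theorem sum_map_take_ofFn {p : ℕ} (σ : Fin p → Fin p) (d : Fin p → ℤ) (l : ℕ) :
    (((List.ofFn σ).take l).map d).sum = ∑ a : Fin p, if a.val < l then d (σ a) else 0 := by
  have h := sum_map_block (fun a => d (σ a)) (fun a : Fin p => decide (a.val < l)) true
  simp only [block, decide_eq_true_eq] at h
  rw [← h, List.ofFn_eq_map, ← List.map_take, ← filter_finRange_lt, List.map_map]
  simp [Function.comp_def]

variable (hV : DirectSum.IsInternal (prodDeg 𝒢 ℋ))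

/-- Embedded cochains compose to zero. -/
theorem embedCochain_comp_insertion {m n : ℤ} (f : Cochain ℋ 𝒢 m)
    {K : SymAlg (prodDeg 𝒢 ℋ) →ₗ[k] G × H}
    (hK : K ∈ homDeg (symDeg (prodDeg 𝒢 ℋ)) (prodDeg 𝒢 ℋ) n) (hK2 : ∀ s, (K s).2 = 0) :
    (embedCochain 𝒢 ℋ m f).1 ∘ₗ insertion hV K = 0 := by
  refine symAlg_hom_ext hV fun p d v hv => ?_
  rw [LinearMap.comp_apply, comp_insertion_sprod hV hK _ hv, LinearMap.zero_apply]
  refine Finset.sum_eq_zero fun c _ => ?_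
  rw [sprod_cons, embedCochain_sprod_cons f (hK2 _), smul_zero]

theorem embedCochain_comp_insertion_embedCochain {m n : ℤ} (f : Cochain ℋ 𝒢 m)
    (g : Cochain ℋ 𝒢 n) :
    (embedCochain 𝒢 ℋ m f).1 ∘ₗ insertion hV (embedCochain 𝒢 ℋ n g).1 = 0 :=
  embedCochain_comp_insertion hV f (embedCochain 𝒢 ℋ n g).2 (embedCochain_apply_snd g)

/-- The difference is `f` applied to the defect of `Q` and `g`. By symmetry it is up to sign `f`
applied to the defect of `g` and `Q`, where only `G`-valued cochains are inserted into `f`, so it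
vanishes. -/
theorem embedCochain_comp_insertion_insertion {l m n : ℤ} (f : Cochain ℋ 𝒢 m)
    (g : Cochain ℋ 𝒢 n) {Q : SymAlg (prodDeg 𝒢 ℋ) →ₗ[k] G × H}
    (hQ : Q ∈ homDeg (symDeg (prodDeg 𝒢 ℋ)) (prodDeg 𝒢 ℋ) l) (s : SymAlg (prodDeg 𝒢 ℋ)) :
    (embedCochain 𝒢 ℋ m f).1 (insertion hV Q (insertion hV (embedCochain 𝒢 ℋ n g).1 s)) =
      (embedCochain 𝒢 ℋ m f).1 (insertion hV (Q ∘ₗ insertion hV (embedCochain 𝒢 ℋ n g).1) s) := by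
  have hg := (embedCochain 𝒢 ℋ n g).2
  have h := congrArg (embedCochain 𝒢 ℋ m f).1
    (LinearMap.congr_fun (insertionDefect_symm hV hQ hg) s)
  have h1 := LinearMap.congr_fun (embedCochain_comp_insertion_embedCochain hV f g)
    (insertion hV Q s)
  have h2 := LinearMap.congr_fun (embedCochain_comp_insertion hV f (comp_insertion_mem hV hg hQ)
    fun s => embedCochain_apply_snd g _) s
  simp only [LinearMap.comp_apply, LinearMap.zero_apply] at h1 h2
  rw [LinearMap.smul_apply, map_smul, insertionDefect, insertionDefect, LinearMap.sub_apply,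
    LinearMap.sub_apply, map_sub, map_sub, LinearMap.comp_apply, LinearMap.comp_apply, h1, h2,
    sub_zero, smul_zero, sub_eq_zero] at h
  exact h

/-- Because `Q` is quadratic, color `1` is used once. Its other argument is a value of `g` in `G`,
and `f` reads only the `H`-component of the result, so just `ρ(g(…))v` survives. -/
theorem embedCochain_insertion_semidirect {m n : ℤ} (f : Cochain ℋ 𝒢 m) (g : Cochain ℋ 𝒢 n)
    {Q : SymAlg (prodDeg 𝒢 ℋ) →ₗ[k] G × H} (hQ : IsSemidirectElement 𝒢 ℋ brG ρ Q)
    (hQ1 : Q ∈ homDeg (symDeg (prodDeg 𝒢 ℋ)) (prodDeg 𝒢 ℋ) 1)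
    {p : ℕ} {d : Fin p → ℤ} {w : Fin p → G × H} (hw : ∀ a, w a ∈ prodDeg 𝒢 ℋ (d a)) :
    (embedCochain 𝒢 ℋ m f).1 (insertion hV Q (insertion hV (embedCochain 𝒢 ℋ n g).1
        (sprod _ (List.ofFn w)))) =
      LinearMap.inl k G H (∑ l : Fin p, ∑ σ ∈ shufflesMid p l,
        koszul d σ • f.1 (sprod ℋ (ρ (g.1 (sprod ℋ ((List.ofFn ((Prod.snd ∘ w) ∘ σ)).take l)))
          ((Prod.snd ∘ w) (σ l)) :: (List.ofFn ((Prod.snd ∘ w) ∘ σ)).drop (l + 1)))) := by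
  have hg := (embedCochain 𝒢 ℋ n g).2
  rw [embedCochain_comp_insertion_insertion hV f g hQ1,
    comp_insertion_insertion_sprod hV hQ1 hg _ hw]
  simp only [← koszul_eq_colorSign]
  rw [← sum_shufflesMid fun σ A B C => koszul d σ • (embedCochain 𝒢 ℋ m f).1 (sprod _ (Q (sprod _ (
    (embedCochain 𝒢 ℋ n g).1 (sprod _ (A.map w)) :: B.map w)) :: C.map w)), map_sum]
  · refine Finset.sum_congr rfl fun l _ => ?_
    rw [map_sum]
    refine Finset.sum_congr rfl fun σ _ => ?_
    rw [LinearMap.map_smul_of_tower]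
    congr 1
    have hu := hg _ _ (sprod_map_mem hw ((List.ofFn σ).take l))
    rw [List.map_singleton, hQ.pair hu (hw (σ l)), embedCochain_sprod, embedCochain_sprod]
    simp only [LinearMap.inl_apply, List.map_cons, map_zero, smul_zero, add_zero, List.map_take,
      List.map_drop, List.map_ofFn, Function.comp_def]
  · intro σ A B C hB
    rw [hQ.1 _ (by simpa using hB), sprod_cons, map_zero, zero_mul, map_zero, smul_zero]

theorem semidirect_insertion_insertion {m n : ℤ} (f : Cochain ℋ 𝒢 m) (g : Cochain ℋ 𝒢 n)
    {Q : SymAlg (prodDeg 𝒢 ℋ) →ₗ[k] G × H} (hQ : IsSemidirectElement 𝒢 ℋ brG ρ Q)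
    {p : ℕ} {d : Fin p → ℤ} {w : Fin p → G × H} (hw : ∀ a, w a ∈ prodDeg 𝒢 ℋ (d a)) :
    Q (insertion hV (embedCochain 𝒢 ℋ m f).1 (insertion hV (embedCochain 𝒢 ℋ n g).1
        (sprod _ (List.ofFn w)))) =
      LinearMap.inl k G H (∑ l ∈ Finset.range (p + 1), ∑ σ ∈ shuffles p l,
        (n * (∑ a : Fin p, if a.val < l then d (σ a) else 0)).negOnePow • koszul d σ •
          brG (f.1 (sprod ℋ ((List.ofFn ((Prod.snd ∘ w) ∘ σ)).take l)))
            (g.1 (sprod ℋ ((List.ofFn ((Prod.snd ∘ w) ∘ σ)).drop l)))) := by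
  have hf := (embedCochain 𝒢 ℋ m f).2
  have hg := (embedCochain 𝒢 ℋ n g).2
  have hsymm := LinearMap.congr_fun (insertionDefect_symm hV hf hg) (sprod _ (List.ofFn w))
  rw [LinearMap.smul_apply, insertionDefect, insertionDefect,
    embedCochain_comp_insertion_embedCochain, embedCochain_comp_insertion_embedCochain, map_zero,
    LinearMap.sub_apply, LinearMap.sub_apply, LinearMap.zero_apply, sub_zero, sub_zero,
    LinearMap.comp_apply, LinearMap.comp_apply] at hsymm
  -- The two insertions graded commute because both defect corrections vanish. Exchanging them puts
  -- `f` on the first block of the shuffle, as in the target formula.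
  rw [hsymm, map_smul, ← LinearMap.comp_apply Q, comp_insertion_sprod hV hf _ hw]
  simp only [← koszul_eq_colorSign]
  rw [← sum_shuffles fun σ A B => koszul d σ • (Q ∘ₗ insertion hV (embedCochain 𝒢 ℋ n g).1)
    (sprod _ ((embedCochain 𝒢 ℋ m f).1 (sprod _ (A.map w)) :: B.map w)), map_sum, Finset.smul_sum]
  refine Finset.sum_congr rfl fun l _ => ?_
  rw [map_sum, Finset.smul_sum]
  refine Finset.sum_congr rfl fun σ _ => ?_
  have hu := hf _ _ (sprod_map_mem hw ((List.ofFn σ).take l))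
  have hu' := hg _ _ (sprod_map_mem hw ((List.ofFn σ).drop l))
  set u := (embedCochain 𝒢 ℋ m f).1 (sprod _ (((List.ofFn σ).take l).map w)) with hudef
  -- The value `u` lies in `G`, so it cannot be an argument of `g`. With `u` in one slot of `Q`,
  -- only one slot is left, and `g` must take the whole remaining block.
  have hgu : (embedCochain 𝒢 ℋ n g).1 ∘ₗ lmul _ u = 0 := LinearMap.ext fun s =>
    embedCochain_sprod_cons g (embedCochain_apply_snd f _) s
  have hlin : ∀ s, Q (symι _ u * insertion hV (embedCochain 𝒢 ℋ n g).1 s) =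
      Q (symι _ u * symι _ ((embedCochain 𝒢 ℋ n g).1 s)) := fun s =>
    linear_insertion hV hg (q := Q ∘ₗ lmul _ u) (fun l hl => by
      rw [LinearMap.comp_apply, lmul_apply, ← sprod_cons, hQ.1 _ (by simpa using hl)]) s
  have hpair := hQ.pair hu hu'
  rw [sprod_cons, sprod_cons, sprod_nil, mul_one] at hpair
  rw [sprod_cons, LinearMap.comp_apply, insertion_symι_mul hV hu hg, hgu, map_zero,
    LinearMap.zero_apply, zero_add, map_smul, hlin, hpair, hudef, embedCochain_sprod,
    embedCochain_sprod, LinearMap.map_smul_of_tower, LinearMap.map_smul_of_tower,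
    negOnePow_smul (k := k), smul_comm (koszul d σ) (sg k (_ * n)), smul_smul, ← sg_add,
    ← sum_map_take_ofFn, sg_eq_sg (n := n * (((List.ofFn σ).take l).map d).sum)
      (by simp only [Int.even_add, Int.even_mul]; tauto)]
  simp only [LinearMap.inl_apply, map_zero, smul_zero, add_zero,
    List.map_take, List.map_drop, List.map_ofFn, Function.comp_def]

theorem embedCochain_insertion_weight {n : ℤ} (g : Cochain ℋ 𝒢 n)
    {P : SymAlg (prodDeg 𝒢 ℋ) →ₗ[k] G × H} (hP : IsWeightElement 𝒢 ℋ brH lam P)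
    (hP1 : P ∈ homDeg (symDeg (prodDeg 𝒢 ℋ)) (prodDeg 𝒢 ℋ) 1)
    {p : ℕ} {d : Fin p → ℤ} {w : Fin p → G × H} (hw : ∀ a, w a ∈ prodDeg 𝒢 ℋ (d a)) :
    (embedCochain 𝒢 ℋ n g).1 (insertion hV P (sprod _ (List.ofFn w))) =
      LinearMap.inl k G H (∑ i : Fin p, ∑ j ∈ Finset.Ioi i,
        (d i * (∑ a ∈ Finset.Iio i, d a) + d j * (∑ a ∈ Finset.Iio j, d a)
          + d i * d j).negOnePow •
        g.1 (sprod ℋ (lam • brH ((Prod.snd ∘ w) i) ((Prod.snd ∘ w) j) ::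
          ((List.finRange p).filter (fun a => a ≠ i ∧ a ≠ j)).map (Prod.snd ∘ w)))) := by
  rw [comp_insertion_sprod hV hP1 _ hw, sum_pairs d fun A B => (embedCochain 𝒢 ℋ n g).1
    (sprod _ (P (sprod _ (A.map w)) :: B.map w)), map_sum]
  · refine Finset.sum_congr rfl fun i _ => ?_
    rw [map_sum]
    refine Finset.sum_congr rfl fun j _ => ?_
    rw [LinearMap.map_smul_of_tower, embedCochain_sprod, List.map_cons, List.map_cons,
      List.map_cons, List.map_nil, hP.2, List.map_map]
    rfl
  · intro A B hA
    rw [hP.1 _ (by simpa using hA), sprod_cons, map_zero, zero_mul, map_zero]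

/-- The map `P` depends only on `H`-components, while `g` has values in `G`. Hence `[P, g]` reduces
to the single composite `± g ∘ I_P`. -/
theorem weight_insertion_embedCochain {n : ℤ} (g : Cochain ℋ 𝒢 n)
    {P : SymAlg (prodDeg 𝒢 ℋ) →ₗ[k] G × H} (hP : IsWeightElement 𝒢 ℋ brH lam P) :
    P ∘ₗ insertion hV (embedCochain 𝒢 ℋ n g).1 = 0 := by
  refine symAlg_hom_ext hV fun p d v hv => ?_
  rw [LinearMap.comp_apply, comp_insertion_sprod hV (embedCochain 𝒢 ℋ n g).2 P hv,
    LinearMap.zero_apply]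
  refine Finset.sum_eq_zero fun c _ => ?_
  generalize (block c 1).map v = l
  by_cases hl : l.length = 1
  · obtain ⟨x, rfl⟩ := List.length_eq_one_iff.1 hl
    rw [hP.2, embedCochain_apply_snd, map_zero, LinearMap.zero_apply, smul_zero, Prod.mk_zero_zero,
      smul_zero]
  · rw [hP.1 _ (by simpa using hl), smul_zero]

/-- The value of the derived bracket is given by the formula for the deformation bracket. -/
theorem derivedBracket_sprod {m n : ℤ} (f : Cochain ℋ 𝒢 m) (g : Cochain ℋ 𝒢 n)
    {Q : SymAlg (prodDeg 𝒢 ℋ) →ₗ[k] G × H} (hQ : IsSemidirectElement 𝒢 ℋ brG ρ Q)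
    (hQ1 : Q ∈ homDeg (symDeg (prodDeg 𝒢 ℋ)) (prodDeg 𝒢 ℋ) 1)
    {p : ℕ} {d : Fin p → ℤ} {w : Fin p → G × H} (hw : ∀ a, w a ∈ prodDeg 𝒢 ℋ (d a)) :
    sg k m • nrBracket hV (1 + m) n (nrBracket hV 1 m Q (embedCochain 𝒢 ℋ m f).1)
        (embedCochain 𝒢 ℋ n g).1 (sprod _ (List.ofFn w)) =
      LinearMap.inl k G H (bracketValue ℋ brG ρ m n f.1 g.1 d (Prod.snd ∘ w)) := by
  have hf := (embedCochain 𝒢 ℋ m f).2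
  have hgf := LinearMap.congr_fun (embedCochain_comp_insertion_embedCochain hV g f)
    (insertion hV Q (sprod _ (List.ofFn w)))
  rw [LinearMap.comp_apply, LinearMap.zero_apply] at hgf
  -- Expanding `[[Q, f], g]` gives four composites. The one with `g ∘ I_f ∘ I_Q` vanishes by `hgf`,
  -- and the other three are the three sums in `bracketValue`.
  rw [nrBracket, insertion_nrBracket hV hQ1 hf, nrBracket]
  simp only [LinearMap.sub_apply, LinearMap.smul_apply, LinearMap.comp_apply, map_sub, map_smul,
    hgf, smul_zero, sub_zero, embedCochain_insertion_semidirect hV _ _ hQ hQ1 hw,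
    semidirect_insertion_insertion hV _ _ hQ hw]
  simp only [← map_smul, ← map_sub, bracketValue]
  congr 1
  have h3 : sg k (m + 1) = -sg k m := by
    have h : sg k 1 = -1 := by simp [sg]
    rw [sg_add, h]; ring
  have h4 : sg k ((m + 1) * (n + 1)) = -(sg k m * sg k ((1 + m) * n)) := by
    rw [← neg_mul, ← h3, ← sg_add]; congr 1; ring
  simp only [negOnePow_smul (k := k), add_assoc _ m 1, sg_add (n * _), h3, h4]
  simp only [mul_comm (sg k (n * _)), mul_smul, ← Finset.smul_sum, one_mul]
  rcases sg_eq_or (k := k) m with h | h <;> simp only [h] <;> module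

theorem nrBracket_weight_sprod {n : ℤ} (g : Cochain ℋ 𝒢 n)
    {P : SymAlg (prodDeg 𝒢 ℋ) →ₗ[k] G × H} (hP : IsWeightElement 𝒢 ℋ brH lam P)
    (hP1 : P ∈ homDeg (symDeg (prodDeg 𝒢 ℋ)) (prodDeg 𝒢 ℋ) 1)
    {p : ℕ} {d : Fin p → ℤ} {w : Fin p → G × H} (hw : ∀ a, w a ∈ prodDeg 𝒢 ℋ (d a)) :
    nrBracket hV 1 n P (embedCochain 𝒢 ℋ n g).1 (sprod _ (List.ofFn w)) =
      LinearMap.inl k G H (diffValue ℋ brH lam n g.1 d (Prod.snd ∘ w)) := by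
  rw [nrBracket, weight_insertion_embedCochain hV g hP, zero_sub, LinearMap.neg_apply,
    LinearMap.smul_apply, LinearMap.comp_apply, embedCochain_insertion_weight hV g hP hP1 hw,
    ← map_smul, ← map_neg, one_mul, diffValue, ← neg_smul]
  congr 1
  have h1 : -sg k n = sg k (n + 1) := by
    have h : sg k 1 = -1 := by simp [sg]
    rw [sg_add, h]; ring
  simp only [h1, Finset.smul_sum, negOnePow_smul (k := k), smul_smul, ← sg_add]
  simp only [← add_assoc]

end Evaluation

/-! ### Embedding `C*(H, G)` and restricting back to it. -/

section Restriction

variable {k G H : Type*} [Field k] [AddCommGroup G] [Module k G] [AddCommGroup H] [Module k H]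
  {𝒢 : ℤ → Submodule k G} {ℋ : ℤ → Submodule k H}

theorem CStar.of_congr {V W : Type*} [AddCommGroup V] [Module k V] [AddCommGroup W] [Module k W]
    {𝒱 : ℤ → Submodule k V} {𝒲 : ℤ → Submodule k W} {m n : ℤ} (h : m = n) (f : Cochain 𝒱 𝒲 m) :
    ∃ g : Cochain 𝒱 𝒲 n, CStar.of 𝒱 𝒲 m f = CStar.of 𝒱 𝒲 n g ∧ g.1 = f.1 := by
  subst h
  exact ⟨f, rfl, rfl⟩

theorem embed_of (n : ℤ) (f : Cochain ℋ 𝒢 n) :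
    embed 𝒢 ℋ (CStar.of ℋ 𝒢 n f) = CStar.of _ _ n (embedCochain 𝒢 ℋ n f) := by
  rw [embed, CStar.of, DirectSum.toModule_lof, LinearMap.comp_apply]

theorem inr_mem_prodDeg (i : ℤ) (v : H) (hv : v ∈ ℋ i) :
    LinearMap.inr k G H v ∈ prodDeg 𝒢 ℋ i :=
  ⟨zero_mem _, hv⟩

/-- The restriction of a cochain on `G ⊕ H` to `H`, followed by the projection to `G`. -/
def restrictCochain (n : ℤ) :
    Cochain (prodDeg 𝒢 ℋ) (prodDeg 𝒢 ℋ) n →ₗ[k] Cochain ℋ 𝒢 n where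
  toFun F := ⟨LinearMap.fst k G H ∘ₗ F.1 ∘ₗ
      (symMap (𝒱 := ℋ) (𝒲 := prodDeg 𝒢 ℋ) (LinearMap.inr k G H) inr_mem_prodDeg).toLinearMap,
    fun i s hs => (F.2 i _ (symMap_mem_symDeg _ _ i s hs)).1⟩
  map_add' F F' := by ext; simp
  map_smul' c F := by ext; simp

theorem restrictCochain_sprod {n : ℤ} (F : Cochain (prodDeg 𝒢 ℋ) (prodDeg 𝒢 ℋ) n) (l : List H) :
    (restrictCochain n F).1 (sprod ℋ l) = (F.1 (sprod _ (l.map (LinearMap.inr k G H)))).1 :=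
  congrArg (fun s => (F.1 s).1) (symMap_sprod _ _ l)

/-- The restriction `C*(G ⊕ H, G ⊕ H) → C*(H, G)`. -/
noncomputable def restrict : CStar (prodDeg 𝒢 ℋ) (prodDeg 𝒢 ℋ) →ₗ[k] CStar ℋ 𝒢 :=
  DirectSum.toModule k ℤ _ fun n => CStar.of _ _ n ∘ₗ restrictCochain n

theorem restrict_of (n : ℤ) (F : Cochain (prodDeg 𝒢 ℋ) (prodDeg 𝒢 ℋ) n) :
    restrict (CStar.of _ _ n F) = CStar.of ℋ 𝒢 n (restrictCochain n F) := by
  rw [restrict, CStar.of, DirectSum.toModule_lof, LinearMap.comp_apply]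

/-- Restriction is a left inverse, since `H → G ⊕ H → H` is the identity. -/
theorem embed_injective (hH : DirectSum.IsInternal ℋ) : Function.Injective (embed 𝒢 ℋ) := by
  have h : restrict ∘ₗ embed 𝒢 ℋ = LinearMap.id := by
    refine CStar.hom_ext fun n f => ?_
    rw [LinearMap.comp_apply, embed_of, restrict_of, LinearMap.id_apply]
    refine congrArg _ (Subtype.ext (symAlg_hom_ext hH fun p d v hv => ?_))
    rw [restrictCochain_sprod, embedCochain_sprod, List.map_map]
    simp [Function.comp_def]
  exact Function.LeftInverse.injective (g := restrict) (LinearMap.congr_fun h)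

theorem embed_mem (n : ℤ) (f : CStar ℋ 𝒢) (hf : f ∈ CStar.deg ℋ 𝒢 n) :
    embed 𝒢 ℋ f ∈ CStar.deg (prodDeg 𝒢 ℋ) (prodDeg 𝒢 ℋ) n := by
  obtain ⟨f, rfl⟩ := hf
  rw [embed_of]
  exact CStar.of_mem _ _

end Restriction

/-! ### The differential graded Lie algebra `sC*(H, G)`. -/

section Deformation

variable {k G H : Type*} [Field k] [AddCommGroup G] [Module k G] [AddCommGroup H] [Module k H]
  {𝒢 : ℤ → Submodule k G} {ℋ : ℤ → Submodule k H}
  {brG : G →ₗ[k] G →ₗ[k] G} {brH : H →ₗ[k] H →ₗ[k] H} {ρ : G →ₗ[k] H →ₗ[k] H} {lam : k}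
  (hV : DirectSum.IsInternal (prodDeg 𝒢 ℋ))

theorem nr_embed_embed (f g : CStar ℋ 𝒢) : nr hV (embed 𝒢 ℋ f) (embed 𝒢 ℋ g) = 0 := by
  induction f using CStar.induction with
  | add f f' hf hf' => rw [map_add, map_add, LinearMap.add_apply, hf, hf', add_zero]
  | of m f =>
    induction g using CStar.induction with
    | add g g' hg hg' => rw [map_add, map_add, hg, hg', add_zero]
    | of n g =>
      have h : nrHomog hV m n (embedCochain 𝒢 ℋ m f) (embedCochain 𝒢 ℋ n g) = 0 :=
        Subtype.ext <| by
          rw [nrHomog_coe, nrBracket, embedCochain_comp_insertion_embedCochain,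
            embedCochain_comp_insertion_embedCochain, smul_zero, sub_zero, Submodule.coe_zero]
      rw [embed_of, embed_of, nr_of, h, map_zero]

theorem IsDeformationBracket.embed_of {br : CStar ℋ 𝒢 →ₗ[k] CStar ℋ 𝒢 →ₗ[k] CStar ℋ 𝒢}
    (hbr : IsDeformationBracket 𝒢 ℋ brG ρ br) {Q : Cochain (prodDeg 𝒢 ℋ) (prodDeg 𝒢 ℋ) 1}
    (hQ : IsSemidirectElement 𝒢 ℋ brG ρ Q.1) (m n : ℤ) (f : Cochain ℋ 𝒢 m) (g : Cochain ℋ 𝒢 n) :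
    embed 𝒢 ℋ (br (CStar.of ℋ 𝒢 m f) (CStar.of ℋ 𝒢 n g)) =
      sg k m • nr hV (nr hV (CStar.of _ _ 1 Q) (embed 𝒢 ℋ (CStar.of ℋ 𝒢 m f)))
        (embed 𝒢 ℋ (CStar.of ℋ 𝒢 n g)) := by
  obtain ⟨h, hh, hval⟩ := hbr m n f g
  rw [hh, HomotopyO.embed_of, HomotopyO.embed_of, HomotopyO.embed_of, nr_of, nr_of, ← map_smul]
  obtain ⟨h', hh', hval'⟩ := CStar.of_congr (show m + n + 1 = 1 + m + n by ring)
    (embedCochain 𝒢 ℋ _ h)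
  rw [hh']
  refine congrArg _ (Subtype.ext (symAlg_hom_ext hV fun p d w hw => ?_))
  rw [hval', embedCochain_sprod, List.map_ofFn, hval p d (Prod.snd ∘ w) fun a => (hw a).2,
    Submodule.coe_smul, LinearMap.smul_apply, nrHomog_coe, nrHomog_coe,
    derivedBracket_sprod hV f g hQ Q.2 hw]

theorem IsDeformationBracket.embed_apply {br : CStar ℋ 𝒢 →ₗ[k] CStar ℋ 𝒢 →ₗ[k] CStar ℋ 𝒢}
    (hbr : IsDeformationBracket 𝒢 ℋ brG ρ br) {Q : Cochain (prodDeg 𝒢 ℋ) (prodDeg 𝒢 ℋ) 1}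
    (hQ : IsSemidirectElement 𝒢 ℋ brG ρ Q.1) (m : ℤ) (f : CStar ℋ 𝒢) (hf : f ∈ CStar.deg ℋ 𝒢 m)
    (g : CStar ℋ 𝒢) :
    embed 𝒢 ℋ (br f g) = m.negOnePow •
      nr hV (nr hV (CStar.of _ _ 1 Q) (embed 𝒢 ℋ f)) (embed 𝒢 ℋ g) := by
  obtain ⟨f, rfl⟩ := hf
  rw [negOnePow_smul (k := k)]
  induction g using CStar.induction with
  | add g g' hg hg' => rw [map_add, map_add, map_add, map_add, hg, hg', smul_add]
  | of n g => exact hbr.embed_of hV hQ m n f g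

theorem IsDeformationBracket.bracket_mem {br : CStar ℋ 𝒢 →ₗ[k] CStar ℋ 𝒢 →ₗ[k] CStar ℋ 𝒢}
    (hbr : IsDeformationBracket 𝒢 ℋ brG ρ br) (m n : ℤ) (f : CStar ℋ 𝒢)
    (hf : f ∈ CStar.deg ℋ 𝒢 m) (g : CStar ℋ 𝒢) (hg : g ∈ CStar.deg ℋ 𝒢 n) :
    br f g ∈ CStar.deg ℋ 𝒢 (m + n + 1) := by
  obtain ⟨f, rfl⟩ := hf
  obtain ⟨g, rfl⟩ := hg
  obtain ⟨h, hh, -⟩ := hbr m n f g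
  rw [hh]
  exact CStar.of_mem _ _

theorem IsDeformationDifferential.embed_apply {D : CStar ℋ 𝒢 →ₗ[k] CStar ℋ 𝒢}
    (hD : IsDeformationDifferential 𝒢 ℋ brH lam D)
    {P : Cochain (prodDeg 𝒢 ℋ) (prodDeg 𝒢 ℋ) 1} (hP : IsWeightElement 𝒢 ℋ brH lam P.1)
    (f : CStar ℋ 𝒢) : embed 𝒢 ℋ (D f) = nr hV (CStar.of _ _ 1 P) (embed 𝒢 ℋ f) := by
  induction f using CStar.induction with
  | add f f' hf hf' => rw [map_add, map_add, map_add, map_add, hf, hf']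
  | of n f =>
    obtain ⟨h, hh, hval⟩ := hD n f
    rw [hh, embed_of, embed_of, nr_of]
    obtain ⟨h', hh', hval'⟩ := CStar.of_congr (add_comm n 1) (embedCochain 𝒢 ℋ _ h)
    rw [hh']
    refine congrArg _ (Subtype.ext (symAlg_hom_ext hV fun p d w hw => ?_))
    rw [hval', embedCochain_sprod, List.map_ofFn, hval p d (Prod.snd ∘ w) fun a => (hw a).2, nrHomog_coe,
      nrBracket_weight_sprod hV f hP P.2 hw]

theorem IsDeformationDifferential.apply_mem {D : CStar ℋ 𝒢 →ₗ[k] CStar ℋ 𝒢}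
    (hD : IsDeformationDifferential 𝒢 ℋ brH lam D) (n : ℤ) (f : CStar ℋ 𝒢)
    (hf : f ∈ CStar.deg ℋ 𝒢 n) : D f ∈ CStar.deg ℋ 𝒢 (n + 1) := by
  obtain ⟨f, rfl⟩ := hf
  obtain ⟨h, hh, -⟩ := hD n f
  rw [hh]
  exact CStar.of_mem _ _

/-- Existence comes from restricting the derived bracket to `H`. For uniqueness, the embedded value
of any such bracket is the derived bracket, and `embed` is injective. -/
theorem existsUnique_deformationBracket (hV : DirectSum.IsInternal (prodDeg 𝒢 ℋ))
    (hH : DirectSum.IsInternal ℋ)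
    {Q : Cochain (prodDeg 𝒢 ℋ) (prodDeg 𝒢 ℋ) 1} (hQ : IsSemidirectElement 𝒢 ℋ brG ρ Q.1) :
    ∃! br, IsDeformationBracket 𝒢 ℋ brG ρ br := by
  refine existsUnique_of_exists_of_unique ⟨CStar.lift₂ fun m n => sg k m •
    ((nrHomog hV (1 + m) n ∘ₗ nrHomog hV 1 m Q ∘ₗ embedCochain 𝒢 ℋ m).compl₂
      (embedCochain 𝒢 ℋ n)).compr₂ (CStar.of _ _ _ ∘ₗ restrictCochain _), ?_⟩ ?_
  · intro m n f g
    obtain ⟨h, hh, hval⟩ := CStar.of_congr (show 1 + m + n = m + n + 1 by ring)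
      (sg k m • restrictCochain _ (nrHomog hV _ _ (nrHomog hV _ _ Q (embedCochain 𝒢 ℋ m f))
        (embedCochain 𝒢 ℋ n g)))
    refine ⟨h, ?_, fun p d v hv => ?_⟩
    · rw [← hh, CStar.lift₂_of, map_smul]
      rfl
    · have hw := derivedBracket_sprod hV f g hQ Q.2 (w := fun a => LinearMap.inr k G H (v a))
        fun a => inr_mem_prodDeg (d a) (v a) (hv a)
      rw [hval, Submodule.coe_smul, LinearMap.smul_apply, restrictCochain_sprod, List.map_ofFn,
        nrHomog_coe, nrHomog_coe]
      exact congrArg Prod.fst hw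
  · intro br br' hbr hbr'
    refine CStar.hom_ext₂ fun m n f g => embed_injective hH ?_
    rw [hbr.embed_of hV hQ, hbr'.embed_of hV hQ]

theorem existsUnique_deformationDifferential (hV : DirectSum.IsInternal (prodDeg 𝒢 ℋ))
    (hH : DirectSum.IsInternal ℋ)
    {P : Cochain (prodDeg 𝒢 ℋ) (prodDeg 𝒢 ℋ) 1} (hP : IsWeightElement 𝒢 ℋ brH lam P.1) :
    ∃! D, IsDeformationDifferential 𝒢 ℋ brH lam D := by
  refine existsUnique_of_exists_of_unique
    ⟨restrict ∘ₗ nr hV (CStar.of _ _ 1 P) ∘ₗ embed 𝒢 ℋ, ?_⟩ ?_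
  · intro n g
    obtain ⟨h, hh, hval⟩ := CStar.of_congr (add_comm 1 n)
      (restrictCochain _ (nrHomog hV _ _ P (embedCochain 𝒢 ℋ n g)))
    refine ⟨h, ?_, fun p d v hv => ?_⟩
    · rw [← hh, LinearMap.comp_apply, LinearMap.comp_apply, embed_of, nr_of, restrict_of]
    · have hw := nrBracket_weight_sprod hV g hP P.2 (w := fun a => LinearMap.inr k G H (v a))
        fun a => inr_mem_prodDeg (d a) (v a) (hv a)
      rw [hval, restrictCochain_sprod, List.map_ofFn, nrHomog_coe]
      exact congrArg Prod.fst hw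
  · intro D D' hD hD'
    refine LinearMap.ext fun f => embed_injective hH ?_
    rw [hD.embed_apply hV hP, hD'.embed_apply hV hP]

/-- In degrees `(1, 1)` the sign is `-1`, so the bracket is the symmetrized composition. -/
theorem nr_of_eq_zero {V : Type*} [AddCommGroup V] [Module k V] {𝒱 : ℤ → Submodule k V}
    (hV : DirectSum.IsInternal 𝒱) {P Q : Cochain 𝒱 𝒱 1}
    (h : P.1 ∘ₗ insertion hV Q.1 + Q.1 ∘ₗ insertion hV P.1 = 0) :
    nr hV (CStar.of 𝒱 𝒱 1 P) (CStar.of 𝒱 𝒱 1 Q) = 0 := by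
  have h1 : sg k (1 * 1) = -1 := by simp [sg]
  have h0 : nrHomog hV 1 1 P Q = 0 := Subtype.ext <| by
    rw [nrHomog_coe, nrBracket, h1, neg_smul, one_smul, sub_neg_eq_add, h, Submodule.coe_zero]
  rw [nr_of, h0, map_zero]

theorem nr_semidirect_semidirect (hG : IsSymGradedLieAlgebra 𝒢 brG)
    (hρ : IsAction 𝒢 ℋ brG brH ρ) {Q : Cochain (prodDeg 𝒢 ℋ) (prodDeg 𝒢 ℋ) 1}
    (hQ : IsSemidirectElement 𝒢 ℋ brG ρ Q.1) :
    nr hV (CStar.of _ _ 1 Q) (CStar.of _ _ 1 Q) = 0 :=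
  nr_of_eq_zero hV <| by
    rw [semidirect_insertion_semidirect hG hρ hV Q.2 hQ, add_zero]

theorem nr_weight_weight (hH : IsSymGradedLieAlgebra ℋ brH)
    {P : Cochain (prodDeg 𝒢 ℋ) (prodDeg 𝒢 ℋ) 1} (hP : IsWeightElement 𝒢 ℋ brH lam P.1) :
    nr hV (CStar.of _ _ 1 P) (CStar.of _ _ 1 P) = 0 :=
  nr_of_eq_zero hV <| by
    rw [weight_insertion_weight hH hV P.2 hP, add_zero]

theorem isDGLieAlgebra_deformation [CharZero k] (hG : IsSymGradedLieAlgebra 𝒢 brG)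
    (hH : IsSymGradedLieAlgebra ℋ brH) (hρ : IsAction 𝒢 ℋ brG brH ρ)
    {br : CStar ℋ 𝒢 →ₗ[k] CStar ℋ 𝒢 →ₗ[k] CStar ℋ 𝒢} (hbr : IsDeformationBracket 𝒢 ℋ brG ρ br)
    {D : CStar ℋ 𝒢 →ₗ[k] CStar ℋ 𝒢} (hD : IsDeformationDifferential 𝒢 ℋ brH lam D)
    {Q P : Cochain (prodDeg 𝒢 ℋ) (prodDeg 𝒢 ℋ) 1} (hQ : IsSemidirectElement 𝒢 ℋ brG ρ Q.1)
    (hP : IsWeightElement 𝒢 ℋ brH lam P.1) :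
    IsDGLieAlgebra (L := CStar ℋ 𝒢) (suspDeg (CStar.deg ℋ 𝒢)) br D := by
  have hV := isInternal_prodDeg hG.isInternal hH.isInternal
  have hPQ : nr hV (CStar.of _ _ 1 P) (CStar.of _ _ 1 Q) = 0 :=
    nr_of_eq_zero hV (weight_insertion_semidirect_add hH hρ hV Q.2 hQ P.2 hP)
  refine isDGLieAlgebra_of_derivedBracket (k := k) (A := CStar ℋ 𝒢)
    (L := CStar (prodDeg 𝒢 ℋ) (prodDeg 𝒢 ℋ)) (𝓛 := CStar.deg _ _) (NR := nr hV)
    (𝒜 := CStar.deg ℋ 𝒢) (e := embed 𝒢 ℋ) (Q := CStar.of _ _ 1 Q) (P := CStar.of _ _ 1 P)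
    ?_ ?_ ?_ ?_ ?_ ?_ ?_ ?_ ?_ ?_ ?_ ?_ ?_ ?_
  · exact isGradedLieAlgebra_nr hV
  · exact CStar.isInternal_deg
  · exact embed_injective hH.isInternal
  · exact embed_mem
  · exact nr_embed_embed hV
  · exact CStar.of_mem 1 Q
  · exact CStar.of_mem 1 P
  · exact nr_semidirect_semidirect hV hG hρ hQ
  · exact nr_weight_weight hV hH hP
  · exact hPQ
  · exact hbr.bracket_mem
  · exact hD.apply_mem
  · exact hbr.embed_apply hV hQ
  · exact hD.embed_apply hV hP

end Deformation

end HomotopyO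

open HomotopyO

theorem mainTheorem1 {k G H : Type*} [Field k] [CharZero k]
    [AddCommGroup G] [Module k G] [AddCommGroup H] [Module k H]
    (𝒢 : ℤ → Submodule k G) (ℋ : ℤ → Submodule k H)
    (brG : G →ₗ[k] G →ₗ[k] G) (brH : H →ₗ[k] H →ₗ[k] H) (ρ : G →ₗ[k] H →ₗ[k] H) (lam : k)
    (hG : IsSymGradedLieAlgebra 𝒢 brG) (hH : IsSymGradedLieAlgebra ℋ brH)
    (hρ : IsAction 𝒢 ℋ brG brH ρ) :
    -- the explicit formulas define a unique bracket and a unique differential on `C*(H, G)`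
    (∃! br, IsDeformationBracket 𝒢 ℋ brG ρ br) ∧
    (∃! D, IsDeformationDifferential 𝒢 ℋ brH lam D) ∧
    -- likewise the Nijenhuis–Richardson bracket on `C*(G ⊕ H, G ⊕ H)` and its degree one elements
    -- `μ_G + ρ` and `λ μ_H`
    (∃! NR, IsNRBracket (prodDeg 𝒢 ℋ) NR) ∧
    (∃! Q : Cochain (prodDeg 𝒢 ℋ) (prodDeg 𝒢 ℋ) 1, IsSemidirectElement 𝒢 ℋ brG ρ Q.1) ∧
    (∃! P : Cochain (prodDeg 𝒢 ℋ) (prodDeg 𝒢 ℋ) 1, IsWeightElement 𝒢 ℋ brH lam P.1) ∧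
    ∀ br D NR, ∀ Q P : Cochain (prodDeg 𝒢 ℋ) (prodDeg 𝒢 ℋ) 1,
      IsDeformationBracket 𝒢 ℋ brG ρ br → IsDeformationDifferential 𝒢 ℋ brH lam D →
      IsNRBracket (prodDeg 𝒢 ℋ) NR → IsSemidirectElement 𝒢 ℋ brG ρ Q.1 →
      IsWeightElement 𝒢 ℋ brH lam P.1 →
      -- `sC*(H, G)` is a differential graded Lie algebra
      IsDGLieAlgebra (L := CStar ℋ 𝒢) (suspDeg (CStar.deg ℋ 𝒢)) br D ∧
      -- the Nijenhuis–Richardson algebra is a graded Lie algebra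
      IsGradedLieAlgebra (L := CStar (prodDeg 𝒢 ℋ) (prodDeg 𝒢 ℋ))
        (CStar.deg (prodDeg 𝒢 ℋ) (prodDeg 𝒢 ℋ)) NR ∧
      -- the bracket is the derived bracket `⟦f, g⟧ = (-1)^m [[μ_G + ρ, f], g]`
      (∀ m, ∀ f ∈ CStar.deg ℋ 𝒢 m, ∀ g : CStar ℋ 𝒢,
        embed 𝒢 ℋ (br f g) =
          m.negOnePow • NR (NR (CStar.of _ _ 1 Q) (embed 𝒢 ℋ f)) (embed 𝒢 ℋ g)) ∧
      -- the differential is `[λ μ_H, ·]`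
      ∀ f : CStar ℋ 𝒢, embed 𝒢 ℋ (D f) = NR (CStar.of _ _ 1 P) (embed 𝒢 ℋ f) := by
  have hV := isInternal_prodDeg hG.isInternal hH.isInternal
  have hQ_unique := existsUnique_semidirectElement hG hH.isInternal hρ
  have hP_unique := existsUnique_weightElement hG.isInternal hH lam
  obtain ⟨Q₀, hQ₀⟩ := hQ_unique.exists
  obtain ⟨P₀, hP₀⟩ := hP_unique.exists
  refine ⟨existsUnique_deformationBracket hV hH.isInternal hQ₀,
    existsUnique_deformationDifferential hV hH.isInternal hP₀,
    ⟨nr hV, isNRBracket_nr hV, fun _ h => h.eq_nr hV⟩, hQ_unique, hP_unique,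
    fun br D NR Q P hbr hD hNR hQ hP => ?_⟩
  -- By uniqueness any bracket satisfying the defining formula is the constructed one, so the
  -- results on `nr` apply to it.
  obtain rfl := hNR.eq_nr hV
  exact ⟨isDGLieAlgebra_deformation hG hH hρ hbr hD hQ hP, isGradedLieAlgebra_nr hV,
    hbr.embed_apply hV hQ, hD.embed_apply hV hP⟩
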